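/- Let $n\ge 1$, $0<\alpha<2$, $0\le s<\alpha<n$, $1<q<2<p<2^*_\alpha(s):=\frac{2(n-s)}{n-\alpha}$ and $\gamma<\gamma_H(\alpha):=2^\alpha\,\Gamma\!\left(\frac{n+\alpha}{4}\right)^2\big/\,\Gamma\!\left(\frac{n-\alpha}{4}\right)^2$ (the best constant in the fractional Hardy inequality on $\mathbb R^n$). Let $\Omega\subset\mathbb R^n$ be a smooth bounded domain with $0\in\Omega$, and let $f,g\in C(\overline\Omega)$, possibly changing sign, with $f^+\not\equiv0$ and $g^+\not\equiv0$. Let $X_0^{\alpha/2}(\Omega)$ be the space of all $u\in L^2(\mathbb R^n)$ with $u=0$ a.e. in $\mathbb R^n\setminus\Omega$ and $\iint_{\mathbb R^n\times\mathbb R^n}\frac{|u(x)-u(y)|^2}{|x-y|^{n+\alpha}}\,dx\,dy<\infty$, put $$\langle u,v\rangle=\iint_{\mathbb R^n\times\mathbb R^n}\frac{(u(x)-u(y))(v(x)-v(y))}{|x-y|^{n+\alpha}}\,dx\,dy,\qquad c(n,\alpha)=\frac{2^{\alpha-1}\Gamma(\frac{n+\alpha}{2})}{\pi^{n/2}|\Gamma(-\frac\alpha2)|},$$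 $$\|u\|^2=c(n,\alpha)\langle u,u\rangle-\gamma\int_\Omega\frac{|u|^2}{|x|^\alpha}\,dx,$$ and for $\lambda>0$ $$I_\lambda(u)=\tfrac12\|u\|^2-\tfrac\lambda q\int_\Omega f|u|^q\,dx-\tfrac1p\int_\Omega g\frac{|u|^p}{|x|^s}\,dx .$$ Let $\mathcal N$ be the set of $u\in X_0^{\alpha/2}(\Omega)$ with $\|u\|^2=\lambda\int_\Omega f|u|^q\,dx+\int_\Omega g\frac{|u|^p}{|x|^s}\,dx$, and let $\mathcal N^+$ (respectively $\mathcal N^-$) be the set of $u\in\mathcal N$ for which $$2\|u\|^2-\lambda q\int_\Omega f|u|^q\,dx-p\int_\Omega g\frac{|u|^p}{|x|^s}\,dx$$ is positive (respectively negative). Then there is $\Lambda>0$ such that for every $\lambda\in(0,\Lambda)$ the problem $$(-\Delta)^{\alpha/2}u-\gamma\frac{u}{|x|^\alpha}=\lambda f|u|^{q-2}u+g\frac{|u|^{p-2}u}{|x|^s}\ \text{ in }\Omega,\qquad u=0\ \text{ in }\mathbb R^n\setminus\Omega,$$ has at least two distinct positive weak solutions $u_+$ and $u_-$, where $u_+\in\mathcal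 N^+$ minimizes $I_\lambda$ over $\mathcal N^+$ and $u_-\in\mathcal N^-$ minimizes $I_\lambda$ over $\mathcal N^-$. Here $u$ is a positive weak solution if $u\in X_0^{\alpha/2}(\Omega)$, $u>0$ a.e. in $\Omega$, and for every $v\in X_0^{\alpha/2}(\Omega)$ the integrals below converge and $$c(n,\alpha)\langle u,v\rangle-\gamma\int_\Omega\frac{uv}{|x|^\alpha}\,dx=\lambda\int_\Omega f|u|^{q-2}uv\,dx+\int_\Omega g\frac{|u|^{p-2}uv}{|x|^s}\,dx .$$ -/

import Mathlib

open MeasureTheory Set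
open scoped ContDiff

noncomputable section

namespace FracHardy

/-- `ℝⁿ` with its Euclidean norm. -/
abbrev Rn (n : ℕ) : Type := EuclideanSpace ℝ (Fin n)

/-- A smooth bounded domain: a bounded, connected (in particular nonempty) open set which, near each
of its boundary points, is the sublevel set `{ρ < 0}` of a smooth function `ρ` whose differential
does not vanish at that point. -/
structure IsSmoothBoundedDomain {n : ℕ} (Ω : Set (Rn n)) : Prop where
  isOpen : IsOpen Ω
  isConnected : IsConnected Ω
  isBounded : Bornology.IsBounded Ω
  smooth_boundary : ∀ x ∈ frontier Ω, ∃ U : Set (Rn n), IsOpen U ∧ x ∈ U ∧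
    ∃ ρ : Rn n → ℝ, ContDiffOn ℝ ∞ ρ U ∧ fderiv ℝ ρ x ≠ 0 ∧ Ω ∩ U = {y ∈ U | ρ y < 0}

/-- The constant `c(n,α)`, normalised so that
`c(n,α) ∬ |u(x)-u(y)|² / |x-y|^(n+α) = ∫ |ξ|^α |û(ξ)|²`. -/
def cConst (n : ℕ) (α : ℝ) : ℝ :=
  2 ^ (α - 1) * Real.Gamma (((n : ℝ) + α) / 2) /
    (Real.pi ^ ((n : ℝ) / 2) * |Real.Gamma (-α / 2)|)

/-- The sharp constant `γ_H(α) = 2^α Γ((n+α)/4)² / Γ((n-α)/4)²` of the fractional Hardy inequality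
on `ℝⁿ`. -/
def gammaH (n : ℕ) (α : ℝ) : ℝ :=
  2 ^ α * Real.Gamma (((n : ℝ) + α) / 4) ^ 2 / Real.Gamma (((n : ℝ) - α) / 4) ^ 2

/-- The critical exponent `2*_α(s) = 2(n-s)/(n-α)`. -/
def critExp (n : ℕ) (α s : ℝ) : ℝ := 2 * ((n : ℝ) - s) / ((n : ℝ) - α)

/-- Integrand of the Gagliardo scalar product. -/
def gagliardoIntegrand {n : ℕ} (α : ℝ) (u v : Rn n → ℝ) (z : Rn n × Rn n) : ℝ :=
  (u z.1 - u z.2) * (v z.1 - v z.2) / ‖z.1 - z.2‖ ^ ((n : ℝ) + α)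

/-- The scalar product `∬ (u(x)-u(y)) (v(x)-v(y)) / |x-y|^(n+α) dx dy`. -/
def gagliardo {n : ℕ} (α : ℝ) (u v : Rn n → ℝ) : ℝ :=
  ∫ z : Rn n × Rn n, gagliardoIntegrand α u v z

/-- `u ∈ H^{α/2}(ℝⁿ)`: `u` is in `L²` and its Gagliardo seminorm is finite. -/
def MemH {n : ℕ} (α : ℝ) (u : Rn n → ℝ) : Prop :=
  MemLp u 2 volume ∧ Integrable (gagliardoIntegrand α u u) volume

/-- The space `X₀^{α/2}(Ω)` of the functions of `H^{α/2}(ℝⁿ)` vanishing a.e. outside `Ω`. Elements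
are represented by functions; two functions that agree a.e. are the same element. -/
def X0 {n : ℕ} (α : ℝ) (Ω : Set (Rn n)) : Set (Rn n → ℝ) :=
  {u | MemH α u ∧ ∀ᵐ x ∂(volume.restrict Ωᶜ), u x = 0}

/-- `‖u‖² = c(n,α) ∬ |u(x)-u(y)|² / |x-y|^(n+α) dx dy - γ ∫_Ω |u|² / |x|^α dx`. -/
def normSq {n : ℕ} (α γ : ℝ) (Ω : Set (Rn n)) (u : Rn n → ℝ) : ℝ :=
  cConst n α * gagliardo α u u - γ * ∫ x in Ω, |u x| ^ 2 / ‖x‖ ^ α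

/-- `∫_Ω f |u|^q dx`. -/
def concaveTerm {n : ℕ} (q : ℝ) (Ω : Set (Rn n)) (f u : Rn n → ℝ) : ℝ :=
  ∫ x in Ω, f x * |u x| ^ q

/-- `∫_Ω g |u|^p / |x|^s dx`. -/
def convexTerm {n : ℕ} (s p : ℝ) (Ω : Set (Rn n)) (g u : Rn n → ℝ) : ℝ :=
  ∫ x in Ω, g x * (|u x| ^ p / ‖x‖ ^ s)

/-- The energy functional `I_{λ,p}`. -/
def energy {n : ℕ} (α s q p γ lam : ℝ) (Ω : Set (Rn n)) (f g u : Rn n → ℝ) : ℝ :=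
  1 / 2 * normSq α γ Ω u - lam / q * concaveTerm q Ω f u - 1 / p * convexTerm s p Ω g u

/-- `φ_{λ,p}(u) = ⟨I'_{λ,p}(u), u⟩`. -/
def nehariFun {n : ℕ} (α s q p γ lam : ℝ) (Ω : Set (Rn n)) (f g u : Rn n → ℝ) : ℝ :=
  normSq α γ Ω u - lam * concaveTerm q Ω f u - convexTerm s p Ω g u

/-- `⟨φ'_{λ,p}(u), u⟩`. -/
def nehariFunDeriv {n : ℕ} (α s q p γ lam : ℝ) (Ω : Set (Rn n)) (f g u : Rn n → ℝ) : ℝ :=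
  2 * normSq α γ Ω u - lam * q * concaveTerm q Ω f u - p * convexTerm s p Ω g u

/-- The Nehari set `𝒩`. -/
def nehari {n : ℕ} (α s q p γ lam : ℝ) (Ω : Set (Rn n)) (f g : Rn n → ℝ) : Set (Rn n → ℝ) :=
  {u | u ∈ X0 α Ω ∧ nehariFun α s q p γ lam Ω f g u = 0}

/-- The part `𝒩⁺` of the Nehari set. -/
def nehariPlus {n : ℕ} (α s q p γ lam : ℝ) (Ω : Set (Rn n)) (f g : Rn n → ℝ) :
    Set (Rn n → ℝ) :=
  {u | u ∈ nehari α s q p γ lam Ω f g ∧ 0 < nehariFunDeriv α s q p γ lam Ω f g u}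

/-- The part `𝒩⁻` of the Nehari set. -/
def nehariMinus {n : ℕ} (α s q p γ lam : ℝ) (Ω : Set (Rn n)) (f g : Rn n → ℝ) :
    Set (Rn n → ℝ) :=
  {u | u ∈ nehari α s q p γ lam Ω f g ∧ nehariFunDeriv α s q p γ lam Ω f g u < 0}

/-- Weak solutions of
`(-Δ)^{α/2} u - γ u / |x|^α = λ f |u|^{q-2} u + g |u|^{p-2} u / |x|^s` in `Ω`, `u = 0` outside `Ω`.
All integrals in the weak formulation are required to converge (the Gagliardo scalar product of
two elements of `X₀^{α/2}(Ω)` always does). -/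
def IsWeakSolution {n : ℕ} (α s q p γ lam : ℝ) (Ω : Set (Rn n)) (f g u : Rn n → ℝ) : Prop :=
  u ∈ X0 α Ω ∧ ∀ v ∈ X0 α Ω,
    IntegrableOn (fun x => u x * v x / ‖x‖ ^ α) Ω ∧
    IntegrableOn (fun x => f x * |u x| ^ (q - 2) * u x * v x) Ω ∧
    IntegrableOn (fun x => g x * (|u x| ^ (p - 2) * u x * v x / ‖x‖ ^ s)) Ω ∧
    cConst n α * gagliardo α u v - γ * ∫ x in Ω, u x * v x / ‖x‖ ^ α =
      lam * (∫ x in Ω, f x * |u x| ^ (q - 2) * u x * v x) +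
        ∫ x in Ω, g x * (|u x| ^ (p - 2) * u x * v x / ‖x‖ ^ s)

/-- A positive solution: a weak solution with `u > 0` a.e. in `Ω`. -/
def IsPositiveSolution {n : ℕ} (α s q p γ lam : ℝ) (Ω : Set (Rn n)) (f g u : Rn n → ℝ) : Prop :=
  IsWeakSolution α s q p γ lam Ω f g u ∧ ∀ᵐ x ∂(volume.restrict Ω), 0 < u x

end FracHardy

end

/-! Write `Q` for `normSq`, `F` and `G` for the concave and convex integrals, so that the energy is
`Q/2 - λF/q - G/p`. Hardy's inequality with `γ` below the sharp constant makes `Q` equivalent to the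
Gagliardo form, and the weighted embeddings give `|F| ≤ C Q^(q/2)` and `|G| ≤ C Q^(p/2)`. Since `q <
2 < p`, for small `λ` there is a sphere `Q = ρ` on which the energy is positive and radially
increasing, with all of `𝒩⁺` inside it and all of `𝒩⁻` outside it (`exists_separates`).

Inside the ball the energy takes negative values near `0` along any direction with `F > 0`, so a
minimizer over the ball is interior and nonzero, hence a free critical point lying in `𝒩⁺`. Outside,
the energy is coercive on the Nehari set and a Nehari point maximizes the energy along the part of
its ray beyond the sphere (`fibering_le`). For a minimizing sequence `u_k` with weak limit `w`, one
rescales `|w|` back to the Nehari set by some `t` and compares with `t u_k`, whose energy is at most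
that of `u_k`; weak lower semicontinuity is then enough. The minimizer is critical by a perturbation
argument (`nonneg_of_outer_minimizer`). Both minimizers are absolute values, up to a positive
factor, so they are nonnegative, and the strong maximum principle (`IsWeakSolution.pos`) makes them
positive.

The analytic input is obtained as follows. The Gagliardo kernel is an integral over time of heat
kernels; a ground state inequality for each heat kernel, with the Riesz kernel `|x|^(-(n-α)/2)` as
ground state, integrates to Hardy's inequality with its sharp constant (`hardy_of_bounded`,
`hardy`). Hardy's inequality centred at every point gives a pointwise bound (`sq_le_density`) and
from it the critical Sobolev inequality; interpolation gives Hardy-Sobolev. Compactness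
(`X0.exists_ae_subseq`) comes from comparing functions with their averages over small balls. -/

open Filter Topology

namespace FracHardy

/-! ### Concave-convex problems in an abstract setting -/

/-- Along a ray through a point of the Nehari set, the energy is maximal at that point among the
parameters beyond any `t₀ < 1` at which the energy increases. -/
theorem fibering_le {A L G q p t₀ t : ℝ} (hq : 1 < q) (hq2 : q < 2) (hp : 2 < p)
    (hA : A = L + G) (hG : 0 < G) (ht₀ : 0 < t₀) (ht₀1 : t₀ < 1)
    (h0 : 0 < t₀ ^ 2 * A - t₀ ^ q * L - t₀ ^ p * G) (ht : t₀ ≤ t) :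
    1 / 2 * (t ^ 2 * A) - 1 / q * (t ^ q * L) - 1 / p * (t ^ p * G) ≤
      1 / 2 * A - 1 / q * L - 1 / p * G := by
  -- With `z = x ^ (2 - q)` the Nehari function along the ray is `x ^ q * K z`. As `m ≥ 1` and `G >
  -- 0`, `K` is concave, and `A = L + G` gives `K 1 = 0`. A concave function that vanishes at `1`
  -- and is positive at an earlier point is nonnegative between the two and nonpositive beyond `1`;
  -- this is the sign of the derivative of the energy along the ray.
  set m : ℝ := (p - q) / (2 - q) with hm
  have h2q : 0 < 2 - q := by linarith
  have hm1 : 1 ≤ m := by rw [hm, le_div_iff₀ h2q]; linarith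
  set K : ℝ → ℝ := fun z => A * (z - 1) - G * (z ^ m - 1) with hK
  have hKc : ConcaveOn ℝ (Ici 0) K := by
    have h1 : ConcaveOn ℝ (Ici (0 : ℝ)) fun z : ℝ => -(G * z ^ m) :=
      ((convexOn_rpow hm1).smul hG.le).neg
    have h2 : ConcaveOn ℝ (Ici (0 : ℝ)) fun z : ℝ => A * z + (G - A) := by
      refine ⟨convex_Ici 0, fun x _ y _ a b _ _ hab => ?_⟩
      simp only [smul_eq_mul]
      have : (G - A) = (a + b) * (G - A) := by rw [hab, one_mul]
      nlinarith
    refine (h1.add h2).congr fun z _ => ?_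
    simp only [hK, Pi.add_apply]; ring
  have hfac : ∀ x : ℝ, 0 < x →
      x ^ 2 * A - x ^ q * L - x ^ p * G = x ^ q * K (x ^ (2 - q)) := by
    intro x hx
    have e1 : (x ^ (2 - q)) ^ m = x ^ (p - q) := by
      rw [← Real.rpow_mul hx.le, hm]; congr 1; field_simp
    have e2 : x ^ 2 = x ^ q * x ^ (2 - q) := by
      rw [← Real.rpow_add hx, ← Real.rpow_natCast]; congr 1; push_cast; ring
    have e3 : x ^ p = x ^ q * x ^ (p - q) := by
      rw [← Real.rpow_add hx]; congr 1; ring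
    simp only [hK, e1]
    rw [e2, e3, hA]; ring
  have hK1 : K 1 = 0 := by simp [hK]
  have hKz : 0 < K (t₀ ^ (2 - q)) := by
    rw [hfac t₀ ht₀] at h0
    exact (pos_iff_pos_of_mul_pos h0).1 (Real.rpow_pos_of_pos ht₀ q)
  have hz0 : (0 : ℝ) ≤ t₀ ^ (2 - q) := (Real.rpow_pos_of_pos ht₀ _).le
  have hlow : ∀ x, t₀ ≤ x → x ≤ 1 → 0 ≤ x ^ 2 * A - x ^ q * L - x ^ p * G := by
    intro x hx hx1
    have hx0 := ht₀.trans_le hx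
    rw [hfac x hx0]
    refine mul_nonneg (Real.rpow_pos_of_pos hx0 q).le ?_
    have := hKc.min_le_of_mem_Icc hz0 (by simp : (1 : ℝ) ∈ Ici (0 : ℝ))
      (z := x ^ (2 - q)) ⟨Real.rpow_le_rpow ht₀.le hx h2q.le, Real.rpow_le_one hx0.le hx1 h2q.le⟩
    rw [hK1, min_eq_right hKz.le] at this
    exact this
  have hhigh : ∀ x, 1 ≤ x → x ^ 2 * A - x ^ q * L - x ^ p * G ≤ 0 := by
    intro x hx1
    have hx0 : (0 : ℝ) < x := by linarith
    rw [hfac x hx0]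
    refine mul_nonpos_of_nonneg_of_nonpos (Real.rpow_pos_of_pos hx0 q).le ?_
    by_contra! hc
    have := hKc.min_le_of_mem_Icc hz0 (Real.rpow_pos_of_pos hx0 (2 - q)).le
      (z := 1) ⟨Real.rpow_le_one ht₀.le ht₀1.le h2q.le, Real.one_le_rpow hx1 h2q.le⟩
    rw [hK1] at this
    exact absurd (lt_min hKz hc) (not_lt.2 this)
  set h : ℝ → ℝ := fun x => 1 / 2 * (x ^ 2 * A) - 1 / q * (x ^ q * L) - 1 / p * (x ^ p * G) with hh
  have hd : ∀ x, 0 < x → HasDerivAt h (x⁻¹ * (x ^ 2 * A - x ^ q * L - x ^ p * G)) x := by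
    intro x hx
    have d1 : HasDerivAt (fun x : ℝ => x ^ 2) (2 * x) x := by simpa using hasDerivAt_pow 2 x
    have d2 := Real.hasDerivAt_rpow_const (x := x) (p := q) (Or.inl hx.ne')
    have d3 := Real.hasDerivAt_rpow_const (x := x) (p := p) (Or.inl hx.ne')
    have := (((d1.mul_const A).const_mul (1 / 2)).sub ((d2.mul_const L).const_mul (1 / q))).sub
      ((d3.mul_const G).const_mul (1 / p))
    refine this.congr_deriv ?_
    rw [Real.rpow_sub_one hx.ne', Real.rpow_sub_one hx.ne']
    field_simp
  have hone : h 1 = 1 / 2 * A - 1 / q * L - 1 / p * G := by simp [hh]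
  rw [← hone]
  change h t ≤ h 1
  rcases le_total t 1 with ht1 | ht1
  · have : MonotoneOn h (Icc t₀ 1) := by
      refine monotoneOn_of_deriv_nonneg (convex_Icc _ _)
        (fun x hx => (hd x (ht₀.trans_le hx.1)).continuousAt.continuousWithinAt)
        (fun x hx => ?_) (fun x hx => ?_) <;> rw [interior_Icc] at hx
      · exact (hd x (ht₀.trans hx.1)).differentiableAt.differentiableWithinAt
      · rw [(hd x (ht₀.trans hx.1)).deriv]
        exact mul_nonneg (inv_nonneg.2 (ht₀.trans hx.1).le) (hlow x hx.1.le hx.2.le)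
    exact this ⟨ht, ht1⟩ ⟨ht₀1.le, le_rfl⟩ ht1
  · have : AntitoneOn h (Ici 1) := by
      refine antitoneOn_of_deriv_nonpos (convex_Ici _)
        (fun x hx => (hd x (one_pos.trans_le hx)).continuousAt.continuousWithinAt)
        (fun x hx => ?_) (fun x hx => ?_) <;> rw [interior_Ici] at hx
      · exact (hd x (one_pos.trans hx)).differentiableAt.differentiableWithinAt
      · rw [(hd x (one_pos.trans hx)).deriv]
        exact mul_nonpos_of_nonneg_of_nonpos (inv_nonneg.2 (one_pos.trans hx).le)
          (hhigh x (le_of_lt hx))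
    exact this (mem_Ici.2 le_rfl) ht1 ht1

/-- Data of a concave-convex variational problem on a real vector space: a quadratic form `Q` with
polar form `B`, a `q`-homogeneous term `F` and a `p`-homogeneous term `G` with directional
derivatives `q dF` and `p dG`, and a map `absV` lowering `Q` and preserving `F` and `G`. -/
structure ConcaveConvex {V : Type*} [AddCommGroup V] [Module ℝ V] (q p : ℝ) (Q F G : V → ℝ)
    (B dF dG : V → V → ℝ) (absV : V → V) : Prop where
  one_lt_q : 1 < q
  q_lt_two : q < 2
  two_lt_p : 2 < p
  Q_nonneg : ∀ u, 0 ≤ Q u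
  Q_smul : ∀ (t : ℝ) u, Q (t • u) = t ^ 2 * Q u
  Q_add : ∀ u v (ε : ℝ), Q (u + ε • v) = Q u + 2 * ε * B u v + ε ^ 2 * Q v
  B_self : ∀ u, B u u = Q u
  F_smul : ∀ (t : ℝ) u, 0 < t → F (t • u) = t ^ q * F u
  G_smul : ∀ (t : ℝ) u, 0 < t → G (t • u) = t ^ p * G u
  F_bound : ∃ c, ∀ u, |F u| ≤ c * Q u ^ (q / 2)
  G_bound : ∃ c, ∀ u, |G u| ≤ c * Q u ^ (p / 2)
  F_deriv : ∀ u v, HasDerivAt (fun ε : ℝ => F (u + ε • v)) (q * dF u v) 0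
  G_deriv : ∀ u v, HasDerivAt (fun ε : ℝ => G (u + ε • v)) (p * dG u v) 0
  dF_self : ∀ u, dF u u = F u
  dG_self : ∀ u, dG u u = G u
  -- Only convergence of the lower-order terms and lower semicontinuity of `Q` are asked for. No
  -- strong convergence is needed, so `V` carries no topology.
  compact : ∀ (u : ℕ → V) (M : ℝ), (∀ k, Q (u k) ≤ M) → ∃ (w : V) (σ : ℕ → ℕ), StrictMono σ ∧
    Tendsto (fun k => F (u (σ k))) atTop (𝓝 (F w)) ∧
    Tendsto (fun k => G (u (σ k))) atTop (𝓝 (G w)) ∧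
    ∀ ε > 0, ∀ᶠ k in atTop, Q w - ε ≤ Q (u (σ k))
  Q_abs : ∀ u, Q (absV u) ≤ Q u
  F_abs : ∀ u, F (absV u) = F u
  G_abs : ∀ u, G (absV u) = G u
  F_pos : ∃ u, 0 < F u
  G_pos : ∃ u, 0 < G u

namespace ConcaveConvex

variable {V : Type*} [AddCommGroup V] [Module ℝ V] {q p : ℝ} {Q F G : V → ℝ}
  {B dF dG : V → V → ℝ} {absV : V → V}

/-- For small `l`, a sphere `Q = ρ` separates the two parts of the Nehari set, and on it the energy
is positive and radially increasing. -/
structure Separates {V : Type*} (q p : ℝ) (Q F G : V → ℝ) (l ρ : ℝ) : Prop where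
  l_pos : 0 < l
  pos : 0 < ρ
  radial : ∀ u, Q u = ρ → 0 < Q u - l * F u - G u
  energy : ∀ u, Q u = ρ → 0 < 1 / 2 * Q u - l / q * F u - 1 / p * G u
  -- The sign conditions here and in `outer` are not strict, so together they also exclude
  -- degenerate Nehari points with `Q u > 0`.
  inner : ∀ u, 0 < Q u → Q u - l * F u - G u = 0 → 0 ≤ 2 * Q u - l * q * F u - p * G u → Q u < ρ
  outer : ∀ u, 0 < Q u → Q u - l * F u - G u = 0 → 2 * Q u - l * q * F u - p * G u ≤ 0 → ρ < Q u

/-- On the Nehari set the derivative `2Q - lqF - pG` equals both `(p-q) l F - (p-2) Q` and `(2-q) Q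
- (p-q) G`. If it is nonnegative, the first form and the bound on `F` force `Q` to be small with
`l`; if it is nonpositive, the second form and the bound on `G` keep `Q` away from `0` independently
of `l`. The radius `ρ` is fixed by the second alternative, then `Λ` by the first. -/
theorem exists_separates (H : ConcaveConvex q p Q F G B dF dG absV) :
    ∃ ρ Λ : ℝ, 0 < Λ ∧ ∀ l, 0 < l → l < Λ → Separates q p Q F G l ρ := by
  have hq1 := H.one_lt_q
  have hq2 := H.q_lt_two
  have hp2 := H.two_lt_p
  obtain ⟨c₁', h₁'⟩ := H.F_bound
  obtain ⟨c₂', h₂'⟩ := H.G_bound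
  obtain ⟨c₁, hc₁, h₁⟩ : ∃ c > 0, ∀ u, F u ≤ c * Q u ^ (q / 2) :=
    ⟨max c₁' 1, by positivity, fun u => (le_abs_self _).trans ((h₁' u).trans
      (mul_le_mul_of_nonneg_right (le_max_left _ _) (Real.rpow_nonneg (H.Q_nonneg u) _)))⟩
  obtain ⟨c₂, hc₂, h₂⟩ : ∃ c > 0, ∀ u, G u ≤ c * Q u ^ (p / 2) :=
    ⟨max c₂' 1, by positivity, fun u => (le_abs_self _).trans ((h₂' u).trans
      (mul_le_mul_of_nonneg_right (le_max_left _ _) (Real.rpow_nonneg (H.Q_nonneg u) _)))⟩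
  have hpq : 0 < p - q := by linarith
  -- `δ` will be `ρ ^ (p/2 - 1)`. The first bound gives `G ≤ ρ/4` on the sphere; the second is
  -- incompatible with `(2-q) Q ≤ (p-q) G` inside the ball.
  obtain ⟨δ, hδ, hδ4, hδq⟩ : ∃ δ > 0, c₂ * δ ≤ 1 / 4 ∧ (p - q) * (c₂ * δ) < 2 - q := by
    refine ⟨min (1 / 4) ((2 - q) / (2 * (p - q))) / c₂, by
      have : 0 < 2 - q := by linarith
      positivity, ?_, ?_⟩ <;> rw [mul_div_cancel₀ _ hc₂.ne']
    · exact min_le_left _ _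
    · calc (p - q) * min (1 / 4) ((2 - q) / (2 * (p - q)))
          ≤ (p - q) * ((2 - q) / (2 * (p - q))) :=
            mul_le_mul_of_nonneg_left (min_le_right _ _) hpq.le
        _ = (2 - q) / 2 := by field_simp
        _ < 2 - q := by linarith
  set ρ : ℝ := δ ^ (2 / (p - 2)) with hρ
  have hρ0 : 0 < ρ := Real.rpow_pos_of_pos hδ _
  have hρδ : ρ ^ (p / 2 - 1) = δ := by
    rw [hρ, ← Real.rpow_mul hδ.le]
    have : 2 / (p - 2) * (p / 2 - 1) = 1 := by
      have : p - 2 ≠ 0 := by linarith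
      field_simp
    rw [this, Real.rpow_one]
  have hsplit : ∀ (x e : ℝ), 0 < x → x ^ e = x * x ^ (e - 1) := by
    intro x e hx
    rw [Real.rpow_sub_one hx.ne']; field_simp
  set η : ℝ := ρ ^ (q / 2 - 1) with hη
  have hη0 : 0 < η := Real.rpow_pos_of_pos hρ0 _
  -- The `1/8` gives `l F < ρ/8` on the sphere, which leaves both the radial derivative and the
  -- energy positive there. The other entry is incompatible with `(p-2) Q ≤ (p-q) l F` outside the
  -- ball.
  refine ⟨ρ, min (1 / 8) ((p - 2) / (p - q)) / (c₁ * η), ?_, fun l hl hlΛ => ?_⟩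
  · have : 0 < p - 2 := by linarith
    positivity
  rw [lt_div_iff₀ (by positivity)] at hlΛ
  have hl8 : l * (c₁ * η) < 1 / 8 := hlΛ.trans_le (min_le_left _ _)
  have hlp : (p - q) * (l * (c₁ * η)) < p - 2 := by
    have := hlΛ.trans_le (min_le_right _ _)
    rwa [lt_div_iff₀ hpq, mul_comm] at this
  have hF8 : ∀ u, Q u = ρ → l * F u < ρ / 8 := by
    intro u hu
    have h := h₁ u
    rw [hu, hsplit ρ _ hρ0, ← hη] at h
    nlinarith [mul_le_mul_of_nonneg_left h hl.le]
  have hG4 : ∀ u, Q u = ρ → G u ≤ ρ / 4 := by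
    intro u hu
    have h := h₂ u
    rw [hu, hsplit ρ _ hρ0, hρδ] at h
    nlinarith
  refine ⟨hl, hρ0, fun u hu => ?_, fun u hu => ?_, fun u hu hN hd => ?_, fun u hu hN hd => ?_⟩
  · have := hF8 u hu; have := hG4 u hu; linarith
  · have h1 : l / q * F u ≤ ρ / 8 := by
      have e : l / q * F u = 1 / q * (l * F u) := by ring
      have hq' : 1 / q ≤ 1 := by rw [div_le_one (by linarith)]; linarith
      have hq0 : 0 ≤ 1 / q := by positivity
      rw [e]
      calc 1 / q * (l * F u) ≤ 1 / q * (ρ / 8) :=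
            mul_le_mul_of_nonneg_left (hF8 u hu).le hq0
        _ ≤ ρ / 8 := by nlinarith
    have h2 : 1 / p * G u ≤ ρ / 8 := by
      have hp' : 1 / p ≤ 1 / 2 := one_div_le_one_div_of_le (by norm_num) hp2.le
      have hp0 : 0 ≤ 1 / p := by positivity
      calc 1 / p * G u ≤ 1 / p * (ρ / 4) := mul_le_mul_of_nonneg_left (hG4 u hu) hp0
        _ ≤ ρ / 8 := by nlinarith
    rw [hu]; linarith
  · by_contra! hc
    have h3 : (p - 2) * Q u ≤ (p - q) * (l * F u) := by nlinarith
    have h4 : l * F u ≤ l * (c₁ * η) * Q u := by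
      have h := h₁ u
      rw [hsplit _ _ hu] at h
      have h5 : Q u ^ (q / 2 - 1) ≤ η :=
        Real.rpow_le_rpow_of_nonpos hρ0 hc (by linarith)
      calc l * F u ≤ l * (c₁ * (Q u * Q u ^ (q / 2 - 1))) := mul_le_mul_of_nonneg_left h hl.le
        _ ≤ l * (c₁ * (Q u * η)) := by gcongr
        _ = _ := by ring
    have h6 := mul_le_mul_of_nonneg_left h4 hpq.le
    nlinarith [mul_lt_mul_of_pos_right hlp hu]
  · by_contra! hc
    have h3 : (2 - q) * Q u ≤ (p - q) * G u := by nlinarith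
    have h4 : G u ≤ c₂ * δ * Q u := by
      have h := h₂ u
      rw [hsplit _ _ hu] at h
      have h5 : Q u ^ (p / 2 - 1) ≤ δ := by
        rw [← hρδ]; exact Real.rpow_le_rpow hu.le hc (by linarith)
      calc G u ≤ c₂ * (Q u * Q u ^ (p / 2 - 1)) := h
        _ ≤ c₂ * (Q u * δ) := by gcongr
        _ = _ := by ring
    nlinarith [mul_le_mul_of_nonneg_left h4 hpq.le, mul_lt_mul_of_pos_right hδq hu]

end ConcaveConvex
end FracHardy

/-! ### Minimizers of the energy inside and outside the separating sphere. -/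

namespace FracHardy
namespace ConcaveConvex

variable {V : Type*} [AddCommGroup V] [Module ℝ V] {q p l ρ : ℝ} {Q F G : V → ℝ}
  {B dF dG : V → V → ℝ} {absV : V → V}

theorem tendsto_Q (H : ConcaveConvex q p Q F G B dF dG absV) (u v : V) :
    Tendsto (fun ε : ℝ => Q (u + ε • v)) (𝓝 0) (𝓝 (Q u)) := by
  have : Continuous fun ε : ℝ => Q u + 2 * ε * B u v + ε ^ 2 * Q v := by fun_prop
  have h := this.tendsto 0
  simp only [mul_zero, zero_mul, add_zero, ne_eq, OfNat.ofNat_ne_zero, not_false_eq_true,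
    zero_pow] at h
  exact h.congr fun ε => (H.Q_add u v ε).symm

theorem hasDerivAt_Q (H : ConcaveConvex q p Q F G B dF dG absV) (u v : V) :
    HasDerivAt (fun ε : ℝ => Q (u + ε • v)) (2 * B u v) 0 := by
  have h1 : HasDerivAt (fun ε : ℝ => Q u + ε * (2 * B u v) + ε ^ 2 * Q v) (2 * B u v) 0 := by
    have := ((hasDerivAt_id (0 : ℝ)).mul_const (2 * B u v)).const_add (Q u)
    have h2 := ((hasDerivAt_pow 2 (0 : ℝ)).mul_const (Q v))
    exact (this.add h2).congr_deriv (by simp)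
  refine h1.congr_of_eventuallyEq (Eventually.of_forall fun ε => ?_)
  simp only [H.Q_add u v ε]; ring

theorem Q_pos_of_G_pos (H : ConcaveConvex q p Q F G B dF dG absV) {u : V} (hu : 0 < G u) :
    0 < Q u := by
  obtain ⟨c, hc⟩ := H.G_bound
  refine lt_of_le_of_ne (H.Q_nonneg u) fun h => ?_
  have h1 := hc u
  rw [← h, Real.zero_rpow (by linarith [H.two_lt_p]), mul_zero] at h1
  exact hu.ne' (abs_nonpos_iff.1 h1)

theorem Q_pos_of_F_pos (H : ConcaveConvex q p Q F G B dF dG absV) {u : V} (hu : 0 < F u) :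
    0 < Q u := by
  obtain ⟨c, hc⟩ := H.F_bound
  refine lt_of_le_of_ne (H.Q_nonneg u) fun h => ?_
  have h1 := hc u
  rw [← h, Real.zero_rpow (by linarith [H.one_lt_q]), mul_zero] at h1
  exact hu.ne' (abs_nonpos_iff.1 h1)

/-- Passage to the limit in an upper bound for a lower semicontinuous combination. -/
theorem le_of_lsc {Qs Fs Gs a : ℕ → ℝ} {Q₀ F₀ G₀ c₀ c₁ c₂ L : ℝ} (hc₀ : 0 < c₀)
    (hF : Tendsto Fs atTop (𝓝 F₀)) (hG : Tendsto Gs atTop (𝓝 G₀))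
    (hQ : ∀ ε > 0, ∀ᶠ k in atTop, Q₀ - ε ≤ Qs k) (ha : Tendsto a atTop (𝓝 L))
    (hle : ∀ᶠ k in atTop, c₀ * Qs k - c₁ * Fs k - c₂ * Gs k ≤ a k) :
    c₀ * Q₀ - c₁ * F₀ - c₂ * G₀ ≤ L := by
  refine le_of_forall_pos_le_add fun ε hε => ?_
  have h1 : Tendsto (fun k => a k + c₁ * Fs k + c₂ * Gs k) atTop (𝓝 (L + c₁ * F₀ + c₂ * G₀)) :=
    (ha.add (hF.const_mul c₁)).add (hG.const_mul c₂)
  have h2 : c₀ * (Q₀ - ε / c₀) ≤ L + c₁ * F₀ + c₂ * G₀ := by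
    refine ge_of_tendsto h1 ?_
    filter_upwards [hQ (ε / c₀) (by positivity), hle] with k hk hk'
    nlinarith [mul_le_mul_of_nonneg_left hk hc₀.le]
  have h3 : c₀ * (Q₀ - ε / c₀) = c₀ * Q₀ - ε := by field_simp
  linarith

/-- The energy has a minimizer in the ball `Q ≤ ρ`, and it is an interior point. -/
theorem exists_inner_minimizer (H : ConcaveConvex q p Q F G B dF dG absV)
    (S : Separates q p Q F G l ρ) :
    ∃ w, 0 < Q (absV w) ∧ Q (absV w) < ρ ∧ ∀ v, Q v ≤ ρ →
      1 / 2 * Q (absV w) - l / q * F (absV w) - 1 / p * G (absV w) ≤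
        1 / 2 * Q v - l / q * F v - 1 / p * G v := by
  set I : V → ℝ := fun v => 1 / 2 * Q v - l / q * F v - 1 / p * G v with hI
  have hq1 := H.one_lt_q
  have hq2 := H.q_lt_two
  have hp2 := H.two_lt_p
  have hl := S.l_pos
  have hρ := S.pos
  obtain ⟨c₁, h₁⟩ := H.F_bound
  obtain ⟨c₂, h₂⟩ := H.G_bound
  -- a point with negative energy
  obtain ⟨v, hv⟩ := H.F_pos
  have hQv := H.Q_pos_of_F_pos hv
  have hneg : ∃ z, Q z ≤ ρ ∧ I z < 0 := by
    -- This is the energy at `t • v` divided by `t ^ q`: since `q < 2 < p`, the term with `F v > 0`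
    -- dominates as `t → 0`.
    have key : ∀ᶠ t : ℝ in 𝓝[>] 0, 1 / 2 * (t ^ (2 - q) * Q v) - 1 / p * (t ^ (p - q) * G v)
        < l / q * F v ∧ t ^ 2 * Q v < ρ := by
      refine Filter.Eventually.and ?_ ?_
      · have h0 : Tendsto (fun t : ℝ => 1 / 2 * (t ^ (2 - q) * Q v) -
            1 / p * (t ^ (p - q) * G v)) (𝓝[>] 0) (𝓝 0) := by
          have e1 : ContinuousAt (fun t : ℝ => t ^ (2 - q)) 0 :=
            Real.continuousAt_rpow_const _ _ (Or.inr (by linarith))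
          have e2 : ContinuousAt (fun t : ℝ => t ^ (p - q)) 0 :=
            Real.continuousAt_rpow_const _ _ (Or.inr (by linarith))
          have e3 := ((e1.mul_const (Q v)).const_mul (1 / 2)).sub
            ((e2.mul_const (G v)).const_mul (1 / p))
          have : Tendsto (fun t : ℝ => 1 / 2 * (t ^ (2 - q) * Q v) - 1 / p * (t ^ (p - q) * G v))
              (𝓝 0) (𝓝 (1 / 2 * (0 ^ (2 - q) * Q v) - 1 / p * (0 ^ (p - q) * G v))) := e3.tendsto
          rw [Real.zero_rpow (by linarith : 2 - q ≠ 0),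
            Real.zero_rpow (by linarith : p - q ≠ 0), zero_mul, zero_mul, mul_zero, mul_zero,
            sub_zero] at this
          exact this.mono_left nhdsWithin_le_nhds
        exact h0.eventually (gt_mem_nhds (by positivity))
      · have h0 : Tendsto (fun t : ℝ => t ^ 2 * Q v) (𝓝[>] 0) (𝓝 (0 ^ 2 * Q v)) :=
          Continuous.tendsto (by fun_prop) 0 |>.mono_left nhdsWithin_le_nhds
        exact h0.eventually (gt_mem_nhds (by simpa using hρ))
    obtain ⟨t, ⟨ht1, ht2⟩, ht0⟩ := (key.and self_mem_nhdsWithin).exists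
    have ht0 : 0 < t := ht0
    refine ⟨t • v, by rw [H.Q_smul]; exact ht2.le, ?_⟩
    simp only [hI, H.Q_smul, H.F_smul _ _ ht0, H.G_smul _ _ ht0]
    have e1 : t ^ 2 = t ^ q * t ^ (2 - q) := by
      rw [← Real.rpow_add ht0, ← Real.rpow_natCast]; congr 1; push_cast; ring
    have e2 : t ^ p = t ^ q * t ^ (p - q) := by
      rw [← Real.rpow_add ht0]; congr 1; ring
    rw [e1, e2]
    nlinarith [mul_lt_mul_of_pos_left ht1 (Real.rpow_pos_of_pos ht0 q)]
  obtain ⟨z, hz, hzI⟩ := hneg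
  have hne : (I '' {v | Q v ≤ ρ}).Nonempty := ⟨_, z, hz, rfl⟩
  have hbdd : BddBelow (I '' {v | Q v ≤ ρ}) := by
    refine ⟨-(l / q * (|c₁| * ρ ^ (q / 2))) - 1 / p * (|c₂| * ρ ^ (p / 2)), ?_⟩
    rintro _ ⟨v, hv, rfl⟩
    have hb1 : F v ≤ |c₁| * ρ ^ (q / 2) := by
      refine (le_abs_self _).trans ((h₁ v).trans ?_)
      exact mul_le_mul (le_abs_self _) (Real.rpow_le_rpow (H.Q_nonneg v) hv (by linarith))
        (Real.rpow_nonneg (H.Q_nonneg v) _) (abs_nonneg _)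
    have hb2 : G v ≤ |c₂| * ρ ^ (p / 2) := by
      refine (le_abs_self _).trans ((h₂ v).trans ?_)
      exact mul_le_mul (le_abs_self _) (Real.rpow_le_rpow (H.Q_nonneg v) hv (by linarith))
        (Real.rpow_nonneg (H.Q_nonneg v) _) (abs_nonneg _)
    have hb1' := mul_le_mul_of_nonneg_left hb1 (by positivity : 0 ≤ l / q)
    have hb2' := mul_le_mul_of_nonneg_left hb2 (by positivity : 0 ≤ 1 / p)
    have := H.Q_nonneg v
    simp only [hI]; linarith
  obtain ⟨a, -, ha, hmem⟩ := exists_seq_tendsto_sInf hne hbdd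
  choose u hu huI using hmem
  obtain ⟨w, σ, hσ, hF, hG, hQ⟩ := H.compact u ρ hu
  have hIw : I w ≤ sInf (I '' {v | Q v ≤ ρ}) :=
    le_of_lsc (by norm_num) hF hG hQ (ha.comp hσ.tendsto_atTop)
      (Eventually.of_forall fun k => (huI (σ k)).le)
  have hQw : Q w ≤ ρ := by
    refine le_of_forall_pos_le_add fun ε hε => ?_
    obtain ⟨k, hk⟩ := (hQ ε hε).exists
    have : Q (u (σ k)) ≤ ρ := hu (σ k)
    linarith
  have hIabs : I (absV w) ≤ I w := by
    simp only [hI, H.F_abs, H.G_abs]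
    have := H.Q_abs w
    linarith
  have hmin : ∀ v, Q v ≤ ρ → I (absV w) ≤ I v := fun v hv =>
    hIabs.trans (hIw.trans (csInf_le hbdd ⟨v, hv, rfl⟩))
  -- Negative energy rules out `Q = 0`, where the energy vanishes, and `Q = ρ`, where it is
  -- positive.
  have hIneg : I (absV w) < 0 := (hmin z hz).trans_lt hzI
  refine ⟨w, ?_, ?_, hmin⟩
  · refine lt_of_le_of_ne (H.Q_nonneg _) fun h => ?_
    have hF0 := h₁ (absV w)
    have hG0 := h₂ (absV w)
    rw [← h, Real.zero_rpow (by linarith), mul_zero, abs_nonpos_iff] at hF0 hG0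
    simp [hI, ← h, hF0, hG0] at hIneg
  · refine lt_of_le_of_ne ((H.Q_abs w).trans hQw) fun h => ?_
    exact absurd (S.energy _ h) (not_lt.2 hIneg.le)

theorem hasDerivAt_energy (H : ConcaveConvex q p Q F G B dF dG absV) (l : ℝ) (u v : V) :
    HasDerivAt (fun ε : ℝ => 1 / 2 * Q (u + ε • v) - l / q * F (u + ε • v)
      - 1 / p * G (u + ε • v)) (B u v - l * dF u v - dG u v) 0 := by
  have hq1 := H.one_lt_q
  have hp2 := H.two_lt_p
  refine ((((H.hasDerivAt_Q u v).const_mul (1 / 2)).sub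
    ((H.F_deriv u v).const_mul (l / q))).sub ((H.G_deriv u v).const_mul (1 / p))).congr_deriv ?_
  field_simp

/-- An interior minimizer is an unconstrained local minimum along every line, so no Lagrange
multiplier arises. -/
theorem critical_of_inner_minimizer (H : ConcaveConvex q p Q F G B dF dG absV) {u : V}
    (hu : Q u < ρ) (hmin : ∀ v, Q v ≤ ρ →
      1 / 2 * Q u - l / q * F u - 1 / p * G u ≤ 1 / 2 * Q v - l / q * F v - 1 / p * G v) (v : V) :
    B u v - l * dF u v - dG u v = 0 := by
  refine IsLocalMin.hasDerivAt_eq_zero (a := 0) ?_ (H.hasDerivAt_energy l u v)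
  filter_upwards [(H.tendsto_Q u v).eventually (gt_mem_nhds hu)] with ε hε
  simpa using hmin _ hε.le

theorem deriv_neg_of_outer {V : Type*} {Q F G : V → ℝ} (S : Separates q p Q F G l ρ) {u : V}
    (hu : ρ < Q u)
    (hN : Q u - l * F u - G u = 0) : 2 * Q u - l * q * F u - p * G u < 0 := by
  by_contra! h
  exact absurd (S.inner u (S.pos.trans hu) hN h) hu.not_gt

theorem deriv_pos_of_inner {V : Type*} {Q F G : V → ℝ} (S : Separates q p Q F G l ρ) {u : V}
    (hu0 : 0 < Q u) (hu : Q u < ρ)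
    (hN : Q u - l * F u - G u = 0) : 0 < 2 * Q u - l * q * F u - p * G u := by
  by_contra! h
  exact absurd (S.outer u hu0 hN h) hu.not_gt

/-- The negative derivative equals `(2-q) Q - (p-q) G`. The bound passes to weak limits, where `G`
converges, and so prevents a minimizing sequence from degenerating. -/
theorem G_lower_of_outer (H : ConcaveConvex q p Q F G B dF dG absV)
    (S : Separates q p Q F G l ρ) {u : V} (hu : ρ < Q u) (hN : Q u - l * F u - G u = 0) :
    (2 - q) / (p - q) * ρ ≤ G u := by
  have h := deriv_neg_of_outer S hu hN
  have hpq : 0 < p - q := by linarith [H.q_lt_two, H.two_lt_p]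
  rw [div_mul_eq_mul_div, div_le_iff₀ hpq]
  nlinarith [H.q_lt_two]

/-- The sphere `Q = ρ` meets the ray through `u` at the parameter `√(ρ / Q u)`. -/
theorem radial_at_sphere (H : ConcaveConvex q p Q F G B dF dG absV)
    (S : Separates q p Q F G l ρ) {u : V} (hu : 0 < Q u) :
    0 < √(ρ / Q u) ∧ √(ρ / Q u) ^ 2 * Q u = ρ ∧
      0 < √(ρ / Q u) ^ 2 * Q u - √(ρ / Q u) ^ q * (l * F u) - √(ρ / Q u) ^ p * G u := by
  have hρ := S.pos
  have h0 : 0 < √(ρ / Q u) := Real.sqrt_pos.2 (by positivity)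
  have h1 : √(ρ / Q u) ^ 2 * Q u = ρ := by
    rw [Real.sq_sqrt (by positivity)]; field_simp
  refine ⟨h0, h1, ?_⟩
  have := S.radial (√(ρ / Q u) • u) (by rw [H.Q_smul, h1])
  rw [H.Q_smul, H.F_smul _ _ h0, H.G_smul _ _ h0] at this
  linarith

/-- An instance of `fibering_le` in which `t₀` is the parameter where the ray crosses the sphere;
the hypothesis on `t` says that `t • u` lies on or beyond the sphere. -/
theorem energy_smul_le_of_outer (H : ConcaveConvex q p Q F G B dF dG absV)
    (S : Separates q p Q F G l ρ) {u : V} (hu : ρ < Q u) (hN : Q u - l * F u - G u = 0) {t : ℝ}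
    (ht : 0 < t) (htρ : ρ ≤ t ^ 2 * Q u) :
    1 / 2 * (t ^ 2 * Q u) - l / q * (t ^ q * F u) - 1 / p * (t ^ p * G u) ≤
      1 / 2 * Q u - l / q * F u - 1 / p * G u := by
  have hQ : 0 < Q u := S.pos.trans hu
  obtain ⟨h0, h1, h2⟩ := H.radial_at_sphere S hQ
  have hG : 0 < G u := by
    refine lt_of_lt_of_le ?_ (H.G_lower_of_outer S hu hN)
    have := S.pos
    have : 0 < 2 - q := by linarith [H.q_lt_two]
    have : 0 < p - q := by linarith [H.two_lt_p]
    positivity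
  have h3 : √(ρ / Q u) < 1 := by
    rw [Real.sqrt_lt' one_pos, one_pow, div_lt_one hQ]; exact hu
  have h4 : √(ρ / Q u) ≤ t := by
    rw [Real.sqrt_le_left ht.le, div_le_iff₀ hQ]; exact htρ
  have := fibering_le (t := t) H.one_lt_q H.q_lt_two H.two_lt_p
    (by linarith : Q u = l * F u + G u) hG h0 h3 h2 h4
  have e : ∀ x : ℝ, l / q * x = 1 / q * (l * x) := fun x => by ring
  rw [e, e]
  calc _ = 1 / 2 * (t ^ 2 * Q u) - 1 / q * (t ^ q * (l * F u)) - 1 / p * (t ^ p * G u) := by ring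
    _ ≤ _ := this

/-- Along the ray the Nehari function is positive at the sphere, and it becomes nonpositive for
large `t` because `G u > 0` and `p > 2 > q`. The intermediate value theorem gives a zero beyond the
sphere. -/
theorem exists_smul_outer (H : ConcaveConvex q p Q F G B dF dG absV)
    (S : Separates q p Q F G l ρ) {u : V} (hG : 0 < G u) :
    ∃ t : ℝ, 0 < t ∧ ρ < Q (t • u) ∧ Q (t • u) - l * F (t • u) - G (t • u) = 0 := by
  have hQ := H.Q_pos_of_G_pos hG
  obtain ⟨h0, h1, h2⟩ := H.radial_at_sphere S hQ
  have hp2 := H.two_lt_p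
  have hq2 := H.q_lt_two
  set t₀ := √(ρ / Q u) with ht₀
  set D : ℝ → ℝ := fun t => t ^ 2 * Q u - t ^ q * (l * F u) - t ^ p * G u with hD
  have hDc : ContinuousOn D (Ici t₀) := by
    have hc : ∀ e : ℝ, ContinuousOn (fun t : ℝ => t ^ e) (Ici t₀) := fun e t ht =>
      (Real.continuousAt_rpow_const _ _ (Or.inl (h0.trans_le ht).ne')).continuousWithinAt
    exact (((continuousOn_id.pow 2).mul continuousOn_const).sub
      ((hc q).mul continuousOn_const)).sub ((hc p).mul continuousOn_const)
  obtain ⟨T, hT, hT1, hTt⟩ : ∃ T : ℝ, (Q u + l * |F u|) / G u < T ^ (p - 2) ∧ 1 ≤ T ∧ t₀ ≤ T :=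
    (((tendsto_rpow_atTop (by linarith : 0 < p - 2)).eventually_gt_atTop _).and
      ((eventually_ge_atTop 1).and (eventually_ge_atTop t₀))).exists
  have hT0 : 0 < T := by linarith
  have hDT : D T ≤ 0 := by
    rw [div_lt_iff₀ hG] at hT
    have e1 : T ^ p = T ^ 2 * T ^ (p - 2) := by
      rw [← Real.rpow_natCast, ← Real.rpow_add hT0]; congr 1; push_cast; ring
    have e2 : T ^ q ≤ T ^ 2 := by
      rw [← Real.rpow_natCast]; exact Real.rpow_le_rpow_of_exponent_le hT1 (by push_cast; linarith)
    have e3 : -(T ^ q * (l * F u)) ≤ T ^ 2 * (l * |F u|) := by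
      calc -(T ^ q * (l * F u)) = T ^ q * (l * -F u) := by ring
        _ ≤ T ^ q * (l * |F u|) := by
          have := neg_le_abs (F u); have := S.l_pos; gcongr
        _ ≤ _ := by have := S.l_pos; gcongr
    simp only [hD, e1]
    nlinarith [mul_lt_mul_of_pos_left hT (by positivity : 0 < T ^ 2)]
  obtain ⟨t, ht, htD⟩ := intermediate_value_Icc' hTt (hDc.mono Icc_subset_Ici_self)
    (⟨hDT, h2.le⟩ : (0 : ℝ) ∈ Icc (D T) (D t₀))
  have htt : t₀ < t := lt_of_le_of_ne ht.1 fun h => by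
    rw [← h] at htD; exact h2.ne' htD
  have ht0 := h0.trans htt
  refine ⟨t, ht0, ?_, ?_⟩
  · rw [H.Q_smul, ← h1]
    have : t₀ ^ 2 < t ^ 2 := by gcongr
    exact mul_lt_mul_of_pos_right this hQ
  · rw [H.Q_smul, H.F_smul _ _ ht0, H.G_smul _ _ ht0, ← htD]; simp only [hD]; ring

/-- The energy has a minimizer on the outer part of the Nehari set. -/
theorem exists_outer_minimizer (H : ConcaveConvex q p Q F G B dF dG absV)
    (S : Separates q p Q F G l ρ) :
    ∃ (w : V) (t : ℝ), 0 < t ∧ ρ < Q (t • absV w) ∧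
      Q (t • absV w) - l * F (t • absV w) - G (t • absV w) = 0 ∧
      ∀ v, ρ < Q v → Q v - l * F v - G v = 0 →
      1 / 2 * Q (t • absV w) - l / q * F (t • absV w) - 1 / p * G (t • absV w) ≤
        1 / 2 * Q v - l / q * F v - 1 / p * G v := by
  set I : V → ℝ := fun v => 1 / 2 * Q v - l / q * F v - 1 / p * G v with hI
  have hq1 := H.one_lt_q
  have hq2 := H.q_lt_two
  have hp2 := H.two_lt_p
  have hl := S.l_pos
  have hρ := S.pos
  obtain ⟨c₁, h₁⟩ := H.F_bound
  set N : Set V := {v | ρ < Q v ∧ Q v - l * F v - G v = 0} with hN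
  -- coercivity on the Nehari set
  obtain ⟨κ, K, hκ, hcoer⟩ : ∃ κ K : ℝ, 0 < κ ∧ ∀ v ∈ N, κ * Q v - K ≤ I v := by
    -- Eliminating `G` on the Nehari set, the energy is `(1/2 - 1/p) Q - l (1/q - 1/p) F`. Half of
    -- the first coefficient is kept as `κ`, the other half absorbs `F`.
    set κ : ℝ := (1 / 2 - 1 / p) / 2 with hκ
    have hκ0 : 0 < κ := by
      have : 1 / p < 1 / 2 := one_div_lt_one_div_of_lt (by norm_num) hp2
      rw [hκ]; linarith
    set C : ℝ := l * (1 / q - 1 / p) * |c₁| with hC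
    have hqp : 0 ≤ 1 / q - 1 / p := by
      have : 1 / p ≤ 1 / q := one_div_le_one_div_of_le (by linarith) (by linarith)
      linarith
    have hC0 : 0 ≤ C := by positivity
    -- Beyond the threshold `X` one has `C Q^(q/2) ≤ κ Q`; below it that term is at most the
    -- constant `C X^(q/2)`.
    obtain ⟨X, hX, hX0⟩ : ∃ X : ℝ, C / κ < X ^ (1 - q / 2) ∧ 0 < X :=
      (((tendsto_rpow_atTop (by linarith : 0 < 1 - q / 2)).eventually_gt_atTop _).and
        (eventually_gt_atTop 0)).exists
    refine ⟨κ, C * X ^ (q / 2), hκ0, fun v hv => ?_⟩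
    have hQv : 0 < Q v := hρ.trans hv.1
    have e1 : 2 * κ * Q v - C * Q v ^ (q / 2) ≤ I v := by
      have hF : F v ≤ |c₁| * Q v ^ (q / 2) := (le_abs_self _).trans ((h₁ v).trans
        (mul_le_mul_of_nonneg_right (le_abs_self _) (Real.rpow_nonneg hQv.le _)))
      have e2 : I v = (1 / 2 - 1 / p) * Q v - l * (1 / q - 1 / p) * F v := by
        have h5 : G v = Q v - l * F v := by linarith [hv.2]
        simp only [hI, h5]; ring
      rw [e2, hC, hκ]
      have := mul_le_mul_of_nonneg_left hF (by positivity : 0 ≤ l * (1 / q - 1 / p))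
      nlinarith
    refine le_trans ?_ e1
    rcases le_total (Q v) X with hle | hle
    · have : Q v ^ (q / 2) ≤ X ^ (q / 2) := Real.rpow_le_rpow hQv.le hle (by linarith)
      nlinarith [mul_le_mul_of_nonneg_left this hC0, mul_pos hκ0 hQv]
    · have h3 : C ≤ κ * Q v ^ (1 - q / 2) := by
        rw [div_lt_iff₀ hκ0] at hX
        have := Real.rpow_le_rpow hX0.le hle (by linarith : 0 ≤ 1 - q / 2)
        nlinarith
      have h4 : Q v ^ (1 - q / 2) * Q v ^ (q / 2) = Q v := by
        rw [← Real.rpow_add hQv]; simp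
      have h5 : C * Q v ^ (q / 2) ≤ κ * Q v := by
        calc C * Q v ^ (q / 2) ≤ κ * Q v ^ (1 - q / 2) * Q v ^ (q / 2) :=
              mul_le_mul_of_nonneg_right h3 (Real.rpow_nonneg hQv.le _)
          _ = κ * Q v := by rw [mul_assoc, h4]
      have h6 : 0 ≤ C * X ^ (q / 2) := by positivity
      nlinarith
  obtain ⟨z, hz⟩ := H.G_pos
  obtain ⟨tz, -, hz1, hz2⟩ := H.exists_smul_outer S hz
  have hne : (I '' N).Nonempty := ⟨_, tz • z, ⟨hz1, hz2⟩, rfl⟩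
  have hbdd : BddBelow (I '' N) := by
    refine ⟨-K, ?_⟩
    rintro _ ⟨v, hv, rfl⟩
    nlinarith [hcoer v hv, H.Q_nonneg v]
  obtain ⟨a, -, ha, hmem⟩ := exists_seq_tendsto_sInf hne hbdd
  choose u hu huI using hmem
  obtain ⟨A, hA⟩ := ha.bddAbove_range
  have hbound : ∀ k, Q (u k) ≤ (A + K) / κ := by
    intro k
    rw [le_div_iff₀ hκ]
    have := hcoer _ (hu k)
    have h2 : a k ≤ A := hA ⟨k, rfl⟩
    rw [← huI k] at h2
    linarith
  obtain ⟨w, σ, hσ, hF, hG, hQ⟩ := H.compact u _ hbound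
  have hGw : 0 < G w := by
    have h2q : 0 < 2 - q := by linarith
    have hpq : 0 < p - q := by linarith
    have : 0 < (2 - q) / (p - q) * ρ := by positivity
    exact this.trans_le (ge_of_tendsto hG (Eventually.of_forall fun k =>
      H.G_lower_of_outer S (hu (σ k)).1 (hu (σ k)).2))
  obtain ⟨t, ht, htρ, htN⟩ := H.exists_smul_outer S (u := absV w) (by rwa [H.G_abs])
  refine ⟨w, t, ht, htρ, htN, fun v hvρ hvN => ?_⟩
  refine le_trans ?_ (csInf_le hbdd ⟨v, ⟨hvρ, hvN⟩, rfl⟩)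
  rw [H.Q_smul] at htρ
  have htw : ρ < t ^ 2 * Q w := htρ.trans_le
    (mul_le_mul_of_nonneg_left (H.Q_abs w) (by positivity))
  -- One fixed `t` serves the whole sequence. By lower semicontinuity `t • u_k` is eventually on or
  -- beyond the sphere, so its energy is at most that of `u_k`, although `t • u_k` need not lie on
  -- the Nehari set.
  have hlim : (1 / 2 * t ^ 2) * Q w - (l / q * t ^ q) * F w - (1 / p * t ^ p) * G w ≤
      sInf (I '' N) := by
    refine le_of_lsc (by positivity) hF hG hQ (ha.comp hσ.tendsto_atTop) ?_
    filter_upwards [hQ (Q w - ρ / t ^ 2) (by rw [gt_iff_lt, sub_pos, div_lt_iff₀ (by positivity)];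
                                             linarith)] with k hk
    have h1 : ρ ≤ t ^ 2 * Q (u (σ k)) := by
      have : ρ / t ^ 2 ≤ Q (u (σ k)) := by linarith
      rw [div_le_iff₀ (by positivity)] at this
      linarith
    have h2 := H.energy_smul_le_of_outer S (hu (σ k)).1 (hu (σ k)).2 ht h1
    refine le_trans (le_of_eq ?_) (h2.trans (huI (σ k)).le)
    ring
  rw [H.Q_smul, H.F_smul _ _ ht, H.G_smul _ _ ht, H.F_abs, H.G_abs]
  have := mul_le_mul_of_nonneg_left (H.Q_abs w) (by positivity : 0 ≤ 1 / 2 * t ^ 2)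
  linarith

/-- For small `ε > 0` some `t` near `1` brings `t • (u + ε • v)` back to the Nehari set. Minimality
bounds its energy below by that of `u`, which by fibering is at least that of `t • u`. Dividing the
resulting inequality by `ε` gives the claim as `ε → 0` and `t → 1`; no differentiable dependence of
`t` on `ε` is required. -/
theorem nonneg_of_outer_minimizer (H : ConcaveConvex q p Q F G B dF dG absV)
    (S : Separates q p Q F G l ρ) {u : V} (hu : ρ < Q u) (hN : Q u - l * F u - G u = 0)
    (hmin : ∀ v, ρ < Q v → Q v - l * F v - G v = 0 →
      1 / 2 * Q u - l / q * F u - 1 / p * G u ≤ 1 / 2 * Q v - l / q * F v - 1 / p * G v) (v : V) :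
    0 ≤ B u v - l * dF u v - dG u v := by
  by_contra! hneg
  have hq1 := H.one_lt_q
  have hp2 := H.two_lt_p
  -- difference quotients
  set a : ℝ → ℝ := fun ε => ε⁻¹ * (Q (u + ε • v) - Q u) with ha
  set b : ℝ → ℝ := fun ε => ε⁻¹ * (F (u + ε • v) - F u) with hb
  set c : ℝ → ℝ := fun ε => ε⁻¹ * (G (u + ε • v) - G u) with hc
  have hlim : ∀ {φ : V → ℝ} {d : ℝ}, HasDerivAt (fun ε : ℝ => φ (u + ε • v)) d 0 →
      Tendsto (fun ε : ℝ => ε⁻¹ * (φ (u + ε • v) - φ u)) (𝓝[>] 0) (𝓝 d) := by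
    intro φ d hd
    have := hd.tendsto_slope.mono_left (nhdsGT_le_nhdsNE 0)
    refine this.congr fun ε => ?_
    simp [slope_def_field, div_eq_inv_mul]
  -- The limit is taken jointly in `(t, ε)`, so that `t` can be chosen after `ε`, subject only to
  -- being close to `1`.
  have hev : ∀ᶠ x : ℝ × ℝ in 𝓝 1 ×ˢ 𝓝[>] 0, 1 / 2 * (x.1 ^ 2 * a x.2) -
      l / q * (x.1 ^ q * b x.2) - 1 / p * (x.1 ^ p * c x.2) < 0 := by
    have t1 : Tendsto (fun x : ℝ × ℝ => x.1 ^ 2) (𝓝 1 ×ˢ 𝓝[>] 0) (𝓝 1) := by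
      simpa using (tendsto_fst (f := 𝓝 (1 : ℝ)) (g := 𝓝[>] (0 : ℝ))).pow 2
    have t2 : ∀ e : ℝ, Tendsto (fun x : ℝ × ℝ => x.1 ^ e) (𝓝 1 ×ˢ 𝓝[>] 0) (𝓝 1) := fun e => by
      simpa using (tendsto_fst (f := 𝓝 (1 : ℝ)) (g := 𝓝[>] (0 : ℝ))).rpow_const
        (p := e) (Or.inl one_ne_zero)
    have t3 := (((t1.mul ((hlim (H.hasDerivAt_Q u v)).comp tendsto_snd)).const_mul (1 / 2)).sub
      (((t2 q).mul ((hlim (H.F_deriv u v)).comp tendsto_snd)).const_mul (l / q))).sub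
      (((t2 p).mul ((hlim (H.G_deriv u v)).comp tendsto_snd)).const_mul (1 / p))
    refine t3.eventually (gt_mem_nhds ?_)
    refine lt_of_eq_of_lt ?_ hneg
    field_simp
  obtain ⟨P₁, hP₁, P₂, hP₂, hP⟩ := Filter.eventually_prod_iff.1 hev
  -- sign change of the Nehari function along the ray through `u`
  set D : ℝ → ℝ → ℝ := fun ε t => t ^ 2 * Q (u + ε • v) - t ^ q * (l * F (u + ε • v)) -
    t ^ p * G (u + ε • v) with hD
  have hD0 : HasDerivAt (D 0) (2 * Q u - l * q * F u - p * G u) 1 := by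
    have d1 : HasDerivAt (fun x : ℝ => x ^ 2) (2 * 1) 1 := by simpa using hasDerivAt_pow 2 (1 : ℝ)
    have d2 := Real.hasDerivAt_rpow_const (x := 1) (p := q) (Or.inl one_ne_zero)
    have d3 := Real.hasDerivAt_rpow_const (x := 1) (p := p) (Or.inl one_ne_zero)
    have := ((d1.mul_const (Q u)).sub (d2.mul_const (l * F u))).sub (d3.mul_const (G u))
    simp only [Real.one_rpow, mul_one] at this
    refine (this.congr_deriv (by ring)).congr_of_eventuallyEq (Eventually.of_forall fun x => ?_)
    simp [hD]
  have hD1 : D 0 1 = 0 := by simp only [hD, zero_smul, add_zero, one_pow, Real.one_rpow]; linarith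
  have hlt := deriv_neg_of_outer S hu hN
  have hsl := hD0.tendsto_slope.eventually (gt_mem_nhds hlt)
  have hcommon : ∀ᶠ t : ℝ in 𝓝 1, P₁ t ∧ 0 < t ∧ ρ < t ^ 2 * Q u := by
    refine hP₁.and ((lt_mem_nhds one_pos).and ?_)
    have : Tendsto (fun t : ℝ => t ^ 2 * Q u) (𝓝 1) (𝓝 (1 ^ 2 * Q u)) :=
      Continuous.tendsto (by fun_prop) 1
    exact this.eventually (lt_mem_nhds (by simpa using hu))
  obtain ⟨δ, hδ, hball⟩ := Metric.eventually_nhds_iff_ball.1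
    ((eventually_nhdsWithin_iff.1 hsl).and hcommon)
  set t₁ : ℝ := 1 - δ / 2 with ht₁
  set t₂ : ℝ := 1 + δ / 2 with ht₂
  have hIcc : ∀ t ∈ Icc t₁ t₂, t ∈ Metric.ball (1 : ℝ) δ := by
    intro t ht
    rw [Metric.mem_ball, Real.dist_eq, abs_lt]
    constructor <;> linarith [ht.1, ht.2]
  have h12 : t₁ ≤ t₂ := by linarith
  have hpos₁ : 0 < D 0 t₁ := by
    have := (hball t₁ (hIcc _ ⟨le_rfl, h12⟩)).1 (by simp [ht₁]; linarith)
    rw [slope_def_field, hD1, sub_zero, div_neg_iff] at this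
    rcases this with h | h
    · exact h.1
    · linarith [h.2]
  have hneg₂ : D 0 t₂ < 0 := by
    have := (hball t₂ (hIcc _ ⟨h12, le_rfl⟩)).1 (by simp [ht₂]; linarith)
    rw [slope_def_field, hD1, sub_zero, div_neg_iff] at this
    rcases this with h | h
    · linarith [h.2]
    · exact h.1
  have hcF : Tendsto (fun ε : ℝ => F (u + ε • v)) (𝓝[>] 0) (𝓝 (F u)) := by
    simpa using (H.F_deriv u v).continuousAt.tendsto.mono_left nhdsWithin_le_nhds
  have hcG : Tendsto (fun ε : ℝ => G (u + ε • v)) (𝓝[>] 0) (𝓝 (G u)) := by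
    simpa using (H.G_deriv u v).continuousAt.tendsto.mono_left nhdsWithin_le_nhds
  have hcQ : Tendsto (fun ε : ℝ => Q (u + ε • v)) (𝓝[>] 0) (𝓝 (Q u)) :=
    (H.tendsto_Q u v).mono_left nhdsWithin_le_nhds
  have hDlim : ∀ t, Tendsto (fun ε => D ε t) (𝓝[>] 0) (𝓝 (D 0 t)) := by
    intro t
    have := ((hcQ.const_mul (t ^ 2)).sub ((hcF.const_mul l).const_mul (t ^ q))).sub
      (hcG.const_mul (t ^ p))
    simpa [hD] using this
  have ht₁0 : 0 < t₁ := (hball t₁ (hIcc _ ⟨le_rfl, h12⟩)).2.2.1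
  have hQt₁ : ρ < t₁ ^ 2 * Q u := (hball t₁ (hIcc _ ⟨le_rfl, h12⟩)).2.2.2
  obtain ⟨ε, ⟨⟨hε₁, hε₂⟩, hεP, hεQ⟩, hε⟩ := (((((hDlim t₁).eventually (lt_mem_nhds hpos₁)).and
    ((hDlim t₂).eventually (gt_mem_nhds hneg₂))).and (hP₂.and
      ((hcQ.const_mul (t₁ ^ 2)).eventually (lt_mem_nhds hQt₁)))).and self_mem_nhdsWithin).exists
  have hε : 0 < ε := hε
  have hDc : ContinuousOn (D ε) (Icc t₁ t₂) := by
    have hcr : ∀ e : ℝ, ContinuousOn (fun t : ℝ => t ^ e) (Icc t₁ t₂) := fun e t ht =>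
      (Real.continuousAt_rpow_const _ _ (Or.inl (ht₁0.trans_le ht.1).ne')).continuousWithinAt
    exact (((continuousOn_id.pow 2).mul continuousOn_const).sub
      ((hcr q).mul continuousOn_const)).sub ((hcr p).mul continuousOn_const)
  obtain ⟨t, ht, htD⟩ := intermediate_value_Icc' h12 hDc
    (⟨hε₂.le, hε₁.le⟩ : (0 : ℝ) ∈ Icc (D ε t₂) (D ε t₁))
  obtain ⟨-, htP, ht0, htQ⟩ := hball t (hIcc t ht)
  have hlow := H.energy_smul_le_of_outer S hu hN ht0 htQ.le
  have hup := hmin (t • (u + ε • v)) (by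
    rw [H.Q_smul]
    refine hεQ.trans_le (mul_le_mul_of_nonneg_right ?_ (H.Q_nonneg _))
    have := ht.1
    gcongr) (by
    rw [H.Q_smul, H.F_smul _ _ ht0, H.G_smul _ _ ht0, ← htD]; simp only [hD]; ring)
  rw [H.Q_smul, H.F_smul _ _ ht0, H.G_smul _ _ ht0] at hup
  have hfin := hP htP hεP
  have : 1 / 2 * (t ^ 2 * a ε) - l / q * (t ^ q * b ε) - 1 / p * (t ^ p * c ε) =
      ε⁻¹ * ((1 / 2 * (t ^ 2 * Q (u + ε • v)) - l / q * (t ^ q * F (u + ε • v)) -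
        1 / p * (t ^ p * G (u + ε • v))) - (1 / 2 * (t ^ 2 * Q u) - l / q * (t ^ q * F u) -
        1 / p * (t ^ p * G u))) := by
    simp only [ha, hb, hc]; ring
  simp only at hfin
  rw [this] at hfin
  exact absurd hfin (not_lt.2 (mul_nonneg (inv_nonneg.2 hε.le) (by linarith)))

/-- The inequality is applied to `v` and `-v`. Linearity in `v` is not part of `ConcaveConvex`;
oddness of `B u`, `dF u` and `dG u` follows from uniqueness of derivatives along the line. -/
theorem critical_of_outer_minimizer (H : ConcaveConvex q p Q F G B dF dG absV)
    (S : Separates q p Q F G l ρ) {u : V} (hu : ρ < Q u) (hN : Q u - l * F u - G u = 0)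
    (hmin : ∀ v, ρ < Q v → Q v - l * F v - G v = 0 →
      1 / 2 * Q u - l / q * F u - 1 / p * G u ≤ 1 / 2 * Q v - l / q * F v - 1 / p * G v) (v : V) :
    B u v - l * dF u v - dG u v = 0 := by
  have h1 := H.nonneg_of_outer_minimizer S hu hN hmin v
  have h2 := H.nonneg_of_outer_minimizer S hu hN hmin (-v)
  have hq := H.one_lt_q
  have hp := H.two_lt_p
  have hneg : ∀ {φ : V → ℝ} {d d' : ℝ}, HasDerivAt (fun ε : ℝ => φ (u + ε • v)) d 0 →
      HasDerivAt (fun ε : ℝ => φ (u + ε • -v)) d' 0 → d' = -d := by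
    intro φ d d' h h'
    have h3 : HasDerivAt (fun ε : ℝ => φ (u + (-ε) • v)) (-d) 0 := by
      have := HasDerivAt.scomp (0 : ℝ) (g₁ := fun ε : ℝ => φ (u + ε • v)) (h := fun ε : ℝ => -ε)
        (g₁' := d) (h' := -1) (by simpa using h) (hasDerivAt_neg 0)
      exact this.congr_deriv (by simp)
    refine h'.unique (h3.congr_of_eventuallyEq (Eventually.of_forall fun ε => ?_))
    simp
  have hB := hneg (H.hasDerivAt_Q u v) (H.hasDerivAt_Q u (-v))
  have hF := hneg (H.F_deriv u v) (H.F_deriv u (-v))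
  have hG := hneg (H.G_deriv u v) (H.G_deriv u (-v))
  have hF' : dF u (-v) = -dF u v := mul_left_cancel₀ (by linarith : q ≠ 0) (by linarith)
  have hG' : dG u (-v) = -dG u v := mul_left_cancel₀ (by linarith : p ≠ 0) (by linarith)
  rw [hF', hG'] at h2
  linarith

/-- Existence of two critical points, minimizing the energy over the two parts of the Nehari set. -/
theorem exists_two_minimizers (H : ConcaveConvex q p Q F G B dF dG absV) :
    ∃ Λ : ℝ, 0 < Λ ∧ ∀ l, 0 < l → l < Λ → ∃ (w₁ w₂ : V) (t : ℝ), 0 < t ∧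
      (∀ u, (u = absV w₁ ∨ u = t • absV w₂) →
        0 < Q u ∧ Q u - l * F u - G u = 0 ∧ ∀ v, B u v - l * dF u v - dG u v = 0) ∧
      0 < 2 * Q (absV w₁) - l * q * F (absV w₁) - p * G (absV w₁) ∧
      (∀ v, Q v - l * F v - G v = 0 → 0 < 2 * Q v - l * q * F v - p * G v →
        1 / 2 * Q (absV w₁) - l / q * F (absV w₁) - 1 / p * G (absV w₁) ≤
          1 / 2 * Q v - l / q * F v - 1 / p * G v) ∧
      2 * Q (t • absV w₂) - l * q * F (t • absV w₂) - p * G (t • absV w₂) < 0 ∧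
      (∀ v, Q v - l * F v - G v = 0 → 2 * Q v - l * q * F v - p * G v < 0 →
        1 / 2 * Q (t • absV w₂) - l / q * F (t • absV w₂) - 1 / p * G (t • absV w₂) ≤
          1 / 2 * Q v - l / q * F v - 1 / p * G v) := by
  obtain ⟨ρ, Λ, hΛ, hsep⟩ := H.exists_separates
  refine ⟨Λ, hΛ, fun l hl hlΛ => ?_⟩
  have S := hsep l hl hlΛ
  have hpos : ∀ v, 2 * Q v - l * q * F v - p * G v ≠ 0 → 0 < Q v := by
    intro v hv
    refine lt_of_le_of_ne (H.Q_nonneg v) fun h => hv ?_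
    obtain ⟨c₁, h₁⟩ := H.F_bound
    obtain ⟨c₂, h₂⟩ := H.G_bound
    have hF0 := h₁ v
    have hG0 := h₂ v
    have := H.one_lt_q
    have := H.two_lt_p
    rw [← h, Real.zero_rpow (by linarith), mul_zero, abs_nonpos_iff] at hF0 hG0
    simp [← h, hF0, hG0]
  obtain ⟨w₁, h0, hρ₁, hmin₁⟩ := H.exists_inner_minimizer S
  obtain ⟨w₂, t, ht, hρ₂, hN₂, hmin₂⟩ := H.exists_outer_minimizer S
  have hcrit₁ := H.critical_of_inner_minimizer hρ₁ hmin₁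
  have hN₁ : Q (absV w₁) - l * F (absV w₁) - G (absV w₁) = 0 := by
    simpa only [H.B_self, H.dF_self, H.dG_self] using hcrit₁ (absV w₁)
  -- By `inner` and `outer` every competitor with positive derivative lies in the ball and every one
  -- with negative derivative lies beyond it, so both minimizers minimize over their own part of the
  -- Nehari set.
  refine ⟨w₁, w₂, t, ht, ?_, deriv_pos_of_inner S h0 hρ₁ hN₁,
    fun v hv hd => hmin₁ v (S.inner v (hpos v hd.ne') hv hd.le).le,
    deriv_neg_of_outer S hρ₂ hN₂,
    fun v hv hd => hmin₂ v (S.outer v (hpos v hd.ne) hv hd.le) hv⟩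
  rintro u (rfl | rfl)
  · exact ⟨h0, hN₁, hcrit₁⟩
  · exact ⟨S.pos.trans hρ₂, hN₂, H.critical_of_outer_minimizer S hρ₂ hN₂ hmin₂⟩

end ConcaveConvex
end FracHardy

namespace FracHardy

/-! ### A regularized Beta integral -/

/-- Read off from the fact that the density of the Beta distribution has total mass one. -/
theorem integrableOn_beta {u v : ℝ} (hu : 0 < u) (hv : 0 < v) :
    IntegrableOn (fun x : ℝ => x ^ (u - 1) * (1 - x) ^ (v - 1)) (Ioo 0 1) ∧
      ∫ x in Ioo (0 : ℝ) 1, x ^ (u - 1) * (1 - x) ^ (v - 1) =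
        Real.Gamma u * Real.Gamma v / Real.Gamma (u + v) := by
  have hβ := ProbabilityTheory.beta_pos hu hv
  have h1 := ProbabilityTheory.lintegral_betaPDF_eq_one hu hv
  rw [ProbabilityTheory.lintegral_betaPDF] at h1
  have hnn : 0 ≤ᵐ[volume.restrict (Ioo (0 : ℝ) 1)]
      fun x => 1 / ProbabilityTheory.beta u v * x ^ (u - 1) * (1 - x) ^ (v - 1) := by
    refine (ae_restrict_iff' measurableSet_Ioo).2 (Eventually.of_forall fun x hx => ?_)
    have h2 : 0 < 1 - x := by linarith [hx.2]
    have h3 : 0 < x := hx.1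
    simp only [Pi.zero_apply]
    positivity
  have hm : AEStronglyMeasurable
      (fun x : ℝ => 1 / ProbabilityTheory.beta u v * x ^ (u - 1) * (1 - x) ^ (v - 1))
      (volume.restrict (Ioo 0 1)) := (by fun_prop : Measurable _).aestronglyMeasurable
  have hInt : IntegrableOn
      (fun x : ℝ => 1 / ProbabilityTheory.beta u v * x ^ (u - 1) * (1 - x) ^ (v - 1)) (Ioo 0 1) :=
    (lintegral_ofReal_ne_top_iff_integrable hm hnn).1 (by rw [h1]; simp)
  have hval : ∫ x in Ioo (0 : ℝ) 1,
      1 / ProbabilityTheory.beta u v * x ^ (u - 1) * (1 - x) ^ (v - 1) = 1 := by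
    rw [integral_eq_lintegral_of_nonneg_ae hnn hm, h1]; simp
  simp only [mul_assoc, integral_const_mul] at hval
  refine ⟨?_, ?_⟩
  · have := hInt.const_mul (ProbabilityTheory.beta u v)
    refine this.congr (Eventually.of_forall fun x => ?_)
    simp only
    field_simp
  · rw [one_div, inv_mul_eq_one₀ hβ.ne'] at hval
    rw [← hval, ProbabilityTheory.beta]

/-- Bernoulli's inequality for `b ≥ 1`, monotonicity in the exponent for `b ≤ 1`. It reduces the
singularity `x ^ (-1 - a)` to the integrable `x ^ (-a)`. -/
theorem one_sub_rpow_le {b x : ℝ} (hb : 0 < b) (hx0 : 0 ≤ x) (hx1 : x ≤ 1) :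
    1 - (1 - x) ^ b ≤ max 1 b * x := by
  rcases le_total 1 b with h | h
  · have := one_add_mul_self_le_rpow_one_add (s := -x) (by linarith) h
    rw [max_eq_right h, sub_eq_add_neg 1 x]; linarith
  · have : (1 - x) ^ (1 : ℝ) ≤ (1 - x) ^ b := by
      rcases hx1.eq_or_lt with rfl | hlt
      · simp [Real.zero_rpow hb.ne']
      · exact Real.rpow_le_rpow_of_exponent_ge (by linarith) (by linarith) h
    rw [Real.rpow_one] at this
    rw [max_eq_left h]; linarith

/-- Integrand of the Beta integral `B(-a,b)`, regularized at `0` and extended by `x ^ (-1 - a)`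
beyond `1`. -/
noncomputable def betaReg (a b x : ℝ) : ℝ :=
  x ^ (-1 - a) * (1 - if x < 1 then (1 - x) ^ (b - 1) else 0)

theorem measurable_betaReg (a b : ℝ) : Measurable (betaReg a b) := by
  unfold betaReg
  exact (by fun_prop : Measurable fun x : ℝ => x ^ (-1 - a)).mul
    (measurable_const.sub (Measurable.ite measurableSet_Iio (by fun_prop) measurable_const))

/-- The value is formally `-B(-a,b)`, with `-Γ(-a) = Γ(1-a)/a`. One integration by parts on `(0,1)`
reduces the divergent integral to the convergent `B(1-a,b)`. -/
theorem integrableOn_betaReg {a b : ℝ} (ha : 0 < a) (ha1 : a < 1) (hab : a < b) :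
    IntegrableOn (betaReg a b) (Ioi 0) ∧
      ∫ x in Ioi 0, betaReg a b x =
        Real.Gamma (1 - a) / a * (Real.Gamma b / Real.Gamma (b - a)) := by
  have hb : 0 < b := ha.trans hab
  obtain ⟨hβi, hβv⟩ := integrableOn_beta (by linarith : 0 < 1 - a) hb
  have hunion : Ioi (0 : ℝ) = Ioo 0 1 ∪ Ici 1 := by
    ext x; simp only [mem_Ioi, mem_union, mem_Ioo, mem_Ici]
    constructor
    · intro h; rcases lt_or_ge x 1 with h1 | h1
      · exact Or.inl ⟨h, h1⟩
      · exact Or.inr h1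
    · rintro (h | h) <;> linarith [h]
  have hdisj : Disjoint (Ioo (0 : ℝ) 1) (Ici 1) := by
    rw [Set.disjoint_left]; intro x hx hxc; exact absurd hx.2 (not_lt.2 hxc)
  -- the part beyond `1`
  have hR : EqOn (betaReg a b) (fun x => x ^ (-1 - a)) (Ici 1) := by
    intro x hx; simp [betaReg, not_lt.2 (mem_Ici.1 hx)]
  have hRi : IntegrableOn (betaReg a b) (Ici 1) := by
    refine IntegrableOn.congr_fun ?_ hR.symm measurableSet_Ici
    rw [integrableOn_Ici_iff_integrableOn_Ioi]
    exact integrableOn_Ioi_rpow_of_lt (by linarith) one_pos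
  have hRv : ∫ x in Ici 1, betaReg a b x = 1 / a := by
    rw [setIntegral_congr_fun measurableSet_Ici hR, integral_Ici_eq_integral_Ioi,
      integral_Ioi_rpow_of_lt (by linarith) one_pos, Real.one_rpow]
    rw [show -1 - a + 1 = -a by ring, neg_div_neg_eq]
  -- the part in `(0,1)`
  have hA : IntegrableOn (fun x : ℝ => x ^ (-1 - a) * (1 - (1 - x) ^ b)) (Ioo 0 1) := by
    have h1 : IntegrableOn (fun x : ℝ => max 1 b * x ^ (-a)) (Ioo 0 1) := by
      have : IntegrableOn (fun x : ℝ => x ^ (-a)) (Ioo 0 1) := by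
        rw [intervalIntegral.integrableOn_Ioo_rpow_iff one_pos]; linarith
      exact this.const_mul _
    refine Integrable.mono' h1 (by fun_prop : Measurable _).aestronglyMeasurable ?_
    refine (ae_restrict_iff' measurableSet_Ioo).2 (Eventually.of_forall fun x hx => ?_)
    have hx0 : 0 < x := hx.1
    have h2 : 0 ≤ 1 - (1 - x) ^ b := by
      have := Real.rpow_le_one (by linarith [hx.2] : 0 ≤ 1 - x) (by linarith) hb.le
      linarith
    rw [Real.norm_of_nonneg (by positivity)]
    calc x ^ (-1 - a) * (1 - (1 - x) ^ b) ≤ x ^ (-1 - a) * (max 1 b * x) := by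
          gcongr; exact one_sub_rpow_le hb hx0.le hx.2.le
      _ = max 1 b * x ^ (-a) := by
          rw [show (-a : ℝ) = (-1 - a) + 1 by ring, Real.rpow_add_one hx0.ne']; ring
  have e1 : (1 - a : ℝ) - 1 = -a := by ring
  rw [e1] at hβi hβv
  -- `Φ` is the derivative of `-(x^(-a)/a) (1 - (1-x)^b)`, a primitive that tends to `0` at `0` even
  -- when `b < 1`. Its integral `-1/a` cancels the contribution `1/a` from beyond `1`, leaving `(b/a
  -- - 1) B(1-a,b)`.
  set Φ : ℝ → ℝ := fun x => x ^ (-1 - a) * (1 - (1 - x) ^ b) -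
    b / a * (x ^ (-a) * (1 - x) ^ (b - 1)) with hΦ
  have hΦi : IntegrableOn Φ (Ioo 0 1) := hA.sub (hβi.const_mul (b / a))
  have hΦv : ∫ x in Ioo 0 1, Φ x = -1 / a := by
    rw [← integral_Ioc_eq_integral_Ioo, ← intervalIntegral.integral_of_le zero_le_one]
    have := intervalIntegral.integral_eq_sub_of_hasDerivAt_of_tendsto (a := (0 : ℝ)) (b := 1)
      (f := fun x => -(x ^ (-a) / a) * (1 - (1 - x) ^ b)) (f' := Φ) (fa := 0) (fb := -1 / a)
      one_pos ?_ ?_ ?_ ?_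
    · rw [this]; ring
    · intro x hx
      have hx0 : 0 < x := hx.1
      have hx1 : 0 < 1 - x := by linarith [hx.2]
      have d1 := (Real.hasDerivAt_rpow_const (x := x) (p := -a) (Or.inl hx0.ne')).div_const a
      have d2 : HasDerivAt (fun x : ℝ => (1 - x) ^ b) (-(b * (1 - x) ^ (b - 1))) x := by
        have := (Real.hasDerivAt_rpow_const (x := 1 - x) (p := b) (Or.inl hx1.ne')).comp x
          ((hasDerivAt_id x).const_sub 1)
        exact this.congr_deriv (by ring)
      refine (d1.neg.mul (d2.const_sub 1)).congr_deriv ?_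
      simp only [hΦ]
      rw [show -a - 1 = -1 - a by ring]
      simp only [Pi.neg_apply]
      field_simp
      ring
    · rw [intervalIntegrable_iff_integrableOn_Ioo_of_le zero_le_one]; exact hΦi
    · have hlim : Tendsto (fun x : ℝ => max 1 b / a * x ^ (1 - a)) (𝓝[>] 0) (𝓝 0) := by
        have : ContinuousAt (fun x : ℝ => max 1 b / a * x ^ (1 - a)) 0 :=
          (Real.continuousAt_rpow_const _ _ (Or.inr (by linarith))).const_mul _
        have h := this.tendsto
        simp only [Real.zero_rpow (by linarith : 1 - a ≠ 0), mul_zero] at h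
        exact h.mono_left nhdsWithin_le_nhds
      refine squeeze_zero_norm' ?_ hlim
      filter_upwards [Ioo_mem_nhdsGT (zero_lt_one' ℝ)] with x hx
      have hx0 : 0 < x := hx.1
      have h2 : 0 ≤ 1 - (1 - x) ^ b := by
        have := Real.rpow_le_one (by linarith [hx.2] : 0 ≤ 1 - x) (by linarith) hb.le
        linarith
      rw [norm_mul, norm_neg, Real.norm_of_nonneg h2, Real.norm_of_nonneg (by positivity)]
      calc x ^ (-a) / a * (1 - (1 - x) ^ b) ≤ x ^ (-a) / a * (max 1 b * x) := by
            gcongr; exact one_sub_rpow_le hb hx0.le hx.2.le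
        _ = max 1 b / a * x ^ (1 - a) := by
            rw [show (1 - a : ℝ) = (-a) + 1 by ring, Real.rpow_add_one hx0.ne']; ring
    · have : ContinuousAt (fun x : ℝ => -(x ^ (-a) / a) * (1 - (1 - x) ^ b)) 1 := by
        refine ((Real.continuousAt_rpow_const _ _ (Or.inl one_ne_zero)).div_const a).neg.mul
          (continuousAt_const.sub ?_)
        exact (continuousAt_const.sub continuousAt_id).rpow_const (Or.inr hb.le)
      have h := this.tendsto
      simp only [Real.one_rpow, sub_self, Real.zero_rpow hb.ne', sub_zero, mul_one] at h
      rw [neg_div]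
      exact h.mono_left nhdsWithin_le_nhds
  have hL : EqOn (betaReg a b)
      (fun x => Φ x + (b / a - 1) * (x ^ (-a) * (1 - x) ^ (b - 1))) (Ioo 0 1) := by
    intro x hx
    have hx1 : 0 < 1 - x := by linarith [hx.2]
    simp only [betaReg, if_pos hx.2, hΦ]
    rw [show (-a : ℝ) = (-1 - a) + 1 by ring, Real.rpow_add_one (ne_of_gt hx.1),
      Real.rpow_sub_one hx1.ne']
    field_simp
    ring
  have hLi : IntegrableOn (betaReg a b) (Ioo 0 1) :=
    IntegrableOn.congr_fun (hΦi.add (hβi.const_mul _)) hL.symm measurableSet_Ioo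
  refine ⟨by rw [hunion]; exact hLi.union hRi, ?_⟩
  rw [hunion, setIntegral_union hdisj measurableSet_Ici hLi hRi, hRv,
    setIntegral_congr_fun measurableSet_Ioo hL, integral_add hΦi (hβi.const_mul _),
    integral_const_mul, hΦv, hβv]
  have hg : Real.Gamma (1 - a + b) = (b - a) * Real.Gamma (b - a) := by
    rw [← Real.Gamma_add_one (by linarith)]; congr 1; ring
  have h1 : b - a ≠ 0 := by linarith
  have h2 : Real.Gamma (b - a) ≠ 0 := (Real.Gamma_pos_of_pos (by linarith)).ne'
  rw [hg]
  field_simp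
  ring

end FracHardy

namespace FracHardy

/-! ### The heat kernel -/

/-- The heat kernel `(4πt)^(-n/2) exp(-|x|²/4t)`. -/
noncomputable def heat {n : ℕ} (t : ℝ) (x : Rn n) : ℝ :=
  (4 * Real.pi * t) ^ (-((n : ℝ) / 2)) * Real.exp (-(‖x‖ ^ 2 / 4 / t))

variable {n : ℕ}

theorem heat_pos {t : ℝ} (ht : 0 < t) (x : Rn n) : 0 < heat t x := by
  unfold heat; positivity

theorem heat_le {t : ℝ} (ht : 0 < t) (x : Rn n) :
    heat t x ≤ (4 * Real.pi * t) ^ (-((n : ℝ) / 2)) := by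
  unfold heat
  refine mul_le_of_le_one_right (by positivity) (Real.exp_le_one_iff.2 ?_)
  have : 0 ≤ ‖x‖ ^ 2 / 4 / t := by positivity
  linarith

theorem heat_neg (t : ℝ) (x : Rn n) : heat t (-x) = heat t x := by simp [heat]

theorem measurable_heat : Measurable fun z : ℝ × Rn n => heat z.1 z.2 := by
  unfold heat; fun_prop

theorem continuous_heat (t : ℝ) : Continuous fun x : Rn n => heat t x := by
  unfold heat; fun_prop

theorem integral_heat {t : ℝ} (ht : 0 < t) : ∫ x : Rn n, heat t x = 1 := by
  unfold heat
  rw [integral_const_mul]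
  have := GaussianFourier.integral_rexp_neg_mul_sq_norm (V := Rn n)
    (b := 1 / (4 * t)) (by positivity)
  have e : ∀ x : Rn n, -(‖x‖ ^ 2 / 4 / t) = -(1 / (4 * t)) * ‖x‖ ^ 2 := fun x => by
    field_simp
  simp only [e, this, finrank_euclideanSpace_fin]
  rw [show Real.pi / (1 / (4 * t)) = 4 * Real.pi * t by field_simp,
    Real.rpow_neg (by positivity), inv_mul_cancel₀ (by positivity)]

/-- A nonintegrable function has Bochner integral `0`, so a nonzero value forces integrability. The
same device is used for the Mellin integrals below. -/
theorem integrable_heat {t : ℝ} (ht : 0 < t) : Integrable fun x : Rn n => heat t x :=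
  Integrable.of_integral_ne_zero (by rw [integral_heat ht]; norm_num)

theorem integrable_heat_sub {t : ℝ} (ht : 0 < t) (x : Rn n) :
    Integrable fun y : Rn n => heat t (x - y) := (integrable_heat ht).comp_sub_left x

theorem integral_heat_sub {t : ℝ} (ht : 0 < t) (x : Rn n) : ∫ y : Rn n, heat t (x - y) = 1 := by
  rw [integral_sub_left_eq_self (fun y => heat t y) volume x, integral_heat ht]

/-- The semigroup property of the heat kernel. -/
theorem integral_heat_mul_heat {t r : ℝ} (ht : 0 < t) (hr : 0 < r) (x : Rn n) :
    ∫ y : Rn n, heat t (x - y) * heat r y = heat (r + t) x := by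
  -- Completing the square in `y`: a product of Gaussians is a Gaussian of time `t r / (r + t)`
  -- centred at `(r / (r + t)) x`, times a factor depending on `x` only.
  have hτ : 0 < t * r / (r + t) := by positivity
  have key : ∀ y : Rn n, heat t (x - y) * heat r y =
      heat (r + t) x * heat (t * r / (r + t)) (y - (r / (r + t)) • x) := by
    intro y
    have e1 : ‖x - y‖ ^ 2 / 4 / t + ‖y‖ ^ 2 / 4 / r = ‖x‖ ^ 2 / 4 / (r + t) +
        ‖y - (r / (r + t)) • x‖ ^ 2 / 4 / (t * r / (r + t)) := by
      rw [norm_sub_sq_real, norm_sub_sq_real, inner_smul_right, norm_smul, real_inner_comm,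
        Real.norm_of_nonneg (by positivity)]
      field_simp
      ring
    have e2 : (4 * Real.pi * t) ^ (-((n : ℝ) / 2)) * (4 * Real.pi * r) ^ (-((n : ℝ) / 2)) =
        (4 * Real.pi * (r + t)) ^ (-((n : ℝ) / 2)) *
          (4 * Real.pi * (t * r / (r + t))) ^ (-((n : ℝ) / 2)) := by
      rw [← Real.mul_rpow (by positivity) (by positivity),
        ← Real.mul_rpow (by positivity) (by positivity)]
      congr 1
      field_simp
    unfold heat
    calc _ = ((4 * Real.pi * t) ^ (-((n : ℝ) / 2)) * (4 * Real.pi * r) ^ (-((n : ℝ) / 2))) *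
          Real.exp (-(‖x - y‖ ^ 2 / 4 / t + ‖y‖ ^ 2 / 4 / r)) := by
          rw [neg_add, Real.exp_add]; ring
      _ = _ := by rw [e1, e2, neg_add, Real.exp_add]; ring
  simp only [key, integral_const_mul]
  rw [integral_sub_right_eq_self (fun y => heat (t * r / (r + t)) y), integral_heat hτ, mul_one]

/-- The Gamma integral after the substitution `r ↦ 1/r`. -/
theorem integral_rpow_mul_exp_neg_div {c e : ℝ} (hc : 0 < c) (he : 0 < e) :
    ∫ r in Ioi (0 : ℝ), r ^ (-e - 1) * Real.exp (-(c / r)) = c ^ (-e) * Real.Gamma e := by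
  have h := Real.integral_rpow_mul_exp_neg_mul_Ioi he hc
  rw [← integral_comp_rpow_Ioi _ (by norm_num : (-1 : ℝ) ≠ 0)] at h
  rw [Real.rpow_neg hc.le, ← Real.inv_rpow hc.le, ← one_div, ← h]
  refine setIntegral_congr_fun measurableSet_Ioi fun r hr => ?_
  have hr : 0 < r := hr
  simp only [abs_neg, abs_one, one_mul, smul_eq_mul]
  rw [← Real.rpow_mul hr.le, ← mul_assoc, ← Real.rpow_add hr, Real.rpow_neg_one, div_eq_mul_inv]
  congr 2; ring

/-- The Riesz kernel `|x|^(2β-n)`, normalized as the Mellin transform of the heat kernel. -/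
noncomputable def riesz (β : ℝ) (x : Rn n) : ℝ :=
  Real.pi ^ (-((n : ℝ) / 2)) * 4 ^ (-β) * Real.Gamma (n / 2 - β) * ‖x‖ ^ (2 * β - n)

theorem riesz_pos {β : ℝ} (hβ : β < n / 2) {x : Rn n} (hx : x ≠ 0) : 0 < riesz β x := by
  have := norm_pos_iff.2 hx
  have : 0 < (n : ℝ) / 2 - β := by linarith
  unfold riesz; positivity

theorem riesz_nonneg {β : ℝ} (hβ : β < n / 2) (x : Rn n) : 0 ≤ riesz β x := by
  have : 0 < (n : ℝ) / 2 - β := by linarith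
  unfold riesz; positivity

theorem measurable_riesz (β : ℝ) : Measurable fun x : Rn n => riesz β x := by
  unfold riesz; fun_prop

/-- Negative `β` is allowed: `β = -α/2` produces the Gagliardo kernel, while positive values produce
the ground state and its image under the integrated heat flow. -/
theorem integral_rpow_mul_heat {β : ℝ} (hβ : β < n / 2) {x : Rn n} (hx : x ≠ 0) :
    ∫ r in Ioi (0 : ℝ), r ^ (β - 1) * heat r x = riesz β x := by
  have hx' := norm_pos_iff.2 hx
  have h := integral_rpow_mul_exp_neg_div (c := ‖x‖ ^ 2 / 4) (e := n / 2 - β)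
    (by positivity) (by linarith)
  have h1 : ∫ r in Ioi (0 : ℝ), r ^ (β - 1) * heat r x = (4 * Real.pi) ^ (-((n : ℝ) / 2)) *
      ∫ r in Ioi (0 : ℝ), r ^ (-((n : ℝ) / 2 - β) - 1) * Real.exp (-(‖x‖ ^ 2 / 4 / r)) := by
    rw [← integral_const_mul]
    refine setIntegral_congr_fun measurableSet_Ioi fun r hr => ?_
    have hr : 0 < r := hr
    simp only [heat]
    rw [Real.mul_rpow (by positivity) hr.le,
      show -((n : ℝ) / 2 - β) - 1 = (β - 1) + (-((n : ℝ) / 2)) by ring, Real.rpow_add hr]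
    ring
  rw [h1, h, riesz]
  have h4 : (4 : ℝ) ^ (-((n : ℝ) / 2)) = 4 ^ (-((n : ℝ) / 2 - β)) * 4 ^ (-β) := by
    rw [← Real.rpow_add (by norm_num)]; congr 1; ring
  have hpos : (0 : ℝ) < 4 ^ (-((n : ℝ) / 2 - β)) := by positivity
  rw [Real.mul_rpow (by norm_num) Real.pi_pos.le, Real.div_rpow (by positivity) (by norm_num),
    ← Real.rpow_natCast, ← Real.rpow_mul hx'.le,
    show ((2 : ℕ) : ℝ) * -((n : ℝ) / 2 - β) = 2 * β - n by push_cast; ring, h4]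
  generalize (4 : ℝ) ^ (-((n : ℝ) / 2 - β)) = A at hpos ⊢
  field_simp

theorem integrableOn_rpow_mul_heat {β : ℝ} (hβ : β < n / 2) {x : Rn n} (hx : x ≠ 0) :
    IntegrableOn (fun r : ℝ => r ^ (β - 1) * heat r x) (Ioi 0) :=
  Integrable.of_integral_ne_zero (by rw [integral_rpow_mul_heat hβ hx]; exact (riesz_pos hβ hx).ne')

/-- The heat semigroup applied to the Riesz kernel. -/
noncomputable def heatRiesz (β t : ℝ) (x : Rn n) : ℝ :=
  ∫ r in Ioi (0 : ℝ), r ^ (β - 1) * heat (r + t) x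

/-- Near `r = 0` the heat factor is bounded by a multiple of `t ^ (-n/2)` and `0 < β` suffices; at
infinity it decays like `r ^ (-n/2)` and `β < n/2` suffices. -/
theorem integrableOn_heatRiesz {β t : ℝ} (hβ0 : 0 < β) (hβ : β < n / 2) (ht : 0 < t) (x : Rn n) :
    IntegrableOn (fun r : ℝ => r ^ (β - 1) * heat (r + t) x) (Ioi 0) := by
  have hm : Measurable fun r : ℝ => r ^ (β - 1) * heat (r + t) x :=
    (by fun_prop : Measurable fun r : ℝ => r ^ (β - 1)).mul
      (measurable_heat.comp (by fun_prop : Measurable fun r : ℝ => (r + t, x)))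
  have hb : ∀ r : ℝ, 0 < r → ∀ m : ℝ, 0 < m → m ≤ r + t →
      ‖r ^ (β - 1) * heat (r + t) x‖ ≤
        (4 * Real.pi) ^ (-((n : ℝ) / 2)) * (r ^ (β - 1) * m ^ (-((n : ℝ) / 2))) := by
    intro r hr m hm hmr
    have h1 : 0 < heat (r + t) x := heat_pos (by linarith) x
    rw [Real.norm_of_nonneg (by positivity)]
    calc r ^ (β - 1) * heat (r + t) x
        ≤ r ^ (β - 1) * (4 * Real.pi * (r + t)) ^ (-((n : ℝ) / 2)) := by
          gcongr; exact heat_le (by linarith) x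
      _ ≤ r ^ (β - 1) * (4 * Real.pi * m) ^ (-((n : ℝ) / 2)) := by
          gcongr r ^ (β - 1) * ?_
          exact Real.rpow_le_rpow_of_nonpos (by positivity) (by gcongr) (by simp; positivity)
      _ = _ := by rw [Real.mul_rpow (by positivity) hm.le]; ring
  rw [← Ioc_union_Ioi_eq_Ioi (zero_le_one' ℝ)]
  refine IntegrableOn.union ?_ ?_
  · have h1 : IntegrableOn (fun r : ℝ => (4 * Real.pi) ^ (-((n : ℝ) / 2)) *
        (r ^ (β - 1) * t ^ (-((n : ℝ) / 2)))) (Ioc 0 1) := by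
      refine Integrable.const_mul (Integrable.mul_const ?_ _) _
      rw [← IntegrableOn, integrableOn_Ioc_iff_integrableOn_Ioo,
        intervalIntegral.integrableOn_Ioo_rpow_iff one_pos]
      linarith
    refine Integrable.mono' h1 hm.aestronglyMeasurable ?_
    exact (ae_restrict_iff' measurableSet_Ioc).2
      (Eventually.of_forall fun r hr => hb r hr.1 t ht (by linarith [hr.1]))
  · have h1 : IntegrableOn (fun r : ℝ => (4 * Real.pi) ^ (-((n : ℝ) / 2)) *
        (r ^ (β - 1 - n / 2))) (Ioi 1) :=
      (integrableOn_Ioi_rpow_of_lt (by linarith) one_pos).const_mul _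
    refine Integrable.mono' h1 hm.aestronglyMeasurable ?_
    refine (ae_restrict_iff' measurableSet_Ioi).2 (Eventually.of_forall fun r hr => ?_)
    have hr0 : (0 : ℝ) < r := one_pos.trans hr
    have := hb r hr0 r hr0 (by linarith)
    rwa [← Real.rpow_add hr0] at this

theorem heatRiesz_nonneg {β t : ℝ} (ht : 0 < t) (x : Rn n) : 0 ≤ heatRiesz β t x := by
  refine setIntegral_nonneg measurableSet_Ioi fun r hr => ?_
  have hr : 0 < r := hr
  exact mul_nonneg (by positivity) (heat_pos (by linarith) x).le

theorem heatRiesz_le {β t : ℝ} (hβ0 : 0 < β) (hβ : β < n / 2) (ht : 0 < t) (x : Rn n) :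
    heatRiesz β t x ≤ heatRiesz β t (0 : Rn n) := by
  refine setIntegral_mono_on (integrableOn_heatRiesz hβ0 hβ ht x)
    (integrableOn_heatRiesz hβ0 hβ ht 0) measurableSet_Ioi fun r hr => ?_
  have hr : 0 < r := hr
  refine mul_le_mul_of_nonneg_left ?_ (by positivity)
  refine (heat_le (by linarith) x).trans (le_of_eq ?_)
  simp [heat]

theorem measurable_heatRiesz (β : ℝ) :
    Measurable fun z : ℝ × Rn n => heatRiesz β z.1 z.2 := by
  unfold heatRiesz
  have : StronglyMeasurable fun z : (ℝ × Rn n) × ℝ => z.2 ^ (β - 1) * heat (z.2 + z.1.1) z.1.2 :=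
    ((by fun_prop : Measurable fun z : (ℝ × Rn n) × ℝ => z.2 ^ (β - 1)).mul
      (measurable_heat.comp
        (by fun_prop : Measurable fun z : (ℝ × Rn n) × ℝ => (z.2 + z.1.1, z.1.2)))
        ).stronglyMeasurable
  exact this.integral_prod_right'.measurable

theorem ae_ne_zero (hn : 0 < n) : ∀ᵐ x : Rn n, x ≠ 0 := by
  have : Nonempty (Fin n) := ⟨⟨0, hn⟩⟩
  simp [ae_iff]

/-- `heatRiesz β t` is the convolution of the heat kernel and the Riesz kernel. -/
theorem integral_heat_mul_riesz (hn : 0 < n) {β t : ℝ} (hβ0 : 0 < β) (hβ : β < n / 2)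
    (ht : 0 < t) (x : Rn n) :
    Integrable (fun y : Rn n => heat t (x - y) * riesz β y) ∧
      ∫ y : Rn n, heat t (x - y) * riesz β y = heatRiesz β t x := by
  set f : Rn n × ℝ → ℝ := fun z => heat t (x - z.1) * (z.2 ^ (β - 1) * heat z.2 z.1) with hf
  have hfm : Measurable f :=
    ((continuous_heat t).measurable.comp (by fun_prop : Measurable fun z : Rn n × ℝ => x - z.1)).mul
      ((by fun_prop : Measurable fun z : Rn n × ℝ => z.2 ^ (β - 1)).mul
        (measurable_heat.comp (by fun_prop : Measurable fun z : Rn n × ℝ => (z.2, z.1))))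
  have hslice : ∀ r : ℝ, 0 < r → ∫ y : Rn n, f (y, r) = r ^ (β - 1) * heat (r + t) x := by
    intro r hr
    simp only [hf]
    rw [← integral_heat_mul_heat ht hr, ← integral_const_mul]
    congr 1; ext y; ring
  have hInt : Integrable f (volume.prod (volume.restrict (Ioi 0))) := by
    rw [integrable_prod_iff' hfm.aestronglyMeasurable]
    constructor
    · refine (ae_restrict_iff' measurableSet_Ioi).2 (Eventually.of_forall fun r hr => ?_)
      have hr : 0 < r := hr
      refine Integrable.of_integral_ne_zero ?_
      rw [hslice r hr]
      have := heat_pos (by linarith : 0 < r + t) x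
      positivity
    · refine (integrableOn_heatRiesz hβ0 hβ ht x).congr_fun (fun r hr => ?_) measurableSet_Ioi
      have hr : 0 < r := hr
      simp only
      rw [← hslice r hr]
      congr 1; ext y
      have h1 := heat_pos ht (x - y)
      have h2 := heat_pos hr y
      rw [Real.norm_of_nonneg]; simp only [hf]; positivity
  have hy : ∀ᵐ y : Rn n, ∫ r in Ioi (0 : ℝ), f (y, r) = heat t (x - y) * riesz β y := by
    filter_upwards [ae_ne_zero hn] with y hy
    simp only [hf]
    rw [integral_const_mul, integral_rpow_mul_heat hβ hy]
  refine ⟨hInt.integral_prod_left.congr hy, ?_⟩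
  rw [← integral_congr_ae hy, integral_integral_swap hInt]
  exact setIntegral_congr_fun measurableSet_Ioi fun r hr => hslice r hr

end FracHardy

/-! ### Increments of the Riesz kernel along the heat flow. -/

namespace FracHardy

variable {n : ℕ}

/-- The Riesz kernel is a generalized eigenfunction: integrating its increments along the heat flow
against `t^(-1-a)` gives another Riesz kernel. -/
theorem integral_riesz_sub_heatRiesz {a b : ℝ} (ha : 0 < a) (ha1 : a < 1) (hab : a < b)
    (hb : b < n / 2) {x : Rn n} (hx : x ≠ 0) :
    IntegrableOn (fun t : ℝ => t ^ (-1 - a) * (riesz b x - heatRiesz b t x)) (Ioi 0) ∧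
    ∫ t in Ioi (0 : ℝ), t ^ (-1 - a) * (riesz b x - heatRiesz b t x) =
      Real.Gamma (1 - a) / a * (Real.Gamma b / Real.Gamma (b - a)) * riesz (b - a) x ∧
    ∫ t in Ioi (0 : ℝ), |t ^ (-1 - a) * (riesz b x - heatRiesz b t x)| ≤
      (∫ τ in Ioi (0 : ℝ), |betaReg a b τ|) * riesz (b - a) x := by
  have hb0 : 0 < b := ha.trans hab
  have hba : b - a < n / 2 := by linarith
  obtain ⟨hβi, hβv⟩ := integrableOn_betaReg ha ha1 hab
  set μ : Measure ℝ := volume.restrict (Ioi 0) with hμ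
  -- With the total time `ρ = r + t` as variable, the increment is the integral of `(ρ^(b-1) -
  -- (ρ-t)₊^(b-1)) heat ρ x`. After multiplication by `t^(-1-a)` the bracket is a function of `t/ρ`
  -- times a power of `ρ`, namely `Φ`. Integrating in `t` first gives the integral of `betaReg`
  -- times `ρ^(b-a-1) heat ρ x`, the Mellin integrand of `riesz (b - a)`.
  set Φ : ℝ × ℝ → ℝ := fun z => z.2 ^ (b - 2 - a) * betaReg a b (z.2⁻¹ * z.1) * heat z.2 x with hΦ
  have hΦm : Measurable Φ :=
    ((by fun_prop : Measurable fun z : ℝ × ℝ => z.2 ^ (b - 2 - a)).mul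
      ((measurable_betaReg a b).comp (by fun_prop : Measurable fun z : ℝ × ℝ => z.2⁻¹ * z.1))).mul
      (measurable_heat.comp (by fun_prop : Measurable fun z : ℝ × ℝ => (z.2, x)))
  have hscale : ∀ (ψ : ℝ → ℝ) (ρ : ℝ), 0 < ρ →
      ∫ t in Ioi 0, ρ ^ (b - 2 - a) * ψ (ρ⁻¹ * t) * heat ρ x =
        (∫ τ in Ioi 0, ψ τ) * (ρ ^ (b - a - 1) * heat ρ x) := by
    intro ψ ρ hρ
    rw [integral_mul_const, integral_const_mul,
      integral_comp_mul_left_Ioi (fun t => ψ t) 0 (inv_pos.2 hρ), inv_inv, mul_zero, smul_eq_mul,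
      show b - a - 1 = (b - 2 - a) + 1 by ring, Real.rpow_add_one hρ.ne']
    ring
  have hΦi : Integrable Φ (μ.prod μ) := by
    rw [integrable_prod_iff' hΦm.aestronglyMeasurable]
    constructor
    · refine (ae_restrict_iff' measurableSet_Ioi).2 (Eventually.of_forall fun ρ hρ => ?_)
      have hρ : 0 < ρ := hρ
      have : IntegrableOn (fun t => betaReg a b (ρ⁻¹ * t)) (Ioi 0) := by
        rw [integrableOn_Ioi_comp_mul_left_iff _ _ (inv_pos.2 hρ), mul_zero]; exact hβi
      exact (this.const_mul (ρ ^ (b - 2 - a))).mul_const (heat ρ x)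
    · refine ((integrableOn_rpow_mul_heat hba hx).const_mul
        (∫ τ in Ioi (0 : ℝ), |betaReg a b τ|)).congr ?_
      refine (ae_restrict_iff' measurableSet_Ioi).2 (Eventually.of_forall fun ρ hρ => ?_)
      have hρ : 0 < ρ := hρ
      simp only
      rw [← hscale (fun τ => |betaReg a b τ|) ρ hρ]
      congr 1; ext t
      simp only [hΦ, norm_mul, Real.norm_eq_abs]
      rw [abs_of_pos (Real.rpow_pos_of_pos hρ _), abs_of_pos (heat_pos hρ x)]
  have hslice : ∀ t : ℝ, 0 < t →
      ∫ ρ in Ioi 0, Φ (t, ρ) = t ^ (-1 - a) * (riesz b x - heatRiesz b t x) := by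
    intro t ht
    set g : ℝ → ℝ := fun ρ => (ρ - t) ^ (b - 1) * heat ρ x with hg
    have hpre : (fun r : ℝ => r + t) ⁻¹' Ioi t = Ioi 0 := by ext r; simp
    have hgi : IntegrableOn g (Ioi t) := by
      rw [← (measurePreserving_add_right volume t).integrableOn_comp_preimage
        (measurableEmbedding_addRight t), hpre]
      refine (integrableOn_heatRiesz hb0 hb ht x).congr_fun (fun r _ => ?_) measurableSet_Ioi
      simp [hg]
    have hgv : ∫ ρ in Ioi t, g ρ = heatRiesz b t x := by
      rw [← (measurePreserving_add_right volume t).setIntegral_preimage_emb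
        (measurableEmbedding_addRight t), hpre, heatRiesz]
      refine setIntegral_congr_fun measurableSet_Ioi fun r _ => ?_
      simp [hg]
    have hsub : Ioi t ∩ Ioi 0 = Ioi t := inter_eq_left.2 (Ioi_subset_Ioi ht.le)
    have hI : IntegrableOn ((Ioi t).indicator g) (Ioi 0) := by
      rw [IntegrableOn, integrable_indicator_iff measurableSet_Ioi, IntegrableOn,
        Measure.restrict_restrict measurableSet_Ioi, hsub]
      exact hgi
    have hIv : ∫ ρ in Ioi 0, (Ioi t).indicator g ρ = heatRiesz b t x := by
      rw [setIntegral_indicator measurableSet_Ioi, inter_comm, hsub, hgv]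
    rw [← hIv, ← integral_rpow_mul_heat hb hx, ← integral_sub (integrableOn_rpow_mul_heat hb hx) hI,
      ← integral_const_mul]
    refine setIntegral_congr_fun measurableSet_Ioi fun ρ hρ => ?_
    have hρ : 0 < ρ := hρ
    have e1 : ρ ^ (b - 2 - a) * (ρ⁻¹ * t) ^ (-1 - a) = t ^ (-1 - a) * ρ ^ (b - 1) := by
      rw [Real.mul_rpow (inv_nonneg.2 hρ.le) ht.le, Real.inv_rpow hρ.le, ← Real.rpow_neg hρ.le,
        ← mul_assoc, ← Real.rpow_add hρ, mul_comm]
      congr 2; ring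
    simp only [hΦ, betaReg, indicator, mem_Ioi]
    by_cases htρ : t < ρ
    · have h1 : ρ⁻¹ * t < 1 := by rw [inv_mul_lt_iff₀ hρ]; linarith
      have e2 : ρ ^ (b - 1) * (1 - ρ⁻¹ * t) ^ (b - 1) = (ρ - t) ^ (b - 1) := by
        rw [← Real.mul_rpow hρ.le (by linarith)]; congr 1; field_simp
      rw [if_pos htρ, if_pos h1]
      simp only [hg]
      rw [← e2, ← mul_assoc, e1]; ring
    · have h1 : ¬ ρ⁻¹ * t < 1 := by rw [inv_mul_lt_iff₀ hρ]; linarith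
      rw [if_neg htρ, if_neg h1, ← mul_assoc, e1]; ring
  have hae : ∀ᵐ t ∂μ, ∫ ρ, Φ (t, ρ) ∂μ = t ^ (-1 - a) * (riesz b x - heatRiesz b t x) :=
    (ae_restrict_iff' measurableSet_Ioi).2 (Eventually.of_forall fun t ht => hslice t ht)
  refine ⟨hΦi.integral_prod_left.congr hae, ?_, ?_⟩
  · rw [← integral_congr_ae hae, integral_integral_swap hΦi, ← integral_rpow_mul_heat hba hx, ← hβv,
      ← integral_const_mul]
    exact setIntegral_congr_fun measurableSet_Ioi fun ρ hρ => hscale _ ρ hρ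
  · have h1 : ∫ t, |t ^ (-1 - a) * (riesz b x - heatRiesz b t x)| ∂μ ≤
        ∫ t, (∫ ρ, ‖Φ (t, ρ)‖ ∂μ) ∂μ := by
      refine integral_mono_ae (hΦi.integral_prod_left.congr hae).abs hΦi.norm.integral_prod_left ?_
      filter_upwards [hae] with t ht
      rw [← ht]
      exact norm_integral_le_integral_norm (fun ρ => Φ (t, ρ))
    refine h1.trans (le_of_eq ?_)
    rw [integral_integral_swap hΦi.norm, ← integral_rpow_mul_heat hba hx, ← integral_const_mul]
    refine setIntegral_congr_fun measurableSet_Ioi fun ρ hρ => ?_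
    have hρ : 0 < ρ := hρ
    rw [← hscale (fun τ => |betaReg a b τ|) ρ hρ]
    congr 1; ext t
    simp only [hΦ, norm_mul, Real.norm_eq_abs]
    rw [abs_of_pos (Real.rpow_pos_of_pos hρ _), abs_of_pos (heat_pos hρ x)]

/-! ### The sharp fractional Hardy inequality -/

theorem integrable_of_bounded_support {f : Rn n → ℝ} {C R : ℝ} (hm : AEStronglyMeasurable f volume)
    (hb : ∀ x, |f x| ≤ C) (hs : ∀ x, R < ‖x‖ → f x = 0) : Integrable f := by
  have h1 : Integrable ((Metric.closedBall (0 : Rn n) R).indicator fun _ => C) := by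
    rw [integrable_indicator_iff Metric.isClosed_closedBall.measurableSet]
    exact integrableOn_const (measure_closedBall_lt_top.ne)
  refine h1.mono' hm (Eventually.of_forall fun x => ?_)
  by_cases hx : ‖x‖ ≤ R
  · rw [indicator_of_mem (by simpa using hx)]; exact hb x
  · rw [hs x (not_le.1 hx), norm_zero, indicator_of_notMem (by simpa using hx)]

theorem integrableOn_norm_rpow {α : ℝ} (hn : 0 < n) (hα : α < n) (R : ℝ) :
    IntegrableOn (fun x : Rn n => (‖x‖ ^ α)⁻¹) (Metric.closedBall 0 R) := by
  have : Nonempty (Fin n) := ⟨⟨0, hn⟩⟩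
  have : Nontrivial (Rn n) := inferInstance
  rw [← integrable_indicator_iff Metric.isClosed_closedBall.measurableSet]
  have e : (Metric.closedBall (0 : Rn n) R).indicator (fun x : Rn n => (‖x‖ ^ α)⁻¹) =
      fun x : Rn n => (Iic R).indicator (fun r : ℝ => (r ^ α)⁻¹) ‖x‖ := by
    ext x; simp [indicator]
  rw [e, integrable_fun_norm_addHaar volume (f := (Iic R).indicator (fun r : ℝ => (r ^ α)⁻¹)),
    finrank_euclideanSpace_fin]
  have e2 : (fun y : ℝ => y ^ (n - 1) • (Iic R).indicator (fun r : ℝ => (r ^ α)⁻¹) y) =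
      (Iic R).indicator fun y : ℝ => y ^ (n - 1) * (y ^ α)⁻¹ := by
    ext y; simp only [indicator]; split_ifs <;> simp
  rw [e2, IntegrableOn, integrable_indicator_iff measurableSet_Iic, IntegrableOn,
    Measure.restrict_restrict measurableSet_Iic]
  rcases le_or_gt R 0 with hR | hR
  · rw [show Iic R ∩ Ioi 0 = ∅ by ext y; simp; intro h; linarith]; simp
  rw [inter_comm, Ioi_inter_Iic]
  have : IntegrableOn (fun y : ℝ => y ^ ((n : ℝ) - 1 - α)) (Ioc 0 R) := by
    rw [integrableOn_Ioc_iff_integrableOn_Ioo, intervalIntegral.integrableOn_Ioo_rpow_iff hR]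
    linarith
  refine this.congr_fun (fun y hy => ?_) measurableSet_Ioc
  have hy : 0 < y := hy.1
  simp only
  rw [Real.rpow_sub hy, div_eq_mul_inv, ← Real.rpow_natCast, Nat.cast_sub hn, Nat.cast_one]

end FracHardy

/-! ### The ground state inequality for the heat semigroup, and Hardy's inequality for bounded
functions. -/

namespace FracHardy

variable {n : ℕ}

theorem heat_sub_comm (t : ℝ) (x y : Rn n) : heat t (x - y) = heat t (y - x) := by
  rw [← heat_neg, neg_sub]

theorem integrable_heat_mul_sq {u : Rn n → ℝ} (hu : Measurable u)
    (hu2 : Integrable fun x => u x ^ 2) {t : ℝ} (ht : 0 < t) :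
    Integrable (fun z : Rn n × Rn n => heat t (z.1 - z.2) * u z.1 ^ 2) (volume.prod volume) ∧
      ∫ z : Rn n × Rn n, heat t (z.1 - z.2) * u z.1 ^ 2 ∂(volume.prod volume) =
        ∫ x, u x ^ 2 := by
  have hm : Measurable fun z : Rn n × Rn n => heat t (z.1 - z.2) * u z.1 ^ 2 :=
    ((continuous_heat t).measurable.comp (by fun_prop)).mul (by fun_prop)
  have hv : ∀ x, ∫ y, heat t (x - y) * u x ^ 2 = u x ^ 2 := fun x => by
    rw [integral_mul_const, integral_heat_sub ht, one_mul]
  have hi : Integrable (fun z : Rn n × Rn n => heat t (z.1 - z.2) * u z.1 ^ 2)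
      (volume.prod volume) := by
    rw [integrable_prod_iff hm.aestronglyMeasurable]
    refine ⟨Eventually.of_forall fun x => (integrable_heat_sub ht x).mul_const (u x ^ 2), ?_⟩
    refine hu2.congr (Eventually.of_forall fun x => ?_)
    have : ∀ y, ‖heat t (x - y) * u x ^ 2‖ = heat t (x - y) * u x ^ 2 := fun y =>
      Real.norm_of_nonneg (mul_nonneg (heat_pos ht _).le (sq_nonneg _))
    simp only [this, hv]
  exact ⟨hi, by rw [integral_prod _ hi]; simp only [hv]⟩

/-- Ground state estimate for the quadratic form of the heat semigroup. -/
theorem ground_state_heat (hn : 0 < n) {b t M R : ℝ} (hb0 : 0 < b) (hb : b < n / 2) (ht : 0 < t)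
    (hR0 : 0 ≤ R) {u : Rn n → ℝ} (hu : Measurable u) (hM : ∀ x, |u x| ≤ M)
    (hR : ∀ x, R < ‖x‖ → u x = 0) :
    Integrable (fun z : Rn n × Rn n => heat t (z.1 - z.2) * (u z.1 - u z.2) ^ 2)
      (volume.prod volume) ∧
    2 * ∫ x, u x ^ 2 * (1 - heatRiesz b t x / riesz b x) ≤
      ∫ z : Rn n × Rn n, heat t (z.1 - z.2) * (u z.1 - u z.2) ^ 2 ∂(volume.prod volume) := by
  have hu2b : ∀ x, |u x ^ 2| ≤ M ^ 2 := fun x => by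
    rw [abs_pow]; exact pow_le_pow_left₀ (abs_nonneg _) (hM x) 2
  have hu2 : Integrable fun x => u x ^ 2 :=
    integrable_of_bounded_support (C := M ^ 2) (R := R) (by fun_prop) hu2b
      fun x hx => by rw [hR x hx]; simp
  obtain ⟨h1i, h1v⟩ := integrable_heat_mul_sq hu hu2 ht
  set c : ℝ := (Real.pi ^ (-((n : ℝ) / 2)) * 4 ^ (-b) * Real.Gamma (n / 2 - b))⁻¹ with hc
  have hc0 : 0 < c := by
    have : 0 < (n : ℝ) / 2 - b := by linarith
    rw [hc]; positivity
  have hmr : Measurable fun x : Rn n => riesz b x := measurable_riesz b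
  have hmp : Measurable fun x : Rn n => heatRiesz b t x :=
    (measurable_heatRiesz b).comp (by fun_prop : Measurable fun x : Rn n => (t, x))
  have hw : ∀ x : Rn n, ‖x‖ ≤ R → (riesz b x)⁻¹ ≤ c * R ^ ((n : ℝ) - 2 * b) := by
    intro x hx
    by_cases hx0 : x = 0
    -- At the origin the power of `0` with nonzero exponent is `0`, so `riesz` and its inverse both
    -- take the value `0`. Elsewhere the inverse is a positive power of `‖x‖`, bounded on the ball.
    · have : riesz b x = 0 := by
        rw [riesz, hx0, norm_zero, Real.zero_rpow (by linarith), mul_zero]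
      rw [this, inv_zero]; positivity
    rw [riesz, mul_inv, ← hc, ← Real.rpow_neg (norm_nonneg x), neg_sub]
    gcongr
    linarith
  have h2x : Integrable fun x => u x ^ 2 * (heatRiesz b t x / riesz b x) := by
    refine integrable_of_bounded_support (R := R)
      (C := M ^ 2 * (heatRiesz b t (0 : Rn n) * (c * R ^ ((n : ℝ) - 2 * b))))
      (by fun_prop) (fun x => ?_) fun x hx => by rw [hR x hx]; simp
    by_cases hx : ‖x‖ ≤ R
    · have h0 := riesz_nonneg hb x
      have h3 := heatRiesz_nonneg (β := b) ht x
      have h4 := heatRiesz_nonneg (β := b) ht (0 : Rn n)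
      rw [abs_mul, abs_of_nonneg (div_nonneg h3 h0), div_eq_mul_inv]
      gcongr
      · exact hu2b x
      · exact heatRiesz_le hb0 hb ht x
      · exact hw x hx
    · rw [hR x (not_le.1 hx)]
      have h4 := heatRiesz_nonneg (β := b) ht (0 : Rn n)
      simp only [ne_eq, OfNat.ofNat_ne_zero, not_false_eq_true, zero_pow, zero_mul, abs_zero]
      positivity
  have hm2 : Measurable fun z : Rn n × Rn n =>
      heat t (z.1 - z.2) * riesz b z.2 * (u z.1 ^ 2 / riesz b z.1) :=
    (((continuous_heat t).measurable.comp (by fun_prop)).mul (hmr.comp measurable_snd)).mul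
      (((hu.comp measurable_fst).pow_const 2).div (hmr.comp measurable_fst))
  have h2v : ∀ x, ∫ y, heat t (x - y) * riesz b y * (u x ^ 2 / riesz b x) =
      u x ^ 2 * (heatRiesz b t x / riesz b x) := fun x => by
    rw [integral_mul_const, (integral_heat_mul_riesz hn hb0 hb ht x).2]; ring
  have h2i : Integrable (fun z : Rn n × Rn n =>
      heat t (z.1 - z.2) * riesz b z.2 * (u z.1 ^ 2 / riesz b z.1)) (volume.prod volume) := by
    rw [integrable_prod_iff hm2.aestronglyMeasurable]
    refine ⟨Eventually.of_forall fun x =>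
      (integral_heat_mul_riesz hn hb0 hb ht x).1.mul_const (u x ^ 2 / riesz b x), ?_⟩
    refine h2x.congr (Eventually.of_forall fun x => ?_)
    simp only
    rw [← h2v x]
    congr 1; ext y
    have h3 := riesz_nonneg hb y
    have h4 := riesz_nonneg hb x
    have h5 := heat_pos ht (x - y)
    rw [Real.norm_of_nonneg (by positivity)]
  -- With `w = riesz b`, the symmetrized `k` is the heat kernel times `u(x)² + u(y)² -
  -- w(y)u(x)²/w(x) - w(x)u(y)²/w(y)`. This bracket is at most `(u(x)-u(y))²`, the difference being
  -- `(w(y)u(x) - w(x)u(y))² / (w(x)w(y))`.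
  set k : Rn n × Rn n → ℝ := fun z => heat t (z.1 - z.2) * u z.1 ^ 2 -
    heat t (z.1 - z.2) * riesz b z.2 * (u z.1 ^ 2 / riesz b z.1) with hk
  have hki : Integrable k (volume.prod volume) := h1i.sub h2i
  have hkv : ∫ z, k z ∂(volume.prod volume) = ∫ x, u x ^ 2 * (1 - heatRiesz b t x / riesz b x) := by
    rw [integral_sub h1i h2i, h1v, integral_prod _ h2i]
    simp only [h2v]
    rw [← integral_sub hu2 h2x]
    congr 1; ext x; ring
  have hEi : Integrable (fun z : Rn n × Rn n => heat t (z.1 - z.2) * (u z.1 - u z.2) ^ 2)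
      (volume.prod volume) := by
    refine ((h1i.add h1i.swap).const_mul 2).mono' ?_ (Eventually.of_forall fun z => ?_)
    · exact (((continuous_heat t).measurable.comp (by fun_prop)).mul
        (by fun_prop)).aestronglyMeasurable
    · have h5 := heat_pos ht (z.1 - z.2)
      rw [Real.norm_of_nonneg (by positivity)]
      simp only [Pi.add_apply, Function.comp_apply, Prod.fst_swap, Prod.snd_swap]
      rw [heat_sub_comm t z.2 z.1]
      nlinarith [mul_nonneg h5.le (sq_nonneg (u z.1 + u z.2))]
  refine ⟨hEi, ?_⟩
  have hsum : 2 * ∫ z, k z ∂(volume.prod volume) = ∫ z, (k z + k z.swap) ∂(volume.prod volume) := by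
    rw [integral_add hki (by exact hki.swap), integral_prod_swap]; ring
  rw [← hkv, hsum]
  refine integral_mono_ae (hki.add hki.swap) hEi ?_
  filter_upwards [Measure.quasiMeasurePreserving_fst.ae (ae_ne_zero hn),
    Measure.quasiMeasurePreserving_snd.ae (ae_ne_zero hn)] with z hz1 hz2
  have hw1 := riesz_pos hb hz1
  have hw2 := riesz_pos hb hz2
  have h5 := heat_pos ht (z.1 - z.2)
  simp only [hk, Prod.fst_swap, Prod.snd_swap]
  rw [heat_sub_comm t z.2 z.1]
  have key : 2 * (u z.1 * u z.2) ≤ riesz b z.2 * (u z.1 ^ 2 / riesz b z.1) +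
      riesz b z.1 * (u z.2 ^ 2 / riesz b z.2) := by
    have : riesz b z.2 * (u z.1 ^ 2 / riesz b z.1) + riesz b z.1 * (u z.2 ^ 2 / riesz b z.2) -
        2 * (u z.1 * u z.2) =
        (riesz b z.2 * u z.1 - riesz b z.1 * u z.2) ^ 2 / (riesz b z.1 * riesz b z.2) := by
      field_simp
      ring
    have h6 : 0 ≤ (riesz b z.2 * u z.1 - riesz b z.1 * u z.2) ^ 2 /
      (riesz b z.1 * riesz b z.2) := by positivity
    linarith
  nlinarith [mul_le_mul_of_nonneg_left key h5.le]

/-- The fractional Hardy inequality for bounded functions with bounded support. -/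
theorem hardy_of_bounded {α M R : ℝ} (hα0 : 0 < α) (hα2 : α < 2) (hαn : α < n) (hR0 : 0 ≤ R)
    {u : Rn n → ℝ} (hu : Measurable u) (hM : ∀ x, |u x| ≤ M) (hR : ∀ x, R < ‖x‖ → u x = 0)
    (hgag : Integrable (gagliardoIntegrand α u u) volume) :
    Integrable (fun x => u x ^ 2 / ‖x‖ ^ α) ∧
      gammaH n α * ∫ x, u x ^ 2 / ‖x‖ ^ α ≤ cConst n α * gagliardo α u u := by
  have hn : 0 < n := by
    rcases Nat.eq_zero_or_pos n with h | h
    · subst h; simp at hαn; linarith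
    · exact h
  set a : ℝ := α / 2 with ha
  -- The ground state is then a multiple of `|x|^(-(n-α)/2)`. For this `b` one has `n/2 - b = b - a`
  -- and `n/2 - b + a = b`, so the two Gamma quotients coincide and produce the square in `gammaH`.
  set b : ℝ := ((n : ℝ) + α) / 4 with hb
  have ha0 : 0 < a := by rw [ha]; linarith
  have ha1 : a < 1 := by rw [ha]; linarith
  have hab : a < b := by rw [ha, hb]; linarith
  have hbn : b < n / 2 := by rw [hb]; linarith
  have hb0 : 0 < b := by linarith
  have hu2b : ∀ x, |u x ^ 2| ≤ M ^ 2 := fun x => by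
    rw [abs_pow]; exact pow_le_pow_left₀ (abs_nonneg _) (hM x) 2
  have hVi : Integrable fun x => u x ^ 2 / ‖x‖ ^ α := by
    have h1 : Integrable ((Metric.closedBall (0 : Rn n) R).indicator
        fun x => M ^ 2 * (‖x‖ ^ α)⁻¹) := by
      rw [integrable_indicator_iff Metric.isClosed_closedBall.measurableSet]
      exact (integrableOn_norm_rpow hn hαn R).const_mul _
    refine h1.mono' (by fun_prop : Measurable _).aestronglyMeasurable
      (Eventually.of_forall fun x => ?_)
    by_cases hx : ‖x‖ ≤ R
    · rw [indicator_of_mem (by simpa using hx), norm_div, div_eq_mul_inv, Real.norm_eq_abs,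
        Real.norm_of_nonneg (by positivity : 0 ≤ ‖x‖ ^ α)]
      gcongr
      exact hu2b x
    · rw [hR x (not_le.1 hx), indicator_of_notMem (by simpa using hx)]; simp
  refine ⟨hVi, ?_⟩
  set μ : Measure ℝ := volume.restrict (Ioi 0) with hμ
  -- the Gagliardo form as an integral of the heat forms
  set e : (Rn n × Rn n) × ℝ → ℝ := fun z =>
    z.2 ^ (-1 - a) * (heat z.2 (z.1.1 - z.1.2) * (u z.1.1 - u z.1.2) ^ 2) with he
  have hem : Measurable e :=
    (by fun_prop : Measurable fun z : (Rn n × Rn n) × ℝ => z.2 ^ (-1 - a)).mul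
      ((measurable_heat.comp (by fun_prop :
        Measurable fun z : (Rn n × Rn n) × ℝ => (z.2, z.1.1 - z.1.2))).mul (by fun_prop))
  set K : ℝ := Real.pi ^ (-((n : ℝ) / 2)) * 4 ^ a * Real.Gamma (n / 2 + a) with hK
  have hez : ∀ z : Rn n × Rn n, ∫ t, e (z, t) ∂μ = K * gagliardoIntegrand α u u z ∧
      Integrable (fun t => e (z, t)) μ := by
    intro z
    by_cases hz : z.1 - z.2 = 0
    · have h0 : u z.1 - u z.2 = 0 := by rw [sub_eq_zero.1 hz, sub_self]
      simp [he, gagliardoIntegrand, h0]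
    have hna : -a < (n : ℝ) / 2 := by have : (0 : ℝ) ≤ n := by positivity
                                      linarith
    have e1 : ∀ t, e (z, t) = (t ^ (-a - 1) * heat t (z.1 - z.2)) * (u z.1 - u z.2) ^ 2 := by
      intro t; simp only [he]; rw [show -1 - a = -a - 1 by ring]; ring
    simp only [e1]
    refine ⟨?_, (integrableOn_rpow_mul_heat hna hz).mul_const _⟩
    rw [integral_mul_const, integral_rpow_mul_heat hna hz, riesz, gagliardoIntegrand, neg_neg,
      sub_neg_eq_add, ← hK, show 2 * -a - (n : ℝ) = -((n : ℝ) + α) by rw [ha]; ring,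
      Real.rpow_neg (norm_nonneg _)]
    ring
  have hei : Integrable e ((volume.prod volume).prod μ) := by
    rw [integrable_prod_iff hem.aestronglyMeasurable]
    refine ⟨Eventually.of_forall fun z => (hez z).2, ?_⟩
    refine (hgag.const_mul K).congr (Eventually.of_forall fun z => ?_)
    refine (hez z).1.symm.trans (setIntegral_congr_fun measurableSet_Ioi fun t ht => ?_)
    have ht : 0 < t := ht
    have := heat_pos ht (z.1 - z.2)
    rw [Real.norm_of_nonneg]
    simp only [he]; positivity
  have hev : ∫ t, (∫ z, e (z, t) ∂(volume.prod volume)) ∂μ = K * gagliardo α u u := by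
    rw [← integral_integral_swap hei, gagliardo, ← integral_const_mul]
    simp only [(hez _).1]
    rfl
  -- the potential as an integral over `t`
  set h : Rn n × ℝ → ℝ := fun z =>
    z.2 ^ (-1 - a) * (u z.1 ^ 2 * (1 - heatRiesz b z.2 z.1 / riesz b z.1)) with hh
  have hhm : Measurable h :=
    (by fun_prop : Measurable fun z : Rn n × ℝ => z.2 ^ (-1 - a)).mul
      ((by fun_prop : Measurable fun z : Rn n × ℝ => u z.1 ^ 2).mul (measurable_const.sub
        (((measurable_heatRiesz b).comp (by fun_prop :
          Measurable fun z : Rn n × ℝ => (z.2, z.1))).div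
          ((measurable_riesz b).comp measurable_fst))))
  set J : ℝ := Real.Gamma (1 - a) / a * (Real.Gamma b / Real.Gamma (b - a)) with hJ
  set r : ℝ := 4 ^ a * Real.Gamma (n / 2 - b + a) / Real.Gamma (n / 2 - b) with hr
  have hratio : ∀ x : Rn n, x ≠ 0 → riesz (b - a) x / riesz b x = r * (‖x‖ ^ α)⁻¹ := by
    intro x hx
    have hx' := norm_pos_iff.2 hx
    have h1 : 0 < Real.Gamma ((n : ℝ) / 2 - b) := Real.Gamma_pos_of_pos (by linarith)
    have h2 : ‖x‖ ^ (2 * (b - a) - (n : ℝ)) = ‖x‖ ^ (2 * b - (n : ℝ)) * (‖x‖ ^ α)⁻¹ := by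
      rw [← Real.rpow_neg hx'.le, ← Real.rpow_add hx']; congr 1; rw [ha]; ring
    have h3 : (4 : ℝ) ^ (-(b - a)) = 4 ^ (-b) * 4 ^ a := by
      rw [← Real.rpow_add (by norm_num)]; congr 1; ring
    have h4 : 0 < ‖x‖ ^ (2 * b - (n : ℝ)) := by positivity
    have h5 : (0 : ℝ) < 4 ^ (-b) := by positivity
    have h6 : 0 < Real.pi ^ (-((n : ℝ) / 2)) := by positivity
    rw [riesz, riesz, h2, h3, hr, show (n : ℝ) / 2 - (b - a) = n / 2 - b + a by ring]
    generalize ‖x‖ ^ (2 * b - (n : ℝ)) = A at h4 ⊢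
    generalize (4 : ℝ) ^ (-b) = A' at h5 ⊢
    generalize Real.pi ^ (-((n : ℝ) / 2)) = A'' at h6 ⊢
    generalize Real.Gamma ((n : ℝ) / 2 - b) = G at h1 ⊢
    field_simp
  have hhx : ∀ x : Rn n, x ≠ 0 → ∀ t, h (x, t) =
      t ^ (-1 - a) * (riesz b x - heatRiesz b t x) * (u x ^ 2 / riesz b x) := by
    intro x hx t
    have := riesz_pos hbn hx
    simp only [hh]; field_simp
  set J' : ℝ := ∫ τ in Ioi (0 : ℝ), |betaReg a b τ| with hJ'
  have hhi : Integrable h (volume.prod μ) := by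
    rw [integrable_prod_iff hhm.aestronglyMeasurable]
    constructor
    · filter_upwards [ae_ne_zero hn] with x hx
      simp only [hhx x hx]
      exact (integral_riesz_sub_heatRiesz ha0 ha1 hab hbn hx).1.mul_const _
    · refine (hVi.const_mul (J' * r)).mono' hhm.aestronglyMeasurable.norm.integral_prod_right' ?_
      filter_upwards [ae_ne_zero hn] with x hx
      rw [Real.norm_of_nonneg (integral_nonneg fun _ => norm_nonneg _)]
      have h0 := riesz_pos hbn hx
      simp only [hhx x hx, norm_mul (_ * _), Real.norm_eq_abs]
      rw [integral_mul_const, abs_of_nonneg (by positivity : 0 ≤ u x ^ 2 / riesz b x)]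
      calc _ ≤ J' * riesz (b - a) x * (u x ^ 2 / riesz b x) := by
            gcongr
            exact (integral_riesz_sub_heatRiesz ha0 ha1 hab hbn hx).2.2
        _ = J' * u x ^ 2 * (riesz (b - a) x / riesz b x) := by ring
        _ = _ := by rw [hratio x hx]; ring
  have hhv : ∫ t, (∫ x, h (x, t)) ∂μ = J * r * ∫ x, u x ^ 2 / ‖x‖ ^ α := by
    rw [← integral_integral_swap hhi, ← integral_const_mul]
    refine integral_congr_ae ?_
    filter_upwards [ae_ne_zero hn] with x hx
    simp only [hhx x hx]
    rw [integral_mul_const, (integral_riesz_sub_heatRiesz ha0 ha1 hab hbn hx).2.1]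
    calc _ = J * u x ^ 2 * (riesz (b - a) x / riesz b x) := by rw [hJ]; ring
      _ = _ := by rw [hratio x hx]; ring
  -- The ground state inequality at each time `t`, integrated against `t ^ (-1 - a)`.
  have hmain : 2 * (J * r * ∫ x, u x ^ 2 / ‖x‖ ^ α) ≤ K * gagliardo α u u := by
    rw [← hhv, ← hev, ← integral_const_mul]
    refine integral_mono_ae (hhi.integral_prod_right.const_mul 2) hei.integral_prod_right ?_
    refine (ae_restrict_iff' measurableSet_Ioi).2 (Eventually.of_forall fun t ht => ?_)
    have ht : 0 < t := ht
    simp only [hh, he, integral_const_mul]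
    have := (ground_state_heat hn hb0 hbn ht hR0 hu hM hR).2
    have := mul_le_mul_of_nonneg_left this (by positivity : 0 ≤ t ^ (-1 - a))
    linarith
  -- comparison of the constants
  have hK0 : 0 < K := by rw [hK]; positivity
  have hΓ : Real.Gamma (-α / 2) = -(Real.Gamma (1 - a) / a) := by
    have h1 := Real.Gamma_add_one (by linarith : -a ≠ 0)
    rw [show -α / 2 = -a by rw [ha]; ring, show 1 - a = -a + 1 by ring, h1]
    field_simp
  have hΓ1 : 0 < Real.Gamma (1 - a) := Real.Gamma_pos_of_pos (by linarith)
  have hc : cConst n α = K / (2 * (Real.Gamma (1 - a) / a)) := by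
    rw [cConst, hΓ, abs_neg, abs_of_pos (by positivity), hK, show ((n : ℝ) + α) / 2 = n / 2 + a by
      rw [ha]; ring, Real.rpow_neg Real.pi_pos.le, Real.rpow_sub_one (by norm_num),
      show (4 : ℝ) ^ a = 2 ^ α by
        rw [show (4 : ℝ) = 2 ^ (2 : ℝ) by norm_num, ← Real.rpow_mul (by norm_num)]
        congr 1; rw [ha]; ring]
    field_simp
  have hγ : gammaH n α * (Real.Gamma (1 - a) / a) = J * r := by
    rw [gammaH, hJ, hr, show (n : ℝ) / 2 - b + a = ((n : ℝ) + α) / 4 by rw [ha, hb]; ring,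
      show (n : ℝ) / 2 - b = ((n : ℝ) - α) / 4 by rw [hb]; ring,
      show b - a = ((n : ℝ) - α) / 4 by rw [ha, hb]; ring,
      show (4 : ℝ) ^ a = 2 ^ α by
        rw [show (4 : ℝ) = 2 ^ (2 : ℝ) by norm_num, ← Real.rpow_mul (by norm_num)]
        congr 1; rw [ha]; ring, ← hb]
    field_simp
  rw [hc, div_mul_eq_mul_div, le_div_iff₀ (by positivity)]
  calc _ = 2 * (gammaH n α * (Real.Gamma (1 - a) / a) * ∫ x, u x ^ 2 / ‖x‖ ^ α) := by ring
    _ ≤ _ := by rw [hγ]; exact hmain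

end FracHardy

namespace FracHardy

variable {n : ℕ} {α : ℝ}

/-- Fatou's lemma for nonnegative real functions with bounded integrals. -/
theorem integral_le_of_tendsto {X : Type*} [MeasurableSpace X] {μ : Measure X} {f : ℕ → X → ℝ}
    {g : X → ℝ} {C : ℝ} (hf : ∀ k, Integrable (f k) μ) (hnn : ∀ k, 0 ≤ᵐ[μ] f k)
    (hlim : ∀ᵐ x ∂μ, Tendsto (fun k => f k x) atTop (𝓝 (g x))) (hC : ∀ k, ∫ x, f k x ∂μ ≤ C) :
    Integrable g μ ∧ ∫ x, g x ∂μ ≤ C := by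
  have hC0 : 0 ≤ C := (integral_nonneg_of_ae (hnn 0)).trans (hC 0)
  have hgm : AEStronglyMeasurable g μ := aestronglyMeasurable_of_tendsto_ae atTop
    (fun k => (hf k).aestronglyMeasurable) hlim
  have hg0 : 0 ≤ᵐ[μ] g := by
    filter_upwards [hlim, ae_all_iff.2 hnn] with x hx hx0
    exact ge_of_tendsto hx (Eventually.of_forall hx0)
  have h1 : ∫⁻ x, ENNReal.ofReal (g x) ∂μ ≤ ENNReal.ofReal C := by
    calc ∫⁻ x, ENNReal.ofReal (g x) ∂μ
        = ∫⁻ x, liminf (fun k => ENNReal.ofReal (f k x)) atTop ∂μ := by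
          refine lintegral_congr_ae ?_
          filter_upwards [hlim] with x hx
          exact ((ENNReal.continuous_ofReal.tendsto _).comp hx).liminf_eq.symm
      _ ≤ liminf (fun k => ∫⁻ x, ENNReal.ofReal (f k x) ∂μ) atTop :=
          lintegral_liminf_le' fun k => (hf k).aestronglyMeasurable.aemeasurable.ennreal_ofReal
      _ ≤ ENNReal.ofReal C := by
          refine liminf_le_of_le (by isBoundedDefault) fun b hb => ?_
          obtain ⟨k, hk⟩ := hb.exists
          refine hk.trans ?_
          rw [← ofReal_integral_eq_lintegral_ofReal (hf k) (hnn k)]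
          exact ENNReal.ofReal_le_ofReal (hC k)
  refine ⟨(lintegral_ofReal_ne_top_iff_integrable hgm hg0).1
    (h1.trans_lt ENNReal.ofReal_lt_top).ne, ?_⟩
  rw [integral_eq_lintegral_of_nonneg_ae hg0 hgm]
  exact ENNReal.toReal_le_of_le_ofReal hC0 h1

/-! ### The Gagliardo form -/

theorem aestronglyMeasurable_sub {u : Rn n → ℝ} (hu : AEStronglyMeasurable u volume) :
    AEStronglyMeasurable (fun z : Rn n × Rn n => u z.1 - u z.2) volume :=
  (hu.comp_quasiMeasurePreserving Measure.quasiMeasurePreserving_fst).sub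
    (hu.comp_quasiMeasurePreserving Measure.quasiMeasurePreserving_snd)

theorem aestronglyMeasurable_gagliardoIntegrand {u v : Rn n → ℝ}
    (hu : AEStronglyMeasurable u volume) (hv : AEStronglyMeasurable v volume) :
    AEStronglyMeasurable (gagliardoIntegrand α u v) volume := by
  unfold gagliardoIntegrand
  have h1 : Measurable fun z : Rn n × Rn n => (‖z.1 - z.2‖ ^ ((n : ℝ) + α))⁻¹ := by fun_prop
  simp only [div_eq_mul_inv]
  exact ((aestronglyMeasurable_sub hu).mul (aestronglyMeasurable_sub hv)).mul
    h1.aestronglyMeasurable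

theorem gagliardoIntegrand_self_nonneg (u : Rn n → ℝ) (z : Rn n × Rn n) :
    0 ≤ gagliardoIntegrand α u u z :=
  div_nonneg (mul_self_nonneg _) (by positivity)

theorem gagliardo_self_nonneg (u : Rn n → ℝ) : 0 ≤ gagliardo α u u :=
  integral_nonneg (gagliardoIntegrand_self_nonneg u)

theorem abs_gagliardoIntegrand_le (u v : Rn n → ℝ) (z : Rn n × Rn n) :
    |gagliardoIntegrand α u v z| ≤ gagliardoIntegrand α u u z + gagliardoIntegrand α v v z := by
  unfold gagliardoIntegrand
  rw [abs_div, ← add_div, abs_of_nonneg (by positivity : 0 ≤ ‖z.1 - z.2‖ ^ ((n : ℝ) + α)), abs_mul]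
  gcongr
  nlinarith [abs_mul_abs_self (u z.1 - u z.2), abs_mul_abs_self (v z.1 - v z.2),
    sq_nonneg (|u z.1 - u z.2| - |v z.1 - v z.2|), abs_nonneg (u z.1 - u z.2),
    abs_nonneg (v z.1 - v z.2)]

theorem integrable_gagliardoIntegrand {u v : Rn n → ℝ} (hu : MemH α u) (hv : MemH α v) :
    Integrable (gagliardoIntegrand α u v) volume :=
  (hu.2.add hv.2).mono' (aestronglyMeasurable_gagliardoIntegrand hu.1.1 hv.1.1)
    (Eventually.of_forall fun z => abs_gagliardoIntegrand_le u v z)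

theorem gagliardoIntegrand_congr {u u' v v' : Rn n → ℝ} (hu : u =ᵐ[volume] u')
    (hv : v =ᵐ[volume] v') : gagliardoIntegrand α u v =ᵐ[volume] gagliardoIntegrand α u' v' := by
  filter_upwards [Measure.quasiMeasurePreserving_fst.ae hu,
    Measure.quasiMeasurePreserving_snd.ae hu, Measure.quasiMeasurePreserving_fst.ae hv,
    Measure.quasiMeasurePreserving_snd.ae hv] with z h1 h2 h3 h4
  simp only [gagliardoIntegrand, h1, h2, h3, h4]

theorem gagliardo_congr {u u' v v' : Rn n → ℝ} (hu : u =ᵐ[volume] u')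
    (hv : v =ᵐ[volume] v') : gagliardo α u v = gagliardo α u' v' :=
  integral_congr_ae (gagliardoIntegrand_congr hu hv)

theorem MemH.congr {u u' : Rn n → ℝ} (h : MemH α u) (hu : u =ᵐ[volume] u') : MemH α u' :=
  ⟨h.1.ae_eq hu, h.2.congr (gagliardoIntegrand_congr hu hu)⟩

/-- A function dominated by `u`, together with its increments, inherits `MemH`. -/
theorem MemH.of_le {u v : Rn n → ℝ} (h : MemH α u) (hv : AEStronglyMeasurable v volume)
    (h1 : ∀ x, |v x| ≤ |u x|) (h2 : ∀ x y, |v x - v y| ≤ |u x - u y|) :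
    MemH α v ∧ gagliardo α v v ≤ gagliardo α u u := by
  have h3 : ∀ z, gagliardoIntegrand α v v z ≤ gagliardoIntegrand α u u z := fun z => by
    unfold gagliardoIntegrand
    gcongr ?_ / _
    rw [← abs_mul_abs_self (v z.1 - v z.2), ← abs_mul_abs_self (u z.1 - u z.2)]
    exact mul_self_le_mul_self (abs_nonneg _) (h2 _ _)
  have h4 : Integrable (gagliardoIntegrand α v v) volume :=
    h.2.mono' (aestronglyMeasurable_gagliardoIntegrand hv hv) (Eventually.of_forall fun z => by
      rw [Real.norm_of_nonneg (gagliardoIntegrand_self_nonneg v z)]; exact h3 z)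
  exact ⟨⟨h.1.mono hv (Eventually.of_forall fun x => by simpa using h1 x), h4⟩,
    integral_mono h4 h.2 h3⟩

theorem MemH.add {u v : Rn n → ℝ} (hu : MemH α u) (hv : MemH α v) : MemH α (u + v) := by
  refine ⟨hu.1.add hv.1, ((hu.2.add hv.2).add
    ((integrable_gagliardoIntegrand hu hv).const_mul 2)).congr (Eventually.of_forall fun z => ?_)⟩
  simp only [gagliardoIntegrand, Pi.add_apply]; ring

theorem MemH.smul {u : Rn n → ℝ} (c : ℝ) (hu : MemH α u) : MemH α (c • u) := by
  refine ⟨hu.1.const_smul c, (hu.2.const_mul (c ^ 2)).congr (Eventually.of_forall fun z => ?_)⟩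
  simp only [gagliardoIntegrand, Pi.smul_apply, smul_eq_mul]; ring

theorem MemH.zero : MemH α (0 : Rn n → ℝ) := by
  refine ⟨MemLp.zero, (integrable_zero _ _ _).congr (Eventually.of_forall fun z => ?_)⟩
  simp [gagliardoIntegrand]

theorem gagliardo_add_smul {u v : Rn n → ℝ} (hu : MemH α u) (hv : MemH α v) (c : ℝ) :
    gagliardo α (u + c • v) (u + c • v) =
      gagliardo α u u + 2 * c * gagliardo α u v + c ^ 2 * gagliardo α v v := by
  have hi := integrable_gagliardoIntegrand hu hv
  have hsum := integral_add (hu.2.add (hi.const_mul (2 * c))) (hv.2.const_mul (c ^ 2))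
  simp only [Pi.add_apply] at hsum
  rw [integral_add hu.2 (hi.const_mul (2 * c)), integral_const_mul, integral_const_mul] at hsum
  unfold gagliardo
  rw [← hsum]
  congr 1; ext z
  simp only [gagliardoIntegrand, Pi.add_apply, Pi.smul_apply, smul_eq_mul]; ring

/-- Translation invariance. -/
theorem MemH.comp_add_right {u : Rn n → ℝ} (hu : MemH α u) (y : Rn n) :
    MemH α (fun x => u (x + y)) ∧
      gagliardo α (fun x => u (x + y)) (fun x => u (x + y)) = gagliardo α u u := by
  have e : gagliardoIntegrand α (fun x => u (x + y)) (fun x => u (x + y)) =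
      fun z => gagliardoIntegrand α u u (z + (y, y)) := by
    ext z; simp [gagliardoIntegrand]
  have : (volume : Measure (Rn n × Rn n)).IsAddRightInvariant := by
    rw [Measure.volume_eq_prod]; infer_instance
  refine ⟨⟨?_, ?_⟩, ?_⟩
  · exact hu.1.comp_measurePreserving (measurePreserving_add_right volume y)
  · rw [e]; exact hu.2.comp_add_right (y, y)
  · unfold gagliardo
    rw [e]; exact integral_add_right_eq_self (gagliardoIntegrand α u u) (y, y)

/-! ### The Hardy inequality in general -/

theorem gammaH_pos (hα0 : 0 < α) (hαn : α < n) : 0 < gammaH n α := by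
  unfold gammaH
  have h1 : 0 < ((n : ℝ) - α) / 4 := by linarith
  have h2 : 0 < ((n : ℝ) + α) / 4 := by linarith
  positivity

theorem cConst_pos (hα0 : 0 < α) (hα2 : α < 2) : 0 < cConst n α := by
  unfold cConst
  have h1 : Real.Gamma (-α / 2) ≠ 0 := by
    refine Real.Gamma_ne_zero fun m hm => ?_
    have h2 : (m : ℝ) = α / 2 := by linarith
    rcases Nat.eq_zero_or_pos m with rfl | h
    · simp at h2; linarith
    · have : (1 : ℝ) ≤ m := by exact_mod_cast h
      linarith
  have h2 := abs_pos.2 h1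
  positivity

/-- The sharp fractional Hardy inequality for functions with bounded support. -/
theorem hardy (hα0 : 0 < α) (hα2 : α < 2) (hαn : α < n) {R : ℝ} {u : Rn n → ℝ} (hu : MemH α u)
    (hR : ∀ᵐ x, R < ‖x‖ → u x = 0) :
    Integrable (fun x => u x ^ 2 / ‖x‖ ^ α) ∧
      gammaH n α * ∫ x, u x ^ 2 / ‖x‖ ^ α ≤ cConst n α * gagliardo α u u := by
  obtain ⟨R', hR'0, hR'⟩ : ∃ R', 0 ≤ R' ∧ ∀ᵐ x, R' < ‖x‖ → u x = 0 :=
    ⟨max R 0, le_max_right _ _, hR.mono fun x hx h => hx ((le_max_left _ _).trans_lt h)⟩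
  set v : Rn n → ℝ := (Metric.closedBall (0 : Rn n) R').indicator (hu.1.1.mk u) with hv
  have huv : u =ᵐ[volume] v := by
    filter_upwards [hu.1.1.ae_eq_mk, hR'] with x h1 h2
    by_cases hx : ‖x‖ ≤ R'
    · rw [hv, indicator_of_mem (by simpa using hx), h1]
    · rw [hv, indicator_of_notMem (by simpa using hx), h2 (not_le.1 hx)]
  have hvm : Measurable v := hu.1.1.stronglyMeasurable_mk.measurable.indicator
    Metric.isClosed_closedBall.measurableSet
  have hvR : ∀ x, R' < ‖x‖ → v x = 0 := fun x hx =>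
    indicator_of_notMem (by simpa using hx) _
  have hvH : MemH α v := hu.congr huv
  -- Truncation does not increase `|u(x) - u(y)|`, hence not the Gagliardo form either. The bounded
  -- case applies to each truncation, and Fatou's lemma removes it.
  set w : ℕ → Rn n → ℝ := fun k x => min |v x| k with hw
  have hwm : ∀ k, Measurable (w k) := fun k => by
    have : Measurable fun x => |v x| := hvm.abs
    exact this.min measurable_const
  have hw0 : ∀ k x, 0 ≤ w k x := fun k x => le_min (abs_nonneg _) (Nat.cast_nonneg k)
  have hwH : ∀ k, MemH α (w k) ∧ gagliardo α (w k) (w k) ≤ gagliardo α v v := fun k =>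
    hvH.of_le (hwm k).aestronglyMeasurable
      (fun x => by rw [abs_of_nonneg (hw0 k x)]; exact min_le_left _ _)
      (fun x y => (abs_min_sub_min_le_max _ _ _ _).trans (by
        simp only [sub_self, abs_zero]
        exact max_le (abs_abs_sub_abs_le _ _) (abs_nonneg _)))
  have hγ := gammaH_pos hα0 hαn
  have hc := cConst_pos (n := n) hα0 hα2
  have hwk : ∀ k, Integrable (fun x => w k x ^ 2 / ‖x‖ ^ α) ∧
      gammaH n α * ∫ x, w k x ^ 2 / ‖x‖ ^ α ≤ cConst n α * gagliardo α (w k) (w k) := fun k =>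
    hardy_of_bounded (M := k) hα0 hα2 hαn hR'0 (hwm k)
      (fun x => by rw [abs_of_nonneg (hw0 k x)]; exact min_le_right _ _)
      (fun x hx => by simp [hw, hvR x hx]) (hwH k).1.2
  have hlim : ∀ x, Tendsto (fun k => w k x ^ 2 / ‖x‖ ^ α) atTop (𝓝 (v x ^ 2 / ‖x‖ ^ α)) := by
    intro x
    refine tendsto_const_nhds.congr' ?_
    obtain ⟨k₀, hk₀⟩ := exists_nat_ge |v x|
    filter_upwards [eventually_ge_atTop k₀] with k hk
    have : |v x| ≤ k := hk₀.trans (by exact_mod_cast hk)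
    simp only [hw]
    rw [min_eq_left this, sq_abs]
  obtain ⟨h1, h2⟩ := integral_le_of_tendsto (fun k => (hwk k).1)
    (fun k => Eventually.of_forall fun x => by simp only [Pi.zero_apply]; positivity)
    (Eventually.of_forall hlim)
    (C := cConst n α * gagliardo α v v / gammaH n α) (fun k => by
      rw [le_div_iff₀ hγ, mul_comm]
      exact (hwk k).2.trans (mul_le_mul_of_nonneg_left (hwH k).2 hc.le))
  have e : (fun x => v x ^ 2 / ‖x‖ ^ α) =ᵐ[volume] fun x => u x ^ 2 / ‖x‖ ^ α := by
    filter_upwards [huv] with x hx; rw [hx]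
  refine ⟨h1.congr e, ?_⟩
  rw [← integral_congr_ae e, gagliardo_congr huv huv]
  rwa [le_div_iff₀ hγ, mul_comm] at h2

/-- The Hardy inequality centred at an arbitrary point. -/
theorem hardy_at (hα0 : 0 < α) (hα2 : α < 2) (hαn : α < n) {R : ℝ} {u : Rn n → ℝ} (hu : MemH α u)
    (hR : ∀ᵐ x, R < ‖x‖ → u x = 0) (y : Rn n) :
    Integrable (fun x => u x ^ 2 / ‖x - y‖ ^ α) ∧
      gammaH n α * ∫ x, u x ^ 2 / ‖x - y‖ ^ α ≤ cConst n α * gagliardo α u u := by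
  obtain ⟨h1, h2⟩ := hu.comp_add_right y
  have hR' : ∀ᵐ x, R + ‖y‖ < ‖x‖ → u (x + y) = 0 := by
    filter_upwards [(measurePreserving_add_right volume y).quasiMeasurePreserving.ae hR] with x hx h
    refine hx ?_
    have := norm_sub_le (x + y) y
    rw [add_sub_cancel_right] at this
    linarith
  obtain ⟨h3, h4⟩ := hardy hα0 hα2 hαn h1 hR'
  have e : (fun x => u (x + y) ^ 2 / ‖x‖ ^ α) =
      fun x => (fun x => u x ^ 2 / ‖x - y‖ ^ α) (x + y) := by ext x; simp
  rw [h2, e, integral_add_right_eq_self (fun x => u x ^ 2 / ‖x - y‖ ^ α)] at h4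
  rw [e] at h3
  have h5 := h3.comp_add_right (-y)
  simp only [neg_add_cancel_right] at h5
  exact ⟨h5, h4⟩

end FracHardy

namespace FracHardy

variable {n : ℕ} {α : ℝ}

/-! ### Sobolev inequalities -/

theorem pos_of_lt_dim (hα0 : 0 < α) (hαn : α < n) : 0 < n := by
  rcases Nat.eq_zero_or_pos n with h | h
  · subst h; simp at hαn; linarith
  · exact h

/-- `∫ |u(x)-u(y)|² / |x-y|^(n+α) dy`. -/
noncomputable def gagliardoDensity (α : ℝ) (u : Rn n → ℝ) (x : Rn n) : ℝ :=
  ∫ y, gagliardoIntegrand α u u (x, y)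

theorem gagliardoDensity_nonneg (u : Rn n → ℝ) (x : Rn n) : 0 ≤ gagliardoDensity α u x :=
  integral_nonneg fun _ => gagliardoIntegrand_self_nonneg u _

theorem MemH.integrable_density {u : Rn n → ℝ} (hu : MemH α u) :
    Integrable (gagliardoDensity α u) ∧ ∫ x, gagliardoDensity α u x = gagliardo α u u ∧
      ∀ᵐ x, Integrable fun y => gagliardoIntegrand α u u (x, y) := by
  have h := hu.2
  rw [Measure.volume_eq_prod] at h
  refine ⟨h.integral_prod_left, ?_, h.prod_right_ae⟩
  rw [gagliardo, Measure.volume_eq_prod, integral_prod _ h]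
  rfl

theorem volume_real_ball (x : Rn n) {t : ℝ} (ht : 0 < t) :
    volume.real (Metric.ball x t) = t ^ (n : ℝ) * volume.real (Metric.ball (0 : Rn n) 1) := by
  rw [measureReal_def, Measure.addHaar_ball_of_pos _ _ ht, ENNReal.toReal_mul, measureReal_def,
    ENNReal.toReal_ofReal (by positivity), finrank_euclideanSpace_fin, Real.rpow_natCast]

theorem volume_real_ball_pos : 0 < volume.real (Metric.ball (0 : Rn n) 1) :=
  ENNReal.toReal_pos (Metric.measure_ball_pos _ _ one_pos).ne' measure_ball_lt_top.ne

theorem sq_sub_le_density {u : Rn n → ℝ} (hα0 : 0 < α) {x y : Rn n} {t : ℝ} (hxy : ‖x - y‖ < t) :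
    (u x - u y) ^ 2 ≤ t ^ ((n : ℝ) + α) * gagliardoIntegrand α u u (x, y) := by
  by_cases h : x - y = 0
  · rw [sub_eq_zero.1 h]; simp [gagliardoIntegrand]
  have h0 := norm_pos_iff.2 h
  have h1 : (‖x - y‖) ^ ((n : ℝ) + α) ≤ t ^ ((n : ℝ) + α) := by gcongr
  unfold gagliardoIntegrand
  rw [mul_div_assoc', le_div_iff₀ (by positivity)]
  simp only [← pow_two]
  rw [mul_comm]
  gcongr

/-- A pointwise bound by the density of the Gagliardo form. -/
theorem sq_le_density (hα0 : 0 < α) (hα2 : α < 2) (hαn : α < n) :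
    ∃ C > 0, ∀ (u : Rn n → ℝ) (R : ℝ), MemH α u → (∀ᵐ x, R < ‖x‖ → u x = 0) →
      gagliardo α u u ≤ 1 → ∀ᵐ x, ∀ t > 0,
        u x ^ 2 ≤ C * (t ^ α * gagliardoDensity α u x + t ^ (α - n)) := by
  have hn := pos_of_lt_dim hα0 hαn
  set κ : ℝ := volume.real (Metric.ball (0 : Rn n) 1) with hκ
  have hκ0 : 0 < κ := volume_real_ball_pos
  have hγ := gammaH_pos hα0 hαn
  have hc := cConst_pos (n := n) hα0 hα2
  set c : ℝ := max 1 (cConst n α / gammaH n α) with hcdef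
  have hc0 : 0 < c := by positivity
  refine ⟨2 * c / κ, by positivity, fun u R hu hR hE => ?_⟩
  filter_upwards [hu.integrable_density.2.2] with x hx t ht
  obtain ⟨hi, hv⟩ := hardy_at hα0 hα2 hαn hu hR x
  have hv' : ∫ y, u y ^ 2 / ‖y - x‖ ^ α ≤ c := by
    refine le_trans ?_ (le_max_right _ _)
    rw [le_div_iff₀ hγ, mul_comm]
    exact hv.trans (mul_le_of_le_one_right hc.le hE)
  have hrhs : Integrable fun y => 2 * t ^ ((n : ℝ) + α) * gagliardoIntegrand α u u (x, y) +
      2 * t ^ α * (u y ^ 2 / ‖y - x‖ ^ α) := (hx.const_mul _).add (hi.const_mul _)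
  have hne : ∀ᵐ y : Rn n, y ≠ x := by
    have : Nonempty (Fin n) := ⟨⟨0, hn⟩⟩
    simp [ae_iff]
  -- Average `u(x)² ≤ 2 (u(x)-u(y))² + 2 u(y)²` over the ball. The first term is controlled by the
  -- Gagliardo density at `x`, the second by Hardy's inequality centred at `x`.
  have h1 : ∫ y in Metric.ball x t, u x ^ 2 ≤ ∫ y in Metric.ball x t,
      (2 * t ^ ((n : ℝ) + α) * gagliardoIntegrand α u u (x, y) +
        2 * t ^ α * (u y ^ 2 / ‖y - x‖ ^ α)) := by
    refine setIntegral_mono_ae_restrict (integrableOn_const measure_ball_lt_top.ne)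
      hrhs.integrableOn ?_
    refine (ae_restrict_iff' Metric.isOpen_ball.measurableSet).2 ?_
    filter_upwards [hne] with y hy hyt
    have hyt' : ‖y - x‖ < t := by simpa [dist_eq_norm] using hyt
    have h2 := sq_sub_le_density (u := u) hα0 (by rwa [norm_sub_rev] at hyt' : ‖x - y‖ < t)
    have h3 : u y ^ 2 ≤ t ^ α * (u y ^ 2 / ‖y - x‖ ^ α) := by
      have h0 : 0 < ‖y - x‖ := norm_pos_iff.2 (sub_ne_zero.2 hy)
      rw [mul_div_assoc', le_div_iff₀ (by positivity), mul_comm]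
      gcongr
    nlinarith [sq_nonneg (u x - 2 * u y)]
  have h4 : ∫ y in Metric.ball x t, (2 * t ^ ((n : ℝ) + α) * gagliardoIntegrand α u u (x, y) +
      2 * t ^ α * (u y ^ 2 / ‖y - x‖ ^ α)) ≤ 2 * t ^ ((n : ℝ) + α) * gagliardoDensity α u x +
        2 * t ^ α * c := by
    refine (setIntegral_le_integral hrhs (Eventually.of_forall fun y => ?_)).trans ?_
    · have := gagliardoIntegrand_self_nonneg (α := α) u (x, y)
      simp only [Pi.zero_apply]; positivity
    · rw [integral_add (hx.const_mul _) (hi.const_mul _), integral_const_mul, integral_const_mul]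
      gcongr
      exact le_rfl
  rw [setIntegral_const, smul_eq_mul, volume_real_ball x ht, ← hκ] at h1
  have h5 := h1.trans h4
  have htn : 0 < t ^ (n : ℝ) := by positivity
  have hD := gagliardoDensity_nonneg (α := α) u x
  have e1 : t ^ ((n : ℝ) + α) = t ^ (n : ℝ) * t ^ α := Real.rpow_add ht _ _
  have e2 : t ^ α = t ^ (n : ℝ) * t ^ (α - n) := by
    rw [← Real.rpow_add ht]; congr 1; ring
  have h6 : t ^ (n : ℝ) * (κ * u x ^ 2) ≤
      t ^ (n : ℝ) * (2 * c * (t ^ α * gagliardoDensity α u x + t ^ (α - n))) := by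
    calc t ^ (n : ℝ) * (κ * u x ^ 2) = t ^ (n : ℝ) * κ * u x ^ 2 := by ring
      _ ≤ 2 * t ^ ((n : ℝ) + α) * gagliardoDensity α u x + 2 * t ^ α * c := h5
      _ = t ^ (n : ℝ) * (2 * (1 * (t ^ α * gagliardoDensity α u x)) + 2 * c * t ^ (α - n)) := by
          rw [e1]; nth_rewrite 2 [e2]; ring
      _ ≤ t ^ (n : ℝ) * (2 * (c * (t ^ α * gagliardoDensity α u x)) + 2 * c * t ^ (α - n)) := by
          gcongr; exact le_max_left _ _
      _ = _ := by ring
  have h7 := le_of_mul_le_mul_left h6 htn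
  rw [div_mul_eq_mul_div, le_div_iff₀ hκ0]
  linarith

/-- The critical Sobolev inequality. -/
theorem sobolev (hα0 : 0 < α) (hα2 : α < 2) (hαn : α < n) :
    ∃ C > 0, ∀ (u : Rn n → ℝ) (R : ℝ), MemH α u → (∀ᵐ x, R < ‖x‖ → u x = 0) →
      gagliardo α u u ≤ 1 → Integrable (fun x => |u x| ^ (2 * n / (n - α))) ∧
        ∫ x, |u x| ^ (2 * n / (n - α)) ≤ C := by
  obtain ⟨C, hC0, hC⟩ := sq_le_density hα0 hα2 hαn
  have hn := pos_of_lt_dim hα0 hαn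
  have hn' : (0 : ℝ) < n := by exact_mod_cast hn
  have hnα : 0 < (n : ℝ) - α := by linarith
  set K : ℝ := (2 * C) ^ ((n : ℝ) / (n - α)) with hK
  refine ⟨K, by positivity, fun u R hu hR hE => ?_⟩
  obtain ⟨hDi, hDv, -⟩ := hu.integrable_density
  have key : ∀ᵐ x, |u x| ^ (2 * n / (n - α)) ≤ K * gagliardoDensity α u x := by
    filter_upwards [hC u R hu hR hE] with x hx
    have hD := gagliardoDensity_nonneg (α := α) u x
    rcases hD.eq_or_lt with hD0 | hD0
    · have h1 : u x ^ 2 ≤ 0 := by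
        have hlim : Tendsto (fun t : ℝ => C * t ^ (α - n)) atTop (𝓝 0) := by
          have := (tendsto_rpow_neg_atTop hnα).const_mul C
          rwa [mul_zero, neg_sub] at this
        refine ge_of_tendsto hlim ?_
        filter_upwards [eventually_gt_atTop 0] with t ht
        have := hx t ht
        rwa [← hD0, mul_zero, zero_add] at this
      have h2 : u x = 0 := pow_eq_zero_iff two_ne_zero |>.1 (le_antisymm h1 (sq_nonneg _))
      rw [h2, abs_zero, Real.zero_rpow (by positivity), ← hD0, mul_zero]
    · set D := gagliardoDensity α u x with hDdef
      -- This radius balances the two terms of the pointwise bound: both become `D ^ ((n - α) / n)`,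
      -- and raising to the power `n / (n - α)` leaves `D`, which is integrable.
      have h1 := hx (D ^ (-(1 / (n : ℝ)))) (by positivity)
      have e1 : (D ^ (-(1 / (n : ℝ)))) ^ α * D = D ^ (((n : ℝ) - α) / n) := by
        rw [← Real.rpow_mul hD0.le, ← Real.rpow_add_one hD0.ne']; congr 1; field_simp; ring
      have e2 : (D ^ (-(1 / (n : ℝ)))) ^ (α - n) = D ^ (((n : ℝ) - α) / n) := by
        rw [← Real.rpow_mul hD0.le]; congr 1; field_simp; ring
      rw [e1, e2] at h1
      have h2 : |u x| ^ (2 * n / (n - α)) = (u x ^ 2) ^ ((n : ℝ) / (n - α)) := by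
        rw [← sq_abs, ← Real.rpow_natCast, ← Real.rpow_mul (abs_nonneg _)]
        congr 1; push_cast; ring
      rw [h2]
      calc (u x ^ 2) ^ ((n : ℝ) / (n - α))
          ≤ (2 * C * D ^ (((n : ℝ) - α) / n)) ^ ((n : ℝ) / (n - α)) := by
            gcongr; linarith
        _ = K * D := by
            rw [Real.mul_rpow (by positivity) (by positivity), ← Real.rpow_mul hD0.le,
              show ((n : ℝ) - α) / n * (n / (n - α)) = 1 by field_simp, Real.rpow_one]
  have hm : AEStronglyMeasurable (fun x => |u x| ^ (2 * n / (n - α))) volume :=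
    (hu.1.1.norm.aemeasurable.pow_const _).aestronglyMeasurable
  have hi : Integrable fun x => |u x| ^ (2 * n / (n - α)) := by
    refine (hDi.const_mul K).mono' hm ?_
    filter_upwards [key] with x hx
    rwa [Real.norm_of_nonneg (by positivity)]
  refine ⟨hi, ?_⟩
  calc ∫ x, |u x| ^ (2 * n / (n - α)) ≤ ∫ x, K * gagliardoDensity α u x :=
        integral_mono_ae hi (hDi.const_mul K) key
    _ = K * gagliardo α u u := by rw [integral_const_mul, hDv]
    _ ≤ K := mul_le_of_le_one_right (by positivity) hE

/-- The critical Hardy-Sobolev inequality. -/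
theorem hardy_sobolev {s : ℝ} (hα0 : 0 < α) (hα2 : α < 2) (hαn : α < n) (hs0 : 0 ≤ s)
    (hsα : s < α) :
    ∃ C > 0, ∀ (u : Rn n → ℝ) (R : ℝ), MemH α u → (∀ᵐ x, R < ‖x‖ → u x = 0) →
      gagliardo α u u ≤ 1 → Integrable (fun x => |u x| ^ critExp n α s / ‖x‖ ^ s) ∧
        ∫ x, |u x| ^ critExp n α s / ‖x‖ ^ s ≤ C := by
  obtain ⟨C, hC0, hC⟩ := sobolev hα0 hα2 hαn
  have hγ := gammaH_pos hα0 hαn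
  have hc := cConst_pos (n := n) hα0 hα2
  have hn := pos_of_lt_dim hα0 hαn
  refine ⟨cConst n α / gammaH n α + C, by positivity, fun u R hu hR hE => ?_⟩
  obtain ⟨h1, h2⟩ := hardy hα0 hα2 hαn hu hR
  obtain ⟨h3, h4⟩ := hC u R hu hR hE
  have hnα : 0 < (n : ℝ) - α := by linarith
  have key : ∀ᵐ x, |u x| ^ critExp n α s / ‖x‖ ^ s ≤
      u x ^ 2 / ‖x‖ ^ α + |u x| ^ (2 * n / (n - α)) := by
    filter_upwards [ae_ne_zero hn] with x hx
    have hx' := norm_pos_iff.2 hx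
    by_cases hu0 : u x = 0
    · have : critExp n α s ≠ 0 := by
        unfold critExp
        have : 0 < (n : ℝ) - s := by linarith
        positivity
      rw [hu0, abs_zero, Real.zero_rpow this, zero_div]; positivity
    have hu' := abs_pos.2 hu0
    set A : ℝ := u x ^ 2 / ‖x‖ ^ α with hA
    set B : ℝ := |u x| ^ (2 * n / (n - α)) with hB
    have hA0 : 0 ≤ A := by positivity
    have hB0 : 0 ≤ B := by positivity
    have hw1 : 0 ≤ s / α := by positivity
    have hw2 : s / α ≤ 1 := by rw [div_le_one hα0]; exact hsα.le
    -- The integrand interpolates between the Hardy and the Sobolev integrand with weights `s/α` and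
    -- `1 - s/α`; the powers of `|u|` add up to `critExp n α s`.
    have hY := Real.geom_mean_le_arith_mean2_weighted hw1 (by linarith : 0 ≤ 1 - s / α) hA0 hB0
      (by ring)
    have e : |u x| ^ critExp n α s / ‖x‖ ^ s = A ^ (s / α) * B ^ (1 - s / α) := by
      rw [hA, hB, Real.div_rpow (by positivity) (by positivity), ← sq_abs, ← Real.rpow_natCast,
        ← Real.rpow_mul hu'.le, ← Real.rpow_mul hu'.le, ← Real.rpow_mul hx'.le,
        mul_div_cancel₀ _ hα0.ne', div_mul_eq_mul_div, ← Real.rpow_add hu']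
      congr 2
      unfold critExp
      push_cast
      field_simp
      ring
    rw [e]
    nlinarith [mul_nonneg (by linarith : 0 ≤ 1 - s / α) hA0, mul_nonneg hw1 hB0]
  have hm : AEStronglyMeasurable (fun x => |u x| ^ critExp n α s / ‖x‖ ^ s) volume :=
    (hu.1.1.norm.aemeasurable.pow_const _).aestronglyMeasurable.div₀
      (by fun_prop : Measurable fun x : Rn n => ‖x‖ ^ s).aestronglyMeasurable
  have hi : Integrable (fun x => |u x| ^ critExp n α s / ‖x‖ ^ s) := by
    refine (h1.add h3).mono' hm ?_
    filter_upwards [key] with x hx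
    rwa [Real.norm_of_nonneg (by positivity)]
  refine ⟨hi, ?_⟩
  calc _ ≤ ∫ x, (u x ^ 2 / ‖x‖ ^ α + |u x| ^ (2 * n / (n - α))) :=
        integral_mono_ae hi (h1.add h3) key
    _ = (∫ x, u x ^ 2 / ‖x‖ ^ α) + ∫ x, |u x| ^ (2 * n / (n - α)) := integral_add h1 h3
    _ ≤ _ := by
      refine add_le_add ?_ h4
      rw [le_div_iff₀ hγ, mul_comm]
      exact h2.trans (mul_le_of_le_one_right hc.le hE)

/-- Elements of `X₀` vanish a.e. outside a ball. -/
theorem X0.exists_radius {Ω : Set (Rn n)} (hΩo : IsOpen Ω) (hΩb : Bornology.IsBounded Ω) :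
    ∃ R, 0 ≤ R ∧ Ω ⊆ Metric.closedBall 0 R ∧ ∀ u ∈ X0 α Ω, ∀ᵐ x, R < ‖x‖ → u x = 0 := by
  obtain ⟨R, hR⟩ := hΩb.subset_closedBall 0
  have hR' : Ω ⊆ Metric.closedBall 0 (max R 0) :=
    hR.trans (Metric.closedBall_subset_closedBall (le_max_left _ _))
  refine ⟨max R 0, le_max_right _ _, hR', fun u hu => ?_⟩
  filter_upwards [(ae_restrict_iff' hΩo.measurableSet.compl).1 hu.2] with x hx h
  refine hx fun hxΩ => ?_
  have := hR' hxΩ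
  rw [mem_closedBall_zero_iff] at this
  linarith

theorem X0.smul_mem {Ω : Set (Rn n)} {u : Rn n → ℝ} (c : ℝ) (hu : u ∈ X0 α Ω) :
    c • u ∈ X0 α Ω :=
  ⟨hu.1.smul c, by filter_upwards [hu.2] with x hx; simp [hx]⟩

theorem X0.add_mem {Ω : Set (Rn n)} {u v : Rn n → ℝ} (hu : u ∈ X0 α Ω) (hv : v ∈ X0 α Ω) :
    u + v ∈ X0 α Ω :=
  ⟨hu.1.add hv.1, by filter_upwards [hu.2, hv.2] with x hx hx'; simp [hx, hx']⟩

theorem gagliardo_smul (c : ℝ) (u : Rn n → ℝ) :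
    gagliardo α (c • u) (c • u) = c ^ 2 * gagliardo α u u := by
  unfold gagliardo
  rw [← integral_const_mul]
  congr 1; ext z
  simp only [gagliardoIntegrand, Pi.smul_apply, smul_eq_mul]; ring

/-- Weighted embeddings up to the critical exponent. -/
theorem embedding {s r : ℝ} (hα0 : 0 < α) (hα2 : α < 2) (hαn : α < n) (hs0 : 0 ≤ s)
    (hsα : s < α) (hr0 : 0 < r) (hr : r ≤ critExp n α s) {Ω : Set (Rn n)} (hΩo : IsOpen Ω)
    (hΩb : Bornology.IsBounded Ω) :
    ∃ C > 0, ∀ u ∈ X0 α Ω, IntegrableOn (fun x => |u x| ^ r / ‖x‖ ^ s) Ω ∧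
      ∫ x in Ω, |u x| ^ r / ‖x‖ ^ s ≤ C * gagliardo α u u ^ (r / 2) := by
  obtain ⟨R, hR0, hΩR, hR⟩ := X0.exists_radius (α := α) hΩo hΩb
  obtain ⟨C, hC0, hC⟩ := hardy_sobolev hα0 hα2 hαn hs0 hsα
  have hn := pos_of_lt_dim hα0 hαn
  have hw : IntegrableOn (fun x : Rn n => (‖x‖ ^ s)⁻¹) Ω :=
    (integrableOn_norm_rpow hn (hsα.trans hαn) R).mono_set hΩR
  set W : ℝ := ∫ x in Ω, (‖x‖ ^ s)⁻¹ with hW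
  have hW0 : 0 ≤ W := integral_nonneg fun x => by positivity
  have hunit : ∀ u ∈ X0 α Ω, gagliardo α u u ≤ 1 →
      IntegrableOn (fun x => |u x| ^ r / ‖x‖ ^ s) Ω ∧
        ∫ x in Ω, |u x| ^ r / ‖x‖ ^ s ≤ W + C := by
    intro u hu hE
    obtain ⟨h1, h2⟩ := hC u R hu.1 (hR u hu) hE
    have key : ∀ x, |u x| ^ r / ‖x‖ ^ s ≤ (‖x‖ ^ s)⁻¹ + |u x| ^ critExp n α s / ‖x‖ ^ s := by
      intro x
      rw [inv_eq_one_div, ← add_div]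
      gcongr
      rcases le_total |u x| 1 with h | h
      · have := Real.rpow_le_one (abs_nonneg (u x)) h hr0.le
        have : 0 ≤ |u x| ^ critExp n α s := by positivity
        linarith
      · have := Real.rpow_le_rpow_of_exponent_le h hr
        linarith
    have hm : AEStronglyMeasurable (fun x => |u x| ^ r / ‖x‖ ^ s) (volume.restrict Ω) :=
      ((hu.1.1.1.norm.aemeasurable.pow_const _).aestronglyMeasurable.div₀
        (by fun_prop : Measurable fun x : Rn n => ‖x‖ ^ s).aestronglyMeasurable).restrict
    have hi : IntegrableOn (fun x => |u x| ^ r / ‖x‖ ^ s) Ω :=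
      (hw.add h1.integrableOn).mono' hm (Eventually.of_forall fun x => by
        rw [Real.norm_of_nonneg (by positivity)]; exact key x)
    refine ⟨hi, ?_⟩
    calc _ ≤ ∫ x in Ω, ((‖x‖ ^ s)⁻¹ + |u x| ^ critExp n α s / ‖x‖ ^ s) :=
          integral_mono hi (hw.add h1.integrableOn) key
      _ = W + ∫ x in Ω, |u x| ^ critExp n α s / ‖x‖ ^ s := integral_add hw h1.integrableOn
      _ ≤ W + C := by
          refine add_le_add le_rfl ((setIntegral_le_integral h1 ?_).trans h2)
          exact Eventually.of_forall fun x => by simp only [Pi.zero_apply]; positivity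
  -- Scaling by `M ^ (-1/2)` with a positive upper bound `M`, rather than by the form itself, also
  -- covers functions whose form is zero; `M` decreases to the form at the end.
  have hscale : ∀ u ∈ X0 α Ω, ∀ M > 0, gagliardo α u u ≤ M →
      IntegrableOn (fun x => |u x| ^ r / ‖x‖ ^ s) Ω ∧
        ∫ x in Ω, |u x| ^ r / ‖x‖ ^ s ≤ (W + C) * M ^ (r / 2) := by
    intro u hu M hM hE
    set c : ℝ := M ^ (-(1 / 2) : ℝ) with hc
    have hc0 : 0 < c := by positivity
    have hc2 : c ^ 2 = M⁻¹ := by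
      rw [hc, ← Real.rpow_natCast, ← Real.rpow_mul hM.le]
      norm_num
      exact Real.rpow_neg_one M
    obtain ⟨h1, h2⟩ := hunit (c • u) (X0.smul_mem c hu) (by
      rw [gagliardo_smul, hc2, inv_mul_le_one₀ hM]; exact hE)
    have e : ∀ x, |(c • u) x| ^ r / ‖x‖ ^ s = c ^ r * (|u x| ^ r / ‖x‖ ^ s) := by
      intro x
      rw [Pi.smul_apply, smul_eq_mul, abs_mul, abs_of_pos hc0, Real.mul_rpow hc0.le (abs_nonneg _)]
      ring
    have hcr : c ^ r = (M ^ (r / 2))⁻¹ := by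
      rw [hc, ← Real.rpow_mul hM.le, ← Real.rpow_neg hM.le]; congr 1; ring
    simp only [e] at h1 h2
    rw [integral_const_mul, hcr, inv_mul_le_iff₀ (by positivity)] at h2
    refine ⟨?_, by linarith⟩
    refine (h1.const_mul (c ^ r)⁻¹).congr (Eventually.of_forall fun x => ?_)
    simp only
    rw [inv_mul_cancel_left₀ (by positivity)]
  refine ⟨W + C, by positivity, fun u hu => ?_⟩
  have hE := gagliardo_self_nonneg (α := α) u
  refine ⟨(hscale u hu (gagliardo α u u + 1) (by positivity) (by linarith)).1, ?_⟩
  have hlim : Tendsto (fun M : ℝ => (W + C) * M ^ (r / 2)) (𝓝[>] gagliardo α u u)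
      (𝓝 ((W + C) * gagliardo α u u ^ (r / 2))) :=
    ((Real.continuousAt_rpow_const _ _ (Or.inr (by positivity))).const_mul _).tendsto.mono_left
      nhdsWithin_le_nhds
  refine ge_of_tendsto hlim ?_
  filter_upwards [self_mem_nhdsWithin] with M hM
  have hM : gagliardo α u u < M := hM
  exact (hscale u hu M (hE.trans_lt hM) hM.le).2

end FracHardy

namespace FracHardy

/-! ### Convergence lemmas -/

/-- A sequence bounded in `L²` and converging to `0` a.e. converges weakly to `0`. -/
theorem tendsto_integral_mul_of_bounded {X : Type*} [MeasurableSpace X] {μ : Measure X}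
    {φ : X → ℝ} {d : ℕ → X → ℝ} {C : ℝ} (hφm : AEStronglyMeasurable φ μ)
    (hφ : Integrable (fun x => φ x ^ 2) μ) (hdm : ∀ k, AEStronglyMeasurable (d k) μ)
    (hd : ∀ k, Integrable (fun x => d k x ^ 2) μ) (hC : ∀ k, ∫ x, d k x ^ 2 ∂μ ≤ C)
    (hlim : ∀ᵐ x ∂μ, Tendsto (fun k => d k x) atTop (𝓝 0)) :
    Tendsto (fun k => ∫ x, φ x * d k x ∂μ) atTop (𝓝 0) := by
  have hC0 : 0 ≤ C := (integral_nonneg fun x => sq_nonneg _).trans (hC 0)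
  have hmin : ∀ T : ℝ, 0 < T → Tendsto (fun k => ∫ x, min |φ x * d k x| (T * φ x ^ 2) ∂μ) atTop
      (𝓝 0) := by
    intro T hT
    have h0 : (0 : ℝ) = ∫ _, (0 : ℝ) ∂μ := by simp
    rw [h0]
    refine tendsto_integral_of_dominated_convergence (fun x => T * φ x ^ 2)
      (fun k => ?_) (hφ.const_mul T) (fun k => Eventually.of_forall fun x => ?_) ?_
    · exact (hφm.mul (hdm k)).norm.inf (hφ.const_mul T).aestronglyMeasurable
    · rw [Real.norm_of_nonneg (le_min (abs_nonneg _) (by positivity))]; exact min_le_right _ _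
    · filter_upwards [hlim] with x hx
      have h1 : Tendsto (fun k => |φ x * d k x|) atTop (𝓝 0) := by
        simpa using (hx.const_mul (φ x)).abs
      exact squeeze_zero (fun k => le_min (abs_nonneg _) (by positivity))
        (fun k => min_le_left _ _) h1
  rw [Metric.tendsto_atTop']
  intro ε hε
  obtain ⟨T, hT, hT0⟩ : ∃ T : ℝ, C / T < ε / 2 ∧ 0 < T := by
    refine ⟨2 * (C + 1) / ε, ?_, by positivity⟩
    rw [div_div_eq_mul_div, div_lt_iff₀ (by positivity)]
    nlinarith
  obtain ⟨N, hN⟩ := eventually_atTop.1 ((hmin T hT0).eventually (gt_mem_nhds (half_pos hε)))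
  refine ⟨N, fun k hk => ?_⟩
  rw [dist_zero_right]
  -- Where `|d| ≤ T |φ|` the product is at most `T φ²`, which allows dominated convergence;
  -- elsewhere it is at most `d² / T`, uniformly small in the mean for large `T`.
  have hpt : ∀ x, ‖φ x * d k x‖ ≤ min |φ x * d k x| (T * φ x ^ 2) + T⁻¹ * d k x ^ 2 := by
    intro x
    rw [Real.norm_eq_abs]
    rcases le_total |φ x * d k x| (T * φ x ^ 2) with h | h
    · rw [min_eq_left h]; have : 0 ≤ T⁻¹ * d k x ^ 2 := by positivity
      linarith
    · rw [min_eq_right h]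
      have h1 : T * |φ x| ≤ |d k x| ∨ φ x = 0 := by
        by_cases h0 : φ x = 0
        · exact Or.inr h0
        · left
          have h2 : 0 < |φ x| := abs_pos.2 h0
          rw [abs_mul, ← sq_abs (φ x)] at h
          have : |φ x| * (T * |φ x|) ≤ |φ x| * |d k x| := by nlinarith
          exact le_of_mul_le_mul_left this h2
      have h3 : |φ x * d k x| ≤ T⁻¹ * d k x ^ 2 := by
        rcases h1 with h1 | h1
        · rw [abs_mul, ← sq_abs (d k x), inv_mul_eq_div, le_div_iff₀ hT0]
          nlinarith [abs_nonneg (d k x)]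
        · rw [h1]; simp; positivity
      have : 0 ≤ T * φ x ^ 2 := by positivity
      linarith
  have hmi : Integrable (fun x => min |φ x * d k x| (T * φ x ^ 2)) μ :=
    (hφ.const_mul T).mono' ((hφm.mul (hdm k)).norm.inf (hφ.const_mul T).aestronglyMeasurable)
      (Eventually.of_forall fun x => by
        rw [Real.norm_of_nonneg (le_min (abs_nonneg _) (by positivity))]; exact min_le_right _ _)
  calc ‖∫ x, φ x * d k x ∂μ‖ ≤ ∫ x, (min |φ x * d k x| (T * φ x ^ 2) + T⁻¹ * d k x ^ 2) ∂μ :=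
        norm_integral_le_of_norm_le (hmi.add ((hd k).const_mul _)) (Eventually.of_forall hpt)
    _ = (∫ x, min |φ x * d k x| (T * φ x ^ 2) ∂μ) + T⁻¹ * ∫ x, d k x ^ 2 ∂μ := by
        rw [integral_add hmi ((hd k).const_mul _), integral_const_mul]
    _ < ε / 2 + ε / 2 := by
        refine add_lt_add (hN k hk.le) (lt_of_le_of_lt ?_ hT)
        rw [inv_mul_eq_div]; gcongr; exact hC k
    _ = ε := by ring

/-- Convergence of the integrals of lower powers under an a.e. limit. -/
theorem tendsto_integral_rpow_of_bounded {X : Type*} [MeasurableSpace X] {μ : Measure X}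
    {W : X → ℝ} {u : ℕ → X → ℝ} {w : X → ℝ} {r m C : ℝ} (hr : 0 < r) (hrm : r < m)
    (hW : Integrable W μ) (hum : ∀ k, AEStronglyMeasurable (u k) μ)
    (hu : ∀ k, Integrable (fun x => |W x| * |u k x| ^ m) μ)
    (hC : ∀ k, ∫ x, |W x| * |u k x| ^ m ∂μ ≤ C)
    (hlim : ∀ᵐ x ∂μ, Tendsto (fun k => u k x) atTop (𝓝 (w x))) :
    Tendsto (fun k => ∫ x, W x * |u k x| ^ r ∂μ) atTop (𝓝 (∫ x, W x * |w x| ^ r ∂μ)) := by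
  have hm : 0 < m := hr.trans hrm
  have hwm : AEStronglyMeasurable w μ := aestronglyMeasurable_of_tendsto_ae atTop hum hlim
  have hrp : ∀ e : ℝ, 0 < e → ∀ᵐ x ∂μ, Tendsto (fun k => |u k x| ^ e) atTop (𝓝 (|w x| ^ e)) := by
    intro e he
    filter_upwards [hlim] with x hx
    exact hx.abs.rpow_const (Or.inr he.le)
  obtain ⟨hw, hwC⟩ := integral_le_of_tendsto hu
    (fun k => Eventually.of_forall fun x => by simp only [Pi.zero_apply]; positivity)
    (g := fun x => |W x| * |w x| ^ m) (by
      filter_upwards [hrp m hm] with x hx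
      exact hx.const_mul _) hC
  have hpm : ∀ {v : X → ℝ} (e : ℝ), AEStronglyMeasurable v μ →
      AEStronglyMeasurable (fun x => |v x| ^ e) μ := fun e hv =>
    (hv.norm.aemeasurable.pow_const e).aestronglyMeasurable
  have hri : ∀ {v : X → ℝ}, AEStronglyMeasurable v μ → Integrable (fun x => |W x| * |v x| ^ m) μ →
      Integrable (fun x => W x * |v x| ^ r) μ := by
    intro v hv hvi
    refine (hW.abs.add hvi).mono' (hW.aestronglyMeasurable.mul (hpm r hv))
      (Eventually.of_forall fun x => ?_)
    rw [norm_mul, Real.norm_eq_abs, Real.norm_of_nonneg (by positivity : 0 ≤ |v x| ^ r)]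
    have : |v x| ^ r ≤ 1 + |v x| ^ m := by
      rcases le_total |v x| 1 with h | h
      · have := Real.rpow_le_one (abs_nonneg (v x)) h hr.le
        have : 0 ≤ |v x| ^ m := by positivity
        linarith
      · have := Real.rpow_le_rpow_of_exponent_le h hrm.le
        linarith
    have h2 := mul_le_mul_of_nonneg_left this (abs_nonneg (W x))
    simp only [Pi.add_apply]
    linarith
  have hC0 : 0 ≤ C := (integral_nonneg fun x => by positivity).trans (hC 0)
  set d : ℕ → X → ℝ := fun k x => |u k x| ^ r - |w x| ^ r with hd
  have hdm : ∀ k, AEStronglyMeasurable (d k) μ := fun k => (hpm r (hum k)).sub (hpm r hwm)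
  have hmm : ∀ (T : ℝ) k, AEStronglyMeasurable (fun x => |W x| * min |d k x| (T ^ r)) μ :=
    fun T k => hW.aestronglyMeasurable.norm.mul ((hdm k).norm.inf aestronglyMeasurable_const)
  have hmle : ∀ T : ℝ, 0 < T → ∀ k x, ‖|W x| * min |d k x| (T ^ r)‖ ≤ |W x| * T ^ r := by
    intro T hT k x
    have : 0 ≤ min |d k x| (T ^ r) := le_min (abs_nonneg _) (by positivity)
    rw [Real.norm_of_nonneg (by positivity)]
    gcongr; exact min_le_right _ _
  have hmin : ∀ T : ℝ, 0 < T → Tendsto (fun k => ∫ x, |W x| * min |d k x| (T ^ r) ∂μ) atTop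
      (𝓝 0) := by
    intro T hT
    have h0 : (0 : ℝ) = ∫ _, (0 : ℝ) ∂μ := by simp
    rw [h0]
    refine tendsto_integral_of_dominated_convergence (fun x => |W x| * T ^ r)
      (hmm T) (hW.abs.mul_const _) (fun k => Eventually.of_forall (hmle T hT k)) ?_
    filter_upwards [hrp r hr] with x hx
    have h1 : Tendsto (fun k => |d k x|) atTop (𝓝 0) := by
      simpa using (hx.sub_const (|w x| ^ r)).abs
    have h2 : Tendsto (fun k => |W x| * |d k x|) atTop (𝓝 0) := by
      simpa using h1.const_mul |W x|
    refine squeeze_zero (fun k => mul_nonneg (abs_nonneg _)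
      (le_min (abs_nonneg _) (by positivity))) (fun k => ?_) h2
    gcongr; exact min_le_left _ _
  rw [tendsto_iff_norm_sub_tendsto_zero, Metric.tendsto_atTop']
  intro ε hε
  obtain ⟨T, hT, hT0⟩ : ∃ T : ℝ, T ^ (r - m) * (2 * C) < ε / 2 ∧ 0 < T := by
    have h1 : Tendsto (fun T : ℝ => T ^ (r - m) * (2 * C)) atTop (𝓝 0) := by
      have := (tendsto_rpow_neg_atTop (sub_pos.2 hrm)).mul_const (2 * C)
      rwa [zero_mul, neg_sub] at this
    exact ((h1.eventually (gt_mem_nhds (half_pos hε))).and (eventually_gt_atTop 0)).exists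
  obtain ⟨N, hN⟩ := eventually_atTop.1 ((hmin T hT0).eventually (gt_mem_nhds (half_pos hε)))
  refine ⟨N, fun k hk => ?_⟩
  rw [dist_zero_right, norm_norm, ← integral_sub (hri (hum k) (hu k)) (hri hwm hw)]
  have hpow : ∀ y : ℝ, 0 ≤ y → T < y → y ^ r ≤ T ^ (r - m) * y ^ m := by
    intro y hy hyT
    have hy0 : 0 < y := hT0.trans hyT
    calc y ^ r = y ^ (r - m) * y ^ m := by rw [← Real.rpow_add hy0]; congr 1; ring
      _ ≤ T ^ (r - m) * y ^ m := by
        gcongr ?_ * _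
        exact Real.rpow_le_rpow_of_nonpos hT0 hyT.le (by linarith)
  -- The difference truncated at `T ^ r` is handled by dominated convergence. The excess comes from
  -- values above `T`, where `y ^ r ≤ T ^ (r - m) * y ^ m`; since `r < m` it is small uniformly in
  -- `k`.
  have hpt : ∀ x, ‖W x * |u k x| ^ r - W x * |w x| ^ r‖ ≤ |W x| * min |d k x| (T ^ r) +
      T ^ (r - m) * (|W x| * |u k x| ^ m + |W x| * |w x| ^ m) := by
    intro x
    rw [← mul_sub, norm_mul, Real.norm_eq_abs, Real.norm_eq_abs]
    have key : |d k x| ≤ min |d k x| (T ^ r) + T ^ (r - m) * (|u k x| ^ m + |w x| ^ m) := by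
      rcases le_total |d k x| (T ^ r) with h | h
      · rw [min_eq_left h]
        have : 0 ≤ T ^ (r - m) * (|u k x| ^ m + |w x| ^ m) := by positivity
        linarith
      · rw [min_eq_right h]
        have hTr : 0 < T ^ r := by positivity
        have ha : 0 ≤ |u k x| ^ r := by positivity
        have hb : 0 ≤ |w x| ^ r := by positivity
        have ha' : 0 ≤ T ^ (r - m) * |u k x| ^ m := by positivity
        have hb' : 0 ≤ T ^ (r - m) * |w x| ^ m := by positivity
        have aux : ∀ y : ℝ, 0 ≤ y → y ^ r ≤ T ^ r + T ^ (r - m) * y ^ m := by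
          intro y hy
          rcases le_or_gt y T with h' | h'
          · have := Real.rpow_le_rpow hy h' hr.le
            have : 0 ≤ T ^ (r - m) * y ^ m := by positivity
            linarith
          · have := hpow y hy h'
            linarith
        have h1 := aux _ (abs_nonneg (u k x))
        have h2 := aux _ (abs_nonneg (w x))
        simp only [hd] at h ⊢
        rw [abs_le]
        constructor <;> linarith
    have := mul_le_mul_of_nonneg_left key (abs_nonneg (W x))
    simp only [hd] at this ⊢
    linarith
  have hmi : Integrable (fun x => |W x| * min |d k x| (T ^ r)) μ :=
    (hW.abs.mul_const (T ^ r)).mono' (hmm T k) (Eventually.of_forall (hmle T hT0 k))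
  have hs : Integrable (fun x => T ^ (r - m) * (|W x| * |u k x| ^ m + |W x| * |w x| ^ m)) μ :=
    ((hu k).add hw).const_mul _
  calc _ ≤ ∫ x, (|W x| * min |d k x| (T ^ r) +
        T ^ (r - m) * (|W x| * |u k x| ^ m + |W x| * |w x| ^ m)) ∂μ :=
        norm_integral_le_of_norm_le (hmi.add hs) (Eventually.of_forall hpt)
    _ = (∫ x, |W x| * min |d k x| (T ^ r) ∂μ) + T ^ (r - m) *
        ((∫ x, |W x| * |u k x| ^ m ∂μ) + ∫ x, |W x| * |w x| ^ m ∂μ) := by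
        rw [integral_add hmi hs, integral_const_mul, integral_add (hu k) hw]
    _ < ε / 2 + ε / 2 := by
        refine add_lt_add (hN k hk.le) (lt_of_le_of_lt ?_ hT)
        gcongr
        linarith [hC k]
    _ = ε := by ring

/-- Weak sequential compactness of bounded sets in a separable Hilbert space. -/
theorem exists_weakly_convergent_subseq {H : Type*} [NormedAddCommGroup H] [InnerProductSpace ℝ H]
    [CompleteSpace H] [TopologicalSpace.SeparableSpace H] (U : ℕ → H) {M : ℝ}
    (hU : ∀ k, ‖U k‖ ≤ M) :
    ∃ (w : H) (σ : ℕ → ℕ), StrictMono σ ∧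
      ∀ v, Tendsto (fun k => inner ℝ (U (σ k)) v) atTop (𝓝 (inner ℝ w v)) := by
  -- Sequential Banach-Alaoglu in the dual; the Riesz isomorphism carries the limit back to `H`.
  obtain ⟨D, -, σ, hσ, hlim⟩ := WeakDual.isSeqCompact_closedBall ℝ H 0 M
    (x := fun k => StrongDual.toWeakDual (InnerProductSpace.toDual ℝ H (U k)))
    (fun k => by simpa using hU k)
  refine ⟨(InnerProductSpace.toDual ℝ H).symm (WeakDual.toStrongDual D), σ, hσ, fun v => ?_⟩
  have := ((WeakDual.eval_continuous v).tendsto D).comp hlim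
  rw [InnerProductSpace.toDual_symm_apply]
  exact this

end FracHardy

namespace FracHardy

variable {n : ℕ} {α : ℝ}

/-! ### Compactness -/

/-- Nonnegativity of the variance about the mean `c`. -/
theorem sq_setIntegral_le {X : Type*} [MeasurableSpace X] {μ : Measure X} {s : Set X}
    {g : X → ℝ} (hs0 : 0 < μ.real s) (hg : IntegrableOn g s μ)
    (hg2 : IntegrableOn (fun x => g x ^ 2) s μ) :
    (∫ x in s, g x ∂μ) ^ 2 ≤ μ.real s * ∫ x in s, g x ^ 2 ∂μ := by
  set c : ℝ := (∫ x in s, g x ∂μ) / μ.real s with hc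
  have hfin : μ s ≠ ⊤ := fun h => by simp [measureReal_def, h] at hs0
  have h1 : 0 ≤ ∫ x in s, (g x - c) ^ 2 ∂μ := integral_nonneg fun x => sq_nonneg _
  have h2 : ∫ x in s, (g x - c) ^ 2 ∂μ =
      (∫ x in s, g x ^ 2 ∂μ) - 2 * c * (∫ x in s, g x ∂μ) + c ^ 2 * μ.real s := by
    have hci : IntegrableOn (fun _ : X => c ^ 2) s μ := integrableOn_const hfin
    have h3 : IntegrableOn (fun x => g x ^ 2 - 2 * c * g x) s μ := hg2.sub (hg.const_mul _)
    have h4 : ∀ x, (g x - c) ^ 2 = (g x ^ 2 - 2 * c * g x) + c ^ 2 := fun x => by ring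
    simp only [h4]
    rw [integral_add h3 hci, integral_sub hg2 (hg.const_mul _), integral_const_mul,
      setIntegral_const, smul_eq_mul, mul_comm (c ^ 2)]
  have h5 : c * μ.real s = ∫ x in s, g x ∂μ := by rw [hc]; field_simp
  rw [h2, ← h5] at h1
  rw [← h5]
  nlinarith

theorem integrableOn_ball_of_memLp {v : Rn n → ℝ} (hv : MemLp v 2 volume) (x : Rn n) (t : ℝ) :
    IntegrableOn v (Metric.ball x t) := by
  have := Fact.mk (measure_ball_lt_top (μ := volume) (x := x) (r := t))
  exact (hv.restrict _).integrable (by norm_num)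

/-- Functions are close in `L²` to their averages over small balls. -/
theorem sq_sub_average_le (hα0 : 0 < α) {v : Rn n → ℝ} (hv : MemH α v) {t : ℝ} (ht : 0 < t) :
    ∀ᵐ x, (v x - (volume.real (Metric.ball x t))⁻¹ * ∫ y in Metric.ball x t, v y) ^ 2 ≤
      t ^ α * (volume.real (Metric.ball (0 : Rn n) 1))⁻¹ * gagliardoDensity α v x := by
  set κ : ℝ := volume.real (Metric.ball (0 : Rn n) 1) with hκ
  have hκ0 : 0 < κ := volume_real_ball_pos
  filter_upwards [hv.integrable_density.2.2] with x hx
  set B := Metric.ball x t with hB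
  have hvol : volume.real B = t ^ (n : ℝ) * κ := volume_real_ball x ht
  have hvol0 : 0 < volume.real B := by rw [hvol]; positivity
  have hfin : volume B ≠ ⊤ := measure_ball_lt_top.ne
  have hvB : IntegrableOn v B := integrableOn_ball_of_memLp hv.1 x t
  have hci : IntegrableOn (fun _ => v x) B := integrableOn_const hfin
  have hg : IntegrableOn (fun y => v x - v y) B := hci.sub hvB
  have hle : ∀ y ∈ B, (v x - v y) ^ 2 ≤ t ^ ((n : ℝ) + α) * gagliardoIntegrand α v v (x, y) :=
    fun y hy => sq_sub_le_density hα0 (by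
      rw [norm_sub_rev]; simpa [hB, dist_eq_norm] using hy)
  have hg2 : IntegrableOn (fun y => (v x - v y) ^ 2) B := by
    refine (hx.integrableOn.const_mul (t ^ ((n : ℝ) + α))).mono'
      (hg.aestronglyMeasurable.pow 2) ?_
    refine (ae_restrict_iff' Metric.isOpen_ball.measurableSet).2
      (Eventually.of_forall fun y hy => ?_)
    rw [Real.norm_of_nonneg (sq_nonneg _)]
    exact hle y hy
  have h1 := sq_setIntegral_le hvol0 hg hg2
  have h2 : ∫ y in B, (v x - v y) ^ 2 ≤ t ^ ((n : ℝ) + α) * gagliardoDensity α v x := by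
    calc _ ≤ ∫ y in B, t ^ ((n : ℝ) + α) * gagliardoIntegrand α v v (x, y) :=
          setIntegral_mono_on hg2 (hx.integrableOn.const_mul _) Metric.isOpen_ball.measurableSet hle
      _ ≤ ∫ y, t ^ ((n : ℝ) + α) * gagliardoIntegrand α v v (x, y) :=
          setIntegral_le_integral (hx.const_mul _) (Eventually.of_forall fun y => by
            have := gagliardoIntegrand_self_nonneg (α := α) v (x, y)
            simp only [Pi.zero_apply]; positivity)
      _ = _ := by rw [integral_const_mul]; rfl
  have h3 : ∫ y in B, (v x - v y) = volume.real B * v x - ∫ y in B, v y := by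
    rw [integral_sub hci hvB, setIntegral_const, smul_eq_mul]
  have h4 : v x - (volume.real B)⁻¹ * ∫ y in B, v y =
      (volume.real B)⁻¹ * ∫ y in B, (v x - v y) := by
    rw [h3]; field_simp
  rw [h4, mul_pow]
  have e1 : t ^ ((n : ℝ) + α) = t ^ (n : ℝ) * t ^ α := Real.rpow_add ht _ _
  have hD := gagliardoDensity_nonneg (α := α) v x
  calc (volume.real B)⁻¹ ^ 2 * (∫ y in B, (v x - v y)) ^ 2
      ≤ (volume.real B)⁻¹ ^ 2 * (volume.real B * (t ^ ((n : ℝ) + α) * gagliardoDensity α v x)) := by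
        gcongr
        exact h1.trans (mul_le_mul_of_nonneg_left h2 hvol0.le)
    _ = t ^ α * κ⁻¹ * gagliardoDensity α v x := by
        rw [hvol, e1]; field_simp

theorem norm_toLp_sq {X : Type*} [MeasurableSpace X] {μ : Measure X} {f : X → ℝ}
    (hf : MemLp f 2 μ) : ‖hf.toLp f‖ ^ 2 = ∫ x, f x ^ 2 ∂μ := by
  rw [← real_inner_self_eq_norm_sq, L2.inner_def]
  refine integral_congr_ae ?_
  filter_upwards [hf.coeFn_toLp] with x hx
  simp [hx, pow_two]

theorem X0.sub_mem {Ω : Set (Rn n)} {u v : Rn n → ℝ} (hu : u ∈ X0 α Ω) (hv : v ∈ X0 α Ω) :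
    u - v ∈ X0 α Ω := by
  have := X0.add_mem hu (X0.smul_mem (-1) hv)
  rwa [neg_one_smul, ← sub_eq_add_neg] at this

theorem gagliardo_sub_le {u v : Rn n → ℝ} (hu : MemH α u) (hv : MemH α v) :
    gagliardo α (u - v) (u - v) ≤ 2 * gagliardo α u u + 2 * gagliardo α v v := by
  have h1 := gagliardo_add_smul hu hv (-1)
  have h2 := gagliardo_add_smul hu hv 1
  have h3 := gagliardo_self_nonneg (α := α) (u + (1 : ℝ) • v)
  rw [neg_one_smul, ← sub_eq_add_neg] at h1
  linarith

theorem X0.integral_sq_le (hα0 : 0 < α) (hα2 : α < 2) (hαn : α < n) {Ω : Set (Rn n)}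
    (hΩo : IsOpen Ω) (hΩb : Bornology.IsBounded Ω) :
    ∃ C > 0, ∀ u ∈ X0 α Ω, ∫ x, u x ^ 2 ≤ C * gagliardo α u u := by
  have hnα : 0 < (n : ℝ) - α := by linarith
  obtain ⟨C, hC0, hC⟩ := embedding (s := 0) (r := 2) hα0 hα2 hαn le_rfl hα0 two_pos (by
    unfold critExp; rw [le_div_iff₀ hnα]; linarith) hΩo hΩb
  refine ⟨C, hC0, fun u hu => ?_⟩
  have h := (hC u hu).2
  simp only [Real.rpow_zero, div_one, div_self (two_ne_zero (α := ℝ)), Real.rpow_one,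
    Real.rpow_two, sq_abs] at h
  rwa [setIntegral_eq_integral_of_ae_compl_eq_zero] at h
  filter_upwards [(ae_restrict_iff' hΩo.measurableSet.compl).1 hu.2] with x hx hxΩ
  rw [hx hxΩ]; simp

/-- Bounded sequences in `X₀` have subsequences converging a.e. -/
theorem X0.exists_ae_subseq (hα0 : 0 < α) (hα2 : α < 2) (hαn : α < n) {Ω : Set (Rn n)}
    (hΩo : IsOpen Ω) (hΩb : Bornology.IsBounded Ω) {u : ℕ → Rn n → ℝ} {M : ℝ}
    (hu : ∀ k, u k ∈ X0 α Ω) (hM : ∀ k, gagliardo α (u k) (u k) ≤ M) :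
    ∃ (w : Rn n → ℝ) (σ : ℕ → ℕ), StrictMono σ ∧
      ∀ᵐ x, Tendsto (fun k => u (σ k) x) atTop (𝓝 (w x)) := by
  have hM0 : 0 ≤ M := (gagliardo_self_nonneg _).trans (hM 0)
  obtain ⟨C, hC0, hC⟩ := X0.integral_sq_le hα0 hα2 hαn hΩo hΩb
  set κ : ℝ := volume.real (Metric.ball (0 : Rn n) 1) with hκ
  have hκ0 : 0 < κ := volume_real_ball_pos
  set U : ℕ → Lp ℝ 2 (volume : Measure (Rn n)) := fun k => (hu k).1.1.toLp (u k) with hU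
  have hUn : ∀ k, ‖U k‖ ≤ √(C * M) := fun k => by
    refine Real.le_sqrt_of_sq_le ?_
    rw [norm_toLp_sq]
    exact (hC _ (hu k)).trans (by have := hM k; gcongr)
  have : Fact ((2 : ENNReal) ≠ ⊤) := ⟨by norm_num⟩
  -- Weak convergence makes the integrals over balls of radius `t` converge at every centre, hence
  -- in `L²(Ω)` by domination. By `sq_sub_average_le` each function is close in `L²` to its
  -- averages, with a squared error of order `t ^ α` uniform in `k`, so the subsequence is Cauchy in
  -- `L²`.
  obtain ⟨W, σ, hσ, hW⟩ := exists_weakly_convergent_subseq U hUn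
  have hball : ∀ (f : Lp ℝ 2 (volume : Measure (Rn n))) (x : Rn n) (t : ℝ),
      inner ℝ f (indicatorConstLp 2 (Metric.isOpen_ball (x := x) (ε := t)).measurableSet
        measure_ball_lt_top.ne (1 : ℝ)) = ∫ y in Metric.ball x t, f y := fun f x t => by
    rw [real_inner_comm, L2.inner_indicatorConstLp_one]
  have hAu : ∀ (t : ℝ) k x, ∫ y in Metric.ball x t, U k y = ∫ y in Metric.ball x t, u k y :=
    fun t k x => integral_congr_ae (ae_restrict_of_ae (hu k).1.1.coeFn_toLp)
  have hlimA : ∀ (t : ℝ) x, Tendsto (fun k => ∫ y in Metric.ball x t, u (σ k) y) atTop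
      (𝓝 (∫ y in Metric.ball x t, W y)) := by
    intro t x
    have := hW (indicatorConstLp 2 (Metric.isOpen_ball (x := x) (ε := t)).measurableSet
        measure_ball_lt_top.ne (1 : ℝ))
    simp only [hball, hAu] at this
    exact this
  have hΩfin : volume Ω ≠ ⊤ := hΩb.measure_lt_top.ne
  have hMH : ∀ k, MemLp (u k) 2 volume := fun k => (hu k).1.1
  -- the averages converge in `L²(Ω)`
  have hAm : ∀ (t : ℝ) {f : Rn n → ℝ}, AEStronglyMeasurable f volume →
      AEStronglyMeasurable (fun x => ∫ y in Metric.ball x t, f y) volume := by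
    intro t f hf
    have h1 : AEStronglyMeasurable (fun z : Rn n × Rn n =>
        {z : Rn n × Rn n | dist z.2 z.1 < t}.indicator (fun z => f z.2) z)
        (volume.prod volume) :=
      (hf.comp_quasiMeasurePreserving Measure.quasiMeasurePreserving_snd).indicator
        (measurableSet_lt (by fun_prop) measurable_const)
    refine h1.integral_prod_right'.congr (Eventually.of_forall fun x => ?_)
    simp only
    rw [← integral_indicator Metric.isOpen_ball.measurableSet]
    rfl
  have hAb : ∀ (t : ℝ), 0 < t → ∀ k x,
      (∫ y in Metric.ball x t, u k y) ^ 2 ≤ t ^ (n : ℝ) * κ * (C * M) := by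
    intro t ht k x
    have hvol : volume.real (Metric.ball x t) = t ^ (n : ℝ) * κ := volume_real_ball x ht
    have hvol0 : 0 < volume.real (Metric.ball x t) := by rw [hvol]; positivity
    have hi2 : Integrable fun x => u k x ^ 2 := (hMH k).integrable_sq
    have hi := integrableOn_ball_of_memLp (hMH k) x t
    refine (sq_setIntegral_le hvol0 hi hi2.integrableOn).trans ?_
    rw [hvol]
    gcongr
    calc _ ≤ ∫ y, u k y ^ 2 := setIntegral_le_integral hi2
          (Eventually.of_forall fun y => sq_nonneg _)
      _ ≤ _ := (hC _ (hu k)).trans (by have := hM k; gcongr)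
  have hconv : ∀ t : ℝ, 0 < t → Tendsto (fun k => ∫ x in Ω,
      ((∫ y in Metric.ball x t, u (σ k) y) - ∫ y in Metric.ball x t, W y) ^ 2) atTop (𝓝 0) := by
    intro t ht
    have h0 : (0 : ℝ) = ∫ x in Ω, (0 : ℝ) := by simp
    rw [h0]
    refine tendsto_integral_of_dominated_convergence (fun _ => 4 * (t ^ (n : ℝ) * κ * (C * M)))
      (fun k => (((hAm t (hMH _).1).sub (hAm t (Lp.aestronglyMeasurable W))).pow 2).restrict)
      (integrableOn_const hΩfin) (fun k => Eventually.of_forall fun x => ?_)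
      (Eventually.of_forall fun x => ?_)
    · have h1 := hAb t ht (σ k) x
      have h2 : (∫ y in Metric.ball x t, W y) ^ 2 ≤ t ^ (n : ℝ) * κ * (C * M) :=
        le_of_tendsto ((hlimA t x).pow 2) (Eventually.of_forall fun k => hAb t ht (σ k) x)
      rw [Real.norm_of_nonneg (sq_nonneg _)]
      nlinarith [sq_nonneg ((∫ y in Metric.ball x t, u (σ k) y) + ∫ y in Metric.ball x t, W y)]
    · have := ((hlimA t x).sub_const (∫ y in Metric.ball x t, W y)).pow 2
      simpa using this
  -- the Cauchy property
  have hcauchy : CauchySeq fun k => U (σ k) := by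
    rw [Metric.cauchySeq_iff']
    intro ε hε
    -- choice of the radius
    obtain ⟨t, ht0, htε⟩ : ∃ t : ℝ, 0 < t ∧ 2 * (t ^ α * κ⁻¹ * (4 * M)) < ε ^ 2 / 2 := by
      have hlim : Tendsto (fun t : ℝ => 2 * (t ^ α * κ⁻¹ * (4 * M))) (𝓝[>] 0) (𝓝 0) := by
        have h1 : ContinuousAt (fun t : ℝ => t ^ α) 0 :=
          Real.continuousAt_rpow_const _ _ (Or.inr hα0.le)
        have h2 := (((h1.mul_const κ⁻¹).mul_const (4 * M)).const_mul 2).tendsto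
        simp only [Real.zero_rpow hα0.ne', zero_mul, mul_zero] at h2
        exact h2.mono_left nhdsWithin_le_nhds
      obtain ⟨t, h1, h2⟩ := ((hlim.eventually (gt_mem_nhds (by positivity : 0 < ε ^ 2 / 2))).and
        self_mem_nhdsWithin).exists
      exact ⟨t, h2, h1⟩
    set b : ℝ := (t ^ (n : ℝ) * κ)⁻¹ with hb
    have hb0 : 0 < b := by positivity
    obtain ⟨N, hN⟩ := eventually_atTop.1 ((hconv t ht0).eventually
      (gt_mem_nhds (by positivity : 0 < ε ^ 2 / (16 * b ^ 2))))
    refine ⟨N, fun k hk => ?_⟩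
    set v : Rn n → ℝ := u (σ k) - u (σ N) with hv
    have hvX : v ∈ X0 α Ω := X0.sub_mem (hu _) (hu _)
    have hvE : gagliardo α v v ≤ 4 * M := by
      have := gagliardo_sub_le (hu (σ k)).1 (hu (σ N)).1
      linarith [hM (σ k), hM (σ N)]
    have hdist : dist (U (σ k)) (U (σ N)) ^ 2 = ∫ x, v x ^ 2 := by
      rw [dist_eq_norm, ← MemLp.toLp_sub, norm_toLp_sq]
    rw [← pow_lt_pow_iff_left₀ dist_nonneg hε.le two_ne_zero, hdist]
    have hΩv : ∫ x, v x ^ 2 = ∫ x in Ω, v x ^ 2 := by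
      rw [setIntegral_eq_integral_of_ae_compl_eq_zero]
      filter_upwards [(ae_restrict_iff' hΩo.measurableSet.compl).1 hvX.2] with x hx hxΩ
      rw [hx hxΩ]; simp
    rw [hΩv]
    obtain ⟨hDi, hDv, -⟩ := hvX.1.integrable_density
    set A : ℕ → Rn n → ℝ := fun k x =>
      (∫ y in Metric.ball x t, u (σ k) y) - ∫ y in Metric.ball x t, W y with hA
    have hAsq : ∀ k, IntegrableOn (fun x => A k x ^ 2) Ω := by
      intro k
      refine (integrableOn_const hΩfin (C := 4 * (t ^ (n : ℝ) * κ * (C * M)))).mono'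
        (((hAm t (hMH _).1).sub (hAm t (Lp.aestronglyMeasurable W))).pow 2).restrict
        (Eventually.of_forall fun x => ?_)
      have h1 := hAb t ht0 (σ k) x
      have h2 : (∫ y in Metric.ball x t, W y) ^ 2 ≤ t ^ (n : ℝ) * κ * (C * M) :=
        le_of_tendsto ((hlimA t x).pow 2) (Eventually.of_forall fun k => hAb t ht0 (σ k) x)
      rw [Real.norm_of_nonneg (sq_nonneg _)]
      simp only [hA]
      nlinarith [sq_nonneg ((∫ y in Metric.ball x t, u (σ k) y) + ∫ y in Metric.ball x t, W y)]
    have hpt : ∀ᵐ x ∂(volume.restrict Ω), v x ^ 2 ≤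
        2 * (t ^ α * κ⁻¹ * gagliardoDensity α v x) + 4 * b ^ 2 * (A k x ^ 2 + A N x ^ 2) := by
      refine ae_restrict_of_ae ?_
      filter_upwards [sq_sub_average_le hα0 hvX.1 ht0] with x hx
      rw [volume_real_ball x ht0, ← hκ, ← hb] at hx
      have hloc := fun k => integrableOn_ball_of_memLp (hMH k) x t
      have hAv : ∫ y in Metric.ball x t, v y = A k x - A N x := by
        simp only [hA, hv, Pi.sub_apply]
        rw [integral_sub (hloc _) (hloc _)]; ring
      rw [hAv] at hx
      have h1 : v x ^ 2 ≤ 2 * (v x - b * (A k x - A N x)) ^ 2 + 2 * (b * (A k x - A N x)) ^ 2 := by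
        nlinarith [sq_nonneg (v x - 2 * (b * (A k x - A N x)))]
      have h2 : (A k x - A N x) ^ 2 ≤ 2 * (A k x ^ 2 + A N x ^ 2) := by
        nlinarith [sq_nonneg (A k x + A N x)]
      have h3 : (b * (A k x - A N x)) ^ 2 ≤ b ^ 2 * (2 * (A k x ^ 2 + A N x ^ 2)) := by
        rw [mul_pow]; gcongr
      linarith
    have hD' : Integrable (fun x => 2 * (t ^ α * κ⁻¹ * gagliardoDensity α v x)) :=
      (hDi.const_mul _).const_mul _
    have hAA : IntegrableOn (fun x => 4 * b ^ 2 * (A k x ^ 2 + A N x ^ 2)) Ω :=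
      ((hAsq k).add (hAsq N)).const_mul _
    calc ∫ x in Ω, v x ^ 2 ≤ ∫ x in Ω, (2 * (t ^ α * κ⁻¹ * gagliardoDensity α v x) +
          4 * b ^ 2 * (A k x ^ 2 + A N x ^ 2)) :=
          integral_mono_ae hvX.1.1.integrable_sq.integrableOn
            (Integrable.add hD'.integrableOn hAA) hpt
      _ = (∫ x in Ω, 2 * (t ^ α * κ⁻¹ * gagliardoDensity α v x)) +
          4 * b ^ 2 * ((∫ x in Ω, A k x ^ 2) + ∫ x in Ω, A N x ^ 2) := by
          rw [integral_add hD'.integrableOn hAA, integral_const_mul (4 * b ^ 2),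
            integral_add (hAsq k) (hAsq N)]
      _ < ε ^ 2 / 2 + 4 * b ^ 2 * (ε ^ 2 / (16 * b ^ 2) + ε ^ 2 / (16 * b ^ 2)) := by
          refine add_lt_add (lt_of_le_of_lt ?_ htε) ?_
          · calc _ ≤ ∫ x, 2 * (t ^ α * κ⁻¹ * gagliardoDensity α v x) :=
                  setIntegral_le_integral hD' (Eventually.of_forall fun x => by
                    have := gagliardoDensity_nonneg (α := α) v x
                    simp only [Pi.zero_apply]; positivity)
              _ = 2 * (t ^ α * κ⁻¹ * gagliardo α v v) := by
                  rw [integral_const_mul, integral_const_mul, hDv]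
              _ ≤ _ := by gcongr
          · have h1 := hN k hk
            have h2 := hN N le_rfl
            simp only [hA]
            gcongr
      _ = ε ^ 2 := by field_simp; ring
  obtain ⟨Z, hZ⟩ := cauchySeq_tendsto_of_complete hcauchy
  obtain ⟨τ, hτ, hae⟩ := (tendstoInMeasure_of_tendsto_Lp hZ).exists_seq_tendsto_ae
  refine ⟨Z, σ ∘ τ, hσ.comp hτ, ?_⟩
  filter_upwards [hae, ae_all_iff.2 fun k => (hu (σ (τ k))).1.1.coeFn_toLp] with x hx hx'
  refine hx.congr fun k => ?_
  exact hx' k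

end FracHardy

namespace FracHardy

variable {n : ℕ} {α : ℝ}

/-! ### The quadratic form -/

theorem rpow_half_mul_rpow_half {x e : ℝ} (hx : 0 ≤ x) (he : 0 < e) :
    x ^ (e / 2) * x ^ (e / 2) = x ^ e := by
  rw [← Real.rpow_add_of_nonneg hx (by positivity) (by positivity)]; congr 1; ring

/-- The polar form of `normSq`. -/
noncomputable def normForm (α γ : ℝ) (Ω : Set (Rn n)) (u v : Rn n → ℝ) : ℝ :=
  cConst n α * gagliardo α u v - γ * ∫ x in Ω, u x * v x / ‖x‖ ^ α

theorem normForm_self (γ : ℝ) (Ω : Set (Rn n)) (u : Rn n → ℝ) :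
    normForm α γ Ω u u = normSq α γ Ω u := by
  unfold normForm normSq
  congr 3; ext x; rw [sq_abs, pow_two]

theorem X0.ae_eq_zero {Ω : Set (Rn n)} (hΩo : IsOpen Ω) {u : Rn n → ℝ} (hu : u ∈ X0 α Ω) :
    ∀ᵐ x, x ∉ Ω → u x = 0 := (ae_restrict_iff' hΩo.measurableSet.compl).1 hu.2

theorem X0.hardy (hα0 : 0 < α) (hα2 : α < 2) (hαn : α < n) {Ω : Set (Rn n)}
    (hΩo : IsOpen Ω) (hΩb : Bornology.IsBounded Ω)
    {u : Rn n → ℝ} (hu : u ∈ X0 α Ω) :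
    Integrable (fun x => u x ^ 2 / ‖x‖ ^ α) ∧
      gammaH n α * ∫ x, u x ^ 2 / ‖x‖ ^ α ≤ cConst n α * gagliardo α u u := by
  obtain ⟨R, -, -, hR⟩ := X0.exists_radius (α := α) hΩo hΩb
  exact FracHardy.hardy hα0 hα2 hαn hu.1 (hR u hu)

theorem X0.integrable_mul_div (hα0 : 0 < α) (hα2 : α < 2) (hαn : α < n) {Ω : Set (Rn n)}
    (hΩo : IsOpen Ω) (hΩb : Bornology.IsBounded Ω)
    {u v : Rn n → ℝ} (hu : u ∈ X0 α Ω) (hv : v ∈ X0 α Ω) :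
    Integrable (fun x => u x * v x / ‖x‖ ^ α) := by
  refine ((X0.hardy hα0 hα2 hαn hΩo hΩb hu).1.add (X0.hardy hα0 hα2 hαn hΩo hΩb hv).1).mono'
    ((hu.1.1.1.mul hv.1.1.1).div₀
      (by fun_prop : Measurable fun x : Rn n => ‖x‖ ^ α).aestronglyMeasurable)
    (Eventually.of_forall fun x => ?_)
  rw [norm_div, Real.norm_of_nonneg (by positivity : 0 ≤ ‖x‖ ^ α), Pi.add_apply, ← add_div,
    Real.norm_eq_abs]
  gcongr
  rw [abs_le]
  constructor <;> nlinarith [sq_nonneg (u x + v x), sq_nonneg (u x - v x)]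

theorem normSq_add_smul (hα0 : 0 < α) (hα2 : α < 2) (hαn : α < n) {Ω : Set (Rn n)}
    (hΩo : IsOpen Ω) (hΩb : Bornology.IsBounded Ω)
    (γ : ℝ) {u v : Rn n → ℝ} (hu : u ∈ X0 α Ω) (hv : v ∈ X0 α Ω) (c : ℝ) :
    normSq α γ Ω (u + c • v) =
      normSq α γ Ω u + 2 * c * normForm α γ Ω u v + c ^ 2 * normSq α γ Ω v := by
  have h1 := (X0.integrable_mul_div hα0 hα2 hαn hΩo hΩb hu hu).integrableOn (s := Ω)
  have h2 := (X0.integrable_mul_div hα0 hα2 hαn hΩo hΩb hu hv).integrableOn (s := Ω)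
  have h3 := (X0.integrable_mul_div hα0 hα2 hαn hΩo hΩb hv hv).integrableOn (s := Ω)
  have h4 : ∫ x in Ω, (u + c • v) x * (u + c • v) x / ‖x‖ ^ α =
      (∫ x in Ω, u x * u x / ‖x‖ ^ α) + 2 * c * (∫ x in Ω, u x * v x / ‖x‖ ^ α) +
        c ^ 2 * ∫ x in Ω, v x * v x / ‖x‖ ^ α := by
    have h5 := integral_add (Integrable.add h1 (h2.const_mul (2 * c))) (h3.const_mul (c ^ 2))
    simp only [Pi.add_apply] at h5
    rw [integral_add h1 (h2.const_mul (2 * c)), integral_const_mul, integral_const_mul] at h5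
    rw [← h5]
    congr 1; ext x
    simp only [Pi.add_apply, Pi.smul_apply, smul_eq_mul]; ring
  simp only [← normForm_self]
  unfold normForm
  rw [h4, gagliardo_add_smul hu.1 hv.1]
  ring

/-- Coercivity of `normSq` below the Hardy constant. -/
theorem normSq_coercive (hα0 : 0 < α) (hα2 : α < 2) (hαn : α < n) {Ω : Set (Rn n)}
    (hΩo : IsOpen Ω) (hΩb : Bornology.IsBounded Ω)
    {γ : ℝ} (hγ : γ < gammaH n α) :
    ∃ κ > 0, ∀ u ∈ X0 α Ω, κ * gagliardo α u u ≤ normSq α γ Ω u := by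
  have hγH := gammaH_pos hα0 hαn
  have hc := cConst_pos (n := n) hα0 hα2
  -- The positive part is used because for negative `γ` the potential term only increases `normSq`.
  have hlt : max γ 0 / gammaH n α < 1 := by rw [div_lt_one hγH]; exact max_lt hγ hγH
  refine ⟨cConst n α * (1 - max γ 0 / gammaH n α), mul_pos hc (by linarith), fun u hu => ?_⟩
  obtain ⟨h1, h2⟩ := X0.hardy hα0 hα2 hαn hΩo hΩb hu
  have h3 : ∫ x in Ω, |u x| ^ 2 / ‖x‖ ^ α ≤ ∫ x, u x ^ 2 / ‖x‖ ^ α := by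
    simp only [sq_abs]
    exact setIntegral_le_integral h1 (Eventually.of_forall fun x => by
      simp only [Pi.zero_apply]; positivity)
  have h4 : 0 ≤ ∫ x in Ω, |u x| ^ 2 / ‖x‖ ^ α := integral_nonneg fun x => by positivity
  have h5 : γ * ∫ x in Ω, |u x| ^ 2 / ‖x‖ ^ α ≤
      max γ 0 / gammaH n α * (cConst n α * gagliardo α u u) := by
    calc _ ≤ max γ 0 * ∫ x in Ω, |u x| ^ 2 / ‖x‖ ^ α := by gcongr; exact le_max_left _ _
      _ ≤ max γ 0 * ∫ x, u x ^ 2 / ‖x‖ ^ α := by gcongr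
      _ = max γ 0 / gammaH n α * (gammaH n α * ∫ x, u x ^ 2 / ‖x‖ ^ α) := by field_simp
      _ ≤ _ := by gcongr
  unfold normSq
  nlinarith

/-- The a.e. limit of a bounded sequence in `X₀` is in `X₀`. -/
theorem X0.mem_of_tendsto (hα0 : 0 < α) (hα2 : α < 2) (hαn : α < n) {Ω : Set (Rn n)}
    (hΩo : IsOpen Ω) (hΩb : Bornology.IsBounded Ω)
    {u : ℕ → Rn n → ℝ} {w : Rn n → ℝ} {M : ℝ} (hu : ∀ k, u k ∈ X0 α Ω)
    (hM : ∀ k, gagliardo α (u k) (u k) ≤ M)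
    (hlim : ∀ᵐ x, Tendsto (fun k => u k x) atTop (𝓝 (w x))) :
    w ∈ X0 α Ω ∧ gagliardo α w w ≤ M := by
  obtain ⟨C, hC0, hC⟩ := X0.integral_sq_le hα0 hα2 hαn hΩo hΩb
  have hwm : AEStronglyMeasurable w volume :=
    aestronglyMeasurable_of_tendsto_ae atTop (fun k => (hu k).1.1.1) hlim
  obtain ⟨h1, -⟩ := integral_le_of_tendsto (fun k => (hu k).1.1.integrable_sq)
    (fun k => Eventually.of_forall fun x => sq_nonneg (u k x)) (g := fun x => w x ^ 2)
    (by filter_upwards [hlim] with x hx; exact hx.pow 2) (C := C * M)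
    (fun k => (hC _ (hu k)).trans (by have := hM k; gcongr))
  obtain ⟨h2, h3⟩ := integral_le_of_tendsto (fun k => (hu k).1.2)
    (fun k => Eventually.of_forall (gagliardoIntegrand_self_nonneg (u k)))
    (g := gagliardoIntegrand α w w) (by
      filter_upwards [Measure.quasiMeasurePreserving_fst.ae hlim,
        Measure.quasiMeasurePreserving_snd.ae hlim] with z hz1 hz2
      exact ((hz1.sub hz2).mul (hz1.sub hz2)).div_const _) hM
  refine ⟨⟨⟨(memLp_two_iff_integrable_sq hwm).2 h1, h2⟩, ?_⟩, h3⟩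
  refine (ae_restrict_iff' hΩo.measurableSet.compl).2 ?_
  filter_upwards [hlim, ae_all_iff.2 fun k => X0.ae_eq_zero hΩo (hu k)] with x hx hx0 hxΩ
  exact tendsto_nhds_unique hx (tendsto_const_nhds.congr fun k => (hx0 k hxΩ).symm)

/-- Lower semicontinuity of `normSq` along bounded sequences converging a.e. -/
theorem normSq_lsc (hα0 : 0 < α) (hα2 : α < 2) (hαn : α < n) {Ω : Set (Rn n)}
    (hΩo : IsOpen Ω) (hΩb : Bornology.IsBounded Ω)
    {γ : ℝ} (hγ : γ < gammaH n α) {u : ℕ → Rn n → ℝ} {w : Rn n → ℝ} {M : ℝ}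
    (hu : ∀ k, u k ∈ X0 α Ω) (hM : ∀ k, gagliardo α (u k) (u k) ≤ M)
    (hlim : ∀ᵐ x, Tendsto (fun k => u k x) atTop (𝓝 (w x))) :
    ∀ ε > 0, ∀ᶠ k in atTop, normSq α γ Ω w - ε ≤ normSq α γ Ω (u k) := by
  obtain ⟨hw, hwM⟩ := X0.mem_of_tendsto hα0 hα2 hαn hΩo hΩb hu hM hlim
  obtain ⟨κ, hκ, hcoer⟩ := normSq_coercive hα0 hα2 hαn hΩo hΩb hγ
  have hγH := gammaH_pos hα0 hαn
  have hc := cConst_pos (n := n) hα0 hα2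
  -- In `Q(u_k) = Q(w) + 2 B(w, d_k) + Q(d_k)` the last term is nonnegative, so it suffices that the
  -- cross term tends to `0`. Each part of it is an `L²` product of a fixed function with a bounded
  -- sequence tending to `0` a.e., once the kernel is split into two square roots (`q` below).
  set d : ℕ → Rn n → ℝ := fun k => u k - w with hd
  have hdX : ∀ k, d k ∈ X0 α Ω := fun k => X0.sub_mem (hu k) hw
  have hdM : ∀ k, gagliardo α (d k) (d k) ≤ 4 * M := fun k => by
    have := gagliardo_sub_le (hu k).1 hw.1
    linarith [hM k]
  have hdlim : ∀ᵐ x, Tendsto (fun k => d k x) atTop (𝓝 0) := by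
    filter_upwards [hlim] with x hx
    simpa [hd] using hx.sub_const (w x)
  -- the Gagliardo part
  have hG : Tendsto (fun k => gagliardo α w (d k)) atTop (𝓝 0) := by
    set q : (Rn n → ℝ) → Rn n × Rn n → ℝ := fun v z =>
      (v z.1 - v z.2) / ‖z.1 - z.2‖ ^ (((n : ℝ) + α) / 2) with hq
    have hqq : ∀ v v' z, q v z * q v' z = gagliardoIntegrand α v v' z := fun v v' z => by
      simp only [hq, gagliardoIntegrand]
      rw [div_mul_div_comm, rpow_half_mul_rpow_half (norm_nonneg _) (by positivity)]
    have hqm : ∀ v, AEStronglyMeasurable v volume → AEStronglyMeasurable (q v) volume := fun v hv =>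
      (aestronglyMeasurable_sub hv).div₀ (by fun_prop :
        Measurable fun z : Rn n × Rn n => ‖z.1 - z.2‖ ^ (((n : ℝ) + α) / 2)).aestronglyMeasurable
    have h1 := tendsto_integral_mul_of_bounded (φ := q w) (d := fun k => q (d k)) (C := 4 * M)
      (hqm w hw.1.1.1) (by simp only [pow_two, hqq]; exact hw.1.2)
      (fun k => hqm _ (hdX k).1.1.1) (fun k => by simp only [pow_two, hqq]; exact (hdX k).1.2)
      (fun k => by simp only [pow_two, hqq]; exact hdM k) (by
        filter_upwards [Measure.quasiMeasurePreserving_fst.ae hdlim,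
          Measure.quasiMeasurePreserving_snd.ae hdlim] with z hz1 hz2
        simpa using (hz1.sub hz2).div_const (‖z.1 - z.2‖ ^ (((n : ℝ) + α) / 2)))
    simp only [hqq] at h1
    exact h1
  -- the potential part
  have hP : Tendsto (fun k => ∫ x in Ω, w x * d k x / ‖x‖ ^ α) atTop (𝓝 0) := by
    set q : (Rn n → ℝ) → Rn n → ℝ := fun v x => v x / ‖x‖ ^ (α / 2) with hq
    have hqq : ∀ v v' x, q v x * q v' x = v x * v' x / ‖x‖ ^ α := fun v v' x => by
      simp only [hq]
      rw [div_mul_div_comm, rpow_half_mul_rpow_half (norm_nonneg _) hα0]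
    have hqm : ∀ v, AEStronglyMeasurable v volume →
        AEStronglyMeasurable (q v) (volume.restrict Ω) := fun v hv =>
      (hv.div₀ (by fun_prop :
        Measurable fun x : Rn n => ‖x‖ ^ (α / 2)).aestronglyMeasurable).restrict
    have hqi : ∀ v ∈ X0 α Ω, IntegrableOn (fun x => q v x ^ 2) Ω := fun v hv => by
      simp only [pow_two, hqq]
      exact (X0.integrable_mul_div hα0 hα2 hαn hΩo hΩb hv hv).integrableOn
    have h1 := tendsto_integral_mul_of_bounded (φ := q w) (d := fun k => q (d k))
      (C := cConst n α * (4 * M) / gammaH n α) (μ := volume.restrict Ω)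
      (hqm w hw.1.1.1) (hqi w hw) (fun k => hqm _ (hdX k).1.1.1) (fun k => hqi _ (hdX k))
      (fun k => by
        obtain ⟨h2, h3⟩ := X0.hardy hα0 hα2 hαn hΩo hΩb (hdX k)
        rw [le_div_iff₀ hγH, mul_comm]
        simp only [pow_two, hqq]
        simp only [pow_two] at h2 h3
        calc _ ≤ gammaH n α * ∫ x, d k x * d k x / ‖x‖ ^ α := by
              refine mul_le_mul_of_nonneg_left ?_ hγH.le
              exact setIntegral_le_integral h2 (Eventually.of_forall fun x => by
                simp only [Pi.zero_apply]
                exact div_nonneg (mul_self_nonneg _) (by positivity))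
          _ ≤ _ := h3.trans (mul_le_mul_of_nonneg_left (hdM k) hc.le)) (by
        refine ae_restrict_of_ae ?_
        filter_upwards [hdlim] with x hx
        simpa using hx.div_const (‖x‖ ^ (α / 2)))
    simp only [hqq] at h1
    exact h1
  have hB : Tendsto (fun k => 2 * 1 * normForm α γ Ω w (d k)) atTop (𝓝 0) := by
    have := ((hG.const_mul (cConst n α)).sub (hP.const_mul γ)).const_mul (2 * 1)
    simpa [normForm] using this
  intro ε hε
  filter_upwards [hB.eventually (lt_mem_nhds (neg_lt_zero.2 hε))] with k hk
  have h1 := normSq_add_smul hα0 hα2 hαn hΩo hΩb γ hw (hdX k) 1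
  have h2 : w + (1 : ℝ) • d k = u k := by simp [hd]
  have h3 := hcoer _ (hdX k)
  have h4 := gagliardo_self_nonneg (α := α) (d k)
  rw [h2] at h1
  rw [h1]
  nlinarith [mul_nonneg hκ.le h4]

/-! ### The power terms -/

/-- `∫_Ω h |u|^r / |x|^s`. -/
noncomputable def powerTerm (s r : ℝ) (Ω : Set (Rn n)) (h u : Rn n → ℝ) : ℝ :=
  ∫ x in Ω, h x / ‖x‖ ^ s * |u x| ^ r

/-- `∫_Ω h |u|^(r-2) u v / |x|^s`. -/
noncomputable def powerTermDeriv (s r : ℝ) (Ω : Set (Rn n)) (h u v : Rn n → ℝ) : ℝ :=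
  ∫ x in Ω, h x / ‖x‖ ^ s * (|u x| ^ (r - 2) * u x * v x)

theorem concaveTerm_eq (q : ℝ) (Ω : Set (Rn n)) (f u : Rn n → ℝ) :
    concaveTerm q Ω f u = powerTerm 0 q Ω f u := by
  simp [concaveTerm, powerTerm]

theorem convexTerm_eq (s p : ℝ) (Ω : Set (Rn n)) (g u : Rn n → ℝ) :
    convexTerm s p Ω g u = powerTerm s p Ω g u := by
  unfold convexTerm powerTerm
  congr 1; ext x; ring

theorem powerTerm_smul {s r t : ℝ} (ht : 0 < t) (Ω : Set (Rn n)) (h u : Rn n → ℝ) :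
    powerTerm s r Ω h (t • u) = t ^ r * powerTerm s r Ω h u := by
  unfold powerTerm
  rw [← integral_const_mul]
  congr 1; ext x
  rw [Pi.smul_apply, smul_eq_mul, abs_mul, abs_of_pos ht, Real.mul_rpow ht.le (abs_nonneg _)]
  ring

theorem abs_rpow_sub_two_mul {r : ℝ} (hr : 1 < r) (y : ℝ) :
    |(|y| ^ (r - 2) * y)| = |y| ^ (r - 1) := by
  by_cases hy : y = 0
  · rw [hy, mul_zero, abs_zero, Real.zero_rpow (by linarith)]
  · rw [abs_mul, abs_of_nonneg (by positivity), show r - 1 = (r - 2) + 1 by ring,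
      Real.rpow_add_one (abs_pos.2 hy).ne']

theorem abs_rpow_sub_two_mul_mul {r : ℝ} (hr : 1 < r) (y : ℝ) :
    |y| ^ (r - 2) * y * y = |y| ^ r := by
  by_cases hy : y = 0
  · rw [hy, mul_zero, abs_zero, Real.zero_rpow (by linarith)]
  · rw [mul_assoc, ← abs_mul_abs_self, ← pow_two, ← Real.rpow_natCast,
      ← Real.rpow_add (abs_pos.2 hy)]
    congr 1; push_cast; ring

theorem powerTermDeriv_self {s r : ℝ} (hr : 1 < r) (Ω : Set (Rn n)) (h u : Rn n → ℝ) :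
    powerTermDeriv s r Ω h u u = powerTerm s r Ω h u := by
  unfold powerTerm powerTermDeriv
  simp only [abs_rpow_sub_two_mul_mul hr]

theorem exists_bound_of_continuousOn_closure {Ω : Set (Rn n)} (hΩb : Bornology.IsBounded Ω)
    {h : Rn n → ℝ} (hh : ContinuousOn h (closure Ω)) : ∃ K, 0 ≤ K ∧ ∀ x ∈ Ω, |h x| ≤ K := by
  obtain ⟨K, hK⟩ := (hΩb.isCompact_closure).exists_bound_of_continuousOn hh
  exact ⟨max K 0, le_max_right _ _, fun x hx =>
    (hK x (subset_closure hx)).trans (le_max_left _ _)⟩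

theorem aestronglyMeasurable_weight {Ω : Set (Rn n)} (hΩo : IsOpen Ω) {h : Rn n → ℝ}
    (hh : ContinuousOn h (closure Ω)) (s : ℝ) :
    AEStronglyMeasurable (fun x => h x / ‖x‖ ^ s) (volume.restrict Ω) :=
  ((hh.mono subset_closure).aestronglyMeasurable hΩo.measurableSet).div₀
    (by fun_prop : Measurable fun x : Rn n => ‖x‖ ^ s).aestronglyMeasurable

theorem integrableOn_weight (hα0 : 0 < α) (hαn : α < n) {Ω : Set (Rn n)} (hΩo : IsOpen Ω)
    (hΩb : Bornology.IsBounded Ω) {s : ℝ} (hsα : s < α) {h : Rn n → ℝ}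
    (hh : ContinuousOn h (closure Ω)) : IntegrableOn (fun x => h x / ‖x‖ ^ s) Ω := by
  obtain ⟨K, hK0, hK⟩ := exists_bound_of_continuousOn_closure hΩb hh
  obtain ⟨R, -, hΩR, -⟩ := X0.exists_radius (α := α) hΩo hΩb
  have hw : IntegrableOn (fun x : Rn n => (‖x‖ ^ s)⁻¹) Ω :=
    (integrableOn_norm_rpow (pos_of_lt_dim hα0 hαn) (hsα.trans hαn) R).mono_set hΩR
  refine (hw.const_mul K).mono' (aestronglyMeasurable_weight hΩo hh s) ?_
  refine (ae_restrict_iff' hΩo.measurableSet).2 (Eventually.of_forall fun x hx => ?_)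
  rw [norm_div, Real.norm_of_nonneg (by positivity : 0 ≤ ‖x‖ ^ s), div_eq_mul_inv]
  gcongr
  exact hK x hx

theorem powerTerm_bound (hα0 : 0 < α) (hα2 : α < 2) (hαn : α < n) {Ω : Set (Rn n)}
    (hΩo : IsOpen Ω) (hΩb : Bornology.IsBounded Ω) {s : ℝ} (hs0 : 0 ≤ s) (hsα : s < α)
    {h : Rn n → ℝ} (hh : ContinuousOn h (closure Ω))
    {r : ℝ} (hr0 : 0 < r) (hr : r ≤ critExp n α s) :
    ∃ C > 0, ∀ u ∈ X0 α Ω, IntegrableOn (fun x => |h x / ‖x‖ ^ s| * |u x| ^ r) Ω ∧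
      ∫ x in Ω, |h x / ‖x‖ ^ s| * |u x| ^ r ≤ C * gagliardo α u u ^ (r / 2) := by
  obtain ⟨K, hK0, hK⟩ := exists_bound_of_continuousOn_closure hΩb hh
  obtain ⟨C, hC0, hC⟩ := embedding hα0 hα2 hαn hs0 hsα hr0 hr hΩo hΩb
  refine ⟨(K + 1) * C, by positivity, fun u hu => ?_⟩
  obtain ⟨h1, h2⟩ := hC u hu
  have hle : ∀ x ∈ Ω, |h x / ‖x‖ ^ s| * |u x| ^ r ≤ (K + 1) * (|u x| ^ r / ‖x‖ ^ s) := by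
    intro x hx
    rw [abs_div, abs_of_nonneg (by positivity : 0 ≤ ‖x‖ ^ s), div_mul_eq_mul_div, mul_div_assoc]
    gcongr
    linarith [hK x hx]
  have hi : IntegrableOn (fun x => |h x / ‖x‖ ^ s| * |u x| ^ r) Ω := by
    refine (h1.const_mul (K + 1)).mono' ((aestronglyMeasurable_weight hΩo hh s).norm.mul
      (hu.1.1.1.norm.aemeasurable.pow_const r).aestronglyMeasurable.restrict) ?_
    refine (ae_restrict_iff' hΩo.measurableSet).2 (Eventually.of_forall fun x hx => ?_)
    rw [Real.norm_of_nonneg (by positivity)]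
    exact hle x hx
  refine ⟨hi, ?_⟩
  calc _ ≤ ∫ x in Ω, (K + 1) * (|u x| ^ r / ‖x‖ ^ s) :=
        setIntegral_mono_on hi (h1.const_mul _) hΩo.measurableSet hle
    _ = (K + 1) * ∫ x in Ω, |u x| ^ r / ‖x‖ ^ s := integral_const_mul _ _
    _ ≤ (K + 1) * (C * gagliardo α u u ^ (r / 2)) := by gcongr
    _ = _ := by ring

theorem abs_powerTerm_le (hα0 : 0 < α) (hα2 : α < 2) (hαn : α < n) {Ω : Set (Rn n)}
    (hΩo : IsOpen Ω) (hΩb : Bornology.IsBounded Ω) {s : ℝ} (hs0 : 0 ≤ s) (hsα : s < α)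
    {h : Rn n → ℝ} (hh : ContinuousOn h (closure Ω))
    {r : ℝ} (hr0 : 0 < r) (hr : r ≤ critExp n α s) :
    ∃ C > 0, ∀ u ∈ X0 α Ω, |powerTerm s r Ω h u| ≤ C * gagliardo α u u ^ (r / 2) := by
  obtain ⟨C, hC0, hC⟩ := powerTerm_bound hα0 hα2 hαn hΩo hΩb hs0 hsα hh hr0 hr
  refine ⟨C, hC0, fun u hu => ?_⟩
  obtain ⟨h1, h2⟩ := hC u hu
  refine le_trans ?_ h2
  rw [powerTerm, ← Real.norm_eq_abs]
  refine norm_integral_le_of_norm_le h1 (Eventually.of_forall fun x => ?_)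
  rw [norm_mul, Real.norm_eq_abs, Real.norm_of_nonneg (by positivity : 0 ≤ |u x| ^ r)]

theorem tendsto_powerTerm (hα0 : 0 < α) (hα2 : α < 2) (hαn : α < n) {Ω : Set (Rn n)}
    (hΩo : IsOpen Ω) (hΩb : Bornology.IsBounded Ω) {s : ℝ} (hs0 : 0 ≤ s) (hsα : s < α)
    {h : Rn n → ℝ} (hh : ContinuousOn h (closure Ω))
    {r : ℝ} (hr0 : 0 < r) (hr : r < critExp n α s) {u : ℕ → Rn n → ℝ}
    {w : Rn n → ℝ} {M : ℝ} (hu : ∀ k, u k ∈ X0 α Ω) (hM : ∀ k, gagliardo α (u k) (u k) ≤ M)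
    (hlim : ∀ᵐ x, Tendsto (fun k => u k x) atTop (𝓝 (w x))) :
    Tendsto (fun k => powerTerm s r Ω h (u k)) atTop (𝓝 (powerTerm s r Ω h w)) := by
  obtain ⟨C, hC0, hC⟩ := powerTerm_bound hα0 hα2 hαn hΩo hΩb hs0 hsα hh (hr0.trans hr) le_rfl
  refine tendsto_integral_rpow_of_bounded hr0 hr
    (integrableOn_weight hα0 hαn hΩo hΩb hsα hh) (fun k => (hu k).1.1.1.restrict)
    (fun k => (hC _ (hu k)).1) (C := C * M ^ (critExp n α s / 2))
    (fun k => (hC _ (hu k)).2.trans ?_) (ae_restrict_of_ae hlim)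
  have := gagliardo_self_nonneg (α := α) (u k)
  have := hM k
  have := hr0.trans hr
  gcongr

/-- Differentiation under the integral: for `|ε| ≤ 1` the derivative of the integrand is dominated
by a multiple of `|W| (|u|^r + |v|^r)`, with `W` the weight. Integrability of the derivative at `ε =
0`, which the weak formulation demands, comes with it. -/
theorem integrableOn_powerTermDeriv (hα0 : 0 < α) (hα2 : α < 2) (hαn : α < n) {Ω : Set (Rn n)}
    (hΩo : IsOpen Ω) (hΩb : Bornology.IsBounded Ω) {s : ℝ} (hs0 : 0 ≤ s) (hsα : s < α)
    {h : Rn n → ℝ} (hh : ContinuousOn h (closure Ω))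
    {r : ℝ} (hr1 : 1 < r) (hr : r ≤ critExp n α s)
    {u v : Rn n → ℝ} (hu : u ∈ X0 α Ω) (hv : v ∈ X0 α Ω) :
    IntegrableOn (fun x => h x / ‖x‖ ^ s * (|u x| ^ (r - 2) * u x * v x)) Ω ∧
      HasDerivAt (fun ε : ℝ => powerTerm s r Ω h (u + ε • v))
        (r * powerTermDeriv s r Ω h u v) 0 := by
  have hr0 : 0 < r := by linarith
  obtain ⟨C, hC0, hC⟩ := powerTerm_bound hα0 hα2 hαn hΩo hΩb hs0 hsα hh hr0 hr
  have hW := aestronglyMeasurable_weight hΩo hh s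
  have hpm : ∀ {v : Rn n → ℝ} (e : ℝ), AEStronglyMeasurable v volume →
      AEStronglyMeasurable (fun x => |v x| ^ e) (volume.restrict Ω) := fun e hv =>
    (hv.norm.aemeasurable.pow_const e).aestronglyMeasurable.restrict
  have hbound : ∀ (W a b : ℝ), ∀ ε : ℝ, |ε| ≤ 1 →
      ‖W * (r * |a + ε * b| ^ (r - 2) * (a + ε * b) * b)‖ ≤
        r * 2 ^ r * (|W| * |a| ^ r + |W| * |b| ^ r) := by
    intro W a b ε hε
    have h1 : |a + ε * b| ≤ 2 * max |a| |b| := by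
      calc |a + ε * b| ≤ |a| + |ε| * |b| := by rw [← abs_mul]; exact abs_add_le _ _
        _ ≤ |a| + 1 * |b| := by gcongr
        _ ≤ _ := by have := le_max_left |a| |b|; have := le_max_right |a| |b|; linarith
    have hm0 : 0 ≤ max |a| |b| := (abs_nonneg a).trans (le_max_left _ _)
    have h2 : |a + ε * b| ^ (r - 1) * |b| ≤ 2 ^ r * (|a| ^ r + |b| ^ r) := by
      calc |a + ε * b| ^ (r - 1) * |b| ≤ (2 * max |a| |b|) ^ (r - 1) * (2 * max |a| |b|) := by
            gcongr
            have := le_max_right |a| |b|; linarith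
        _ = (2 * max |a| |b|) ^ r := by
            rcases hm0.eq_or_lt with h0 | h0
            · rw [← h0, mul_zero, mul_zero, Real.zero_rpow hr0.ne']
            · rw [Real.rpow_sub_one (by positivity)]; field_simp
        _ = 2 ^ r * max |a| |b| ^ r := Real.mul_rpow (by norm_num) hm0
        _ ≤ _ := by
            gcongr
            rcases le_total |a| |b| with h | h
            · rw [max_eq_right h]; have : 0 ≤ |a| ^ r := by positivity
              linarith
            · rw [max_eq_left h]; have : 0 ≤ |b| ^ r := by positivity
              linarith
    have h3 : ‖W * (r * |a + ε * b| ^ (r - 2) * (a + ε * b) * b)‖ =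
        |W| * (r * (|a + ε * b| ^ (r - 1) * |b|)) := by
      rw [norm_mul, Real.norm_eq_abs, Real.norm_eq_abs, mul_assoc r, abs_mul _ b, abs_mul r,
        abs_rpow_sub_two_mul hr1, abs_of_pos hr0]
      ring
    rw [h3]
    calc _ ≤ |W| * (r * (2 ^ r * (|a| ^ r + |b| ^ r))) := by gcongr
      _ = _ := by ring
  have hB : IntegrableOn (fun x => r * 2 ^ r *
      (|h x / ‖x‖ ^ s| * |u x| ^ r + |h x / ‖x‖ ^ s| * |v x| ^ r)) Ω :=
    (Integrable.add (hC u hu).1 (hC v hv).1).const_mul _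
  have hF : ∀ ε : ℝ, IntegrableOn (fun x => h x / ‖x‖ ^ s * |(u + ε • v) x| ^ r) Ω := by
    intro ε
    have h1 := (hC _ (X0.add_mem hu (X0.smul_mem ε hv))).1
    refine h1.mono' (hW.mul (hpm r (hu.1.1.1.add (hv.1.1.1.const_smul ε))))
      (Eventually.of_forall fun x => ?_)
    rw [norm_mul, Real.norm_eq_abs,
      Real.norm_of_nonneg (by positivity : 0 ≤ |(u + ε • v) x| ^ r)]
  have hF'm : AEStronglyMeasurable
      (fun x => h x / ‖x‖ ^ s * (r * |u x + 0 * v x| ^ (r - 2) * (u x + 0 * v x) * v x))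
      (volume.restrict Ω) := by
    simp only [zero_mul, add_zero]
    exact hW.mul ((((hpm (r - 2) hu.1.1.1).const_mul r).mul hu.1.1.1.restrict).mul
      hv.1.1.1.restrict)
  have main := hasDerivAt_integral_of_dominated_loc_of_deriv_le (𝕜 := ℝ) (μ := volume.restrict Ω)
    (F := fun (ε : ℝ) x => h x / ‖x‖ ^ s * |(u + ε • v) x| ^ r)
    (F' := fun ε x => h x / ‖x‖ ^ s * (r * |u x + ε * v x| ^ (r - 2) * (u x + ε * v x) * v x))
    (x₀ := 0) (s := Metric.ball 0 1) (Metric.ball_mem_nhds 0 one_pos)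
    (Eventually.of_forall fun ε => (hF ε).aestronglyMeasurable) (hF 0) hF'm
    (Eventually.of_forall fun x ε hε => hbound _ _ _ ε (by
      rw [mem_ball_zero_iff, Real.norm_eq_abs] at hε; exact hε.le)) hB
    (Eventually.of_forall fun x ε _ => by
      have h1 : HasDerivAt (fun ε : ℝ => u x + ε * v x) (v x) ε := by
        simpa using ((hasDerivAt_id ε).mul_const (v x)).const_add (u x)
      have h2 := (hasDerivAt_abs_rpow (u x + ε * v x) hr1).comp ε h1
      exact h2.const_mul (h x / ‖x‖ ^ s))
  obtain ⟨h1, h2⟩ := main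
  simp only [zero_mul, add_zero] at h1 h2
  have e : ∀ x, h x / ‖x‖ ^ s * (r * |u x| ^ (r - 2) * u x * v x) =
      r * (h x / ‖x‖ ^ s * (|u x| ^ (r - 2) * u x * v x)) := fun x => by ring
  simp only [e] at h1 h2
  rw [integral_const_mul] at h2
  refine ⟨(h1.const_mul r⁻¹).congr (Eventually.of_forall fun x => ?_), h2⟩
  simp only
  rw [inv_mul_cancel_left₀ hr0.ne']

end FracHardy

namespace FracHardy

variable {n : ℕ} {α : ℝ}

/-! ### Lipschitz test functions -/

/-- An integrable majorant of the Gagliardo kernel of a bounded Lipschitz function. -/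
theorem exists_integrable_lipschitz_kernel (hα0 : 0 < α) (hα2 : α < 2) (hn : 0 < n) (L : ℝ) :
    ∃ K : Rn n → ℝ, Integrable K ∧ (∀ z, 0 ≤ K z) ∧ (∀ z, K (-z) = K z) ∧
      ∀ (z : Rn n) (t : ℝ), |t| ≤ ‖z‖ → |t| ≤ 2 * L → t * t / ‖z‖ ^ ((n : ℝ) + α) ≤ K z := by
  -- Near `0` the Lipschitz bound gives `‖z‖ ^ (2 - n - α)`, integrable because `α < 2`. Far away
  -- the bound `2 L` on the increment leaves the integrable tail `K₂`, where `2 ^ (n + α)` comes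
  -- from `1 + ‖z‖ ≤ 2 ‖z‖`.
  set K₁ : Rn n → ℝ := (Metric.closedBall (0 : Rn n) 1).indicator
    fun z => (‖z‖ ^ ((n : ℝ) + α - 2))⁻¹ with hK₁
  set K₂ : Rn n → ℝ := fun z =>
    (2 * L) ^ 2 * 2 ^ ((n : ℝ) + α) * (1 + ‖z‖) ^ (-((n : ℝ) + α)) with hK₂
  have h1 : Integrable K₁ := by
    rw [hK₁, integrable_indicator_iff Metric.isClosed_closedBall.measurableSet]
    exact integrableOn_norm_rpow hn (by linarith) 1
  have h2 : Integrable K₂ := by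
    refine (integrable_one_add_norm ?_).const_mul _
    rw [finrank_euclideanSpace_fin]; linarith
  have h10 : ∀ z, 0 ≤ K₁ z := fun z => indicator_nonneg (fun z _ => by positivity) z
  have h20 : ∀ z, 0 ≤ K₂ z := fun z => by simp only [hK₂]; positivity
  refine ⟨fun z => K₁ z + K₂ z, h1.add h2, fun z => add_nonneg (h10 z) (h20 z), fun z => ?_,
    fun z t ht ht' => ?_⟩
  · simp [hK₁, hK₂, indicator]
  by_cases hz0 : z = 0
  · have : t = 0 := by simpa [hz0] using ht
    rw [this]; simpa using add_nonneg (h10 z) (h20 z)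
  have hz : 0 < ‖z‖ := norm_pos_iff.2 hz0
  have htt : t * t ≤ ‖z‖ ^ 2 := by rw [← abs_mul_abs_self, ← pow_two]; gcongr
  have htt' : t * t ≤ (2 * L) ^ 2 := by rw [← abs_mul_abs_self, ← pow_two]; gcongr
  by_cases hz1 : ‖z‖ ≤ 1
  · refine le_trans ?_ (le_add_of_nonneg_right (h20 z))
    rw [hK₁, indicator_of_mem (by simpa using hz1), Real.rpow_sub hz, inv_div]
    gcongr
    simpa using htt
  · refine le_trans ?_ (le_add_of_nonneg_left (h10 z))
    simp only [hK₂]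
    rw [Real.rpow_neg (by positivity), ← div_eq_mul_inv, div_le_div_iff₀ (by positivity)
      (by positivity)]
    have : (1 + ‖z‖) ^ ((n : ℝ) + α) ≤ 2 ^ ((n : ℝ) + α) * ‖z‖ ^ ((n : ℝ) + α) := by
      rw [← Real.mul_rpow (by norm_num) hz.le]
      gcongr
      linarith
    calc _ ≤ (2 * L) ^ 2 * (2 ^ ((n : ℝ) + α) * ‖z‖ ^ ((n : ℝ) + α)) := by gcongr
      _ = _ := by ring

/-- The increment vanishes unless one of the two points lies in the ball of radius `R`, so the
Gagliardo integrand is at most `(χ(x) + χ(y)) K(x - y)` with `χ` the indicator of that ball. This is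
a sum of integrable convolution integrands. -/
theorem MemH.of_lipschitz (hα0 : 0 < α) (hα2 : α < 2) (hn : 0 < n) {φ : Rn n → ℝ} {L R : ℝ}
    (hLip : ∀ x y, |φ x - φ y| ≤ ‖x - y‖) (hb : ∀ x, |φ x| ≤ L)
    (hs : ∀ x, R < ‖x‖ → φ x = 0) : MemH α φ := by
  have hcont : Continuous φ := LipschitzWith.continuous (K := 1)
    (LipschitzWith.of_dist_le_mul fun x y => by
      rw [Real.dist_eq, dist_eq_norm]; simpa using hLip x y)
  have hφm := hcont.aestronglyMeasurable (μ := (volume : Measure (Rn n)))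
  refine ⟨(memLp_two_iff_integrable_sq hφm).2
    (integrable_of_bounded_support (C := L ^ 2) (R := R) (hφm.pow 2)
      (fun x => by rw [abs_pow]; have := hb x; gcongr) fun x hx => by simp [hs x hx]), ?_⟩
  obtain ⟨K, hK, hK0, hKe, hKb⟩ := exists_integrable_lipschitz_kernel hα0 hα2 hn L
  set χ : Rn n → ℝ := (Metric.closedBall (0 : Rn n) R).indicator fun _ => 1 with hχ
  have hχi : Integrable χ := by
    rw [hχ, integrable_indicator_iff Metric.isClosed_closedBall.measurableSet]
    exact integrableOn_const measure_closedBall_lt_top.ne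
  have hχ0 : ∀ x, 0 ≤ χ x := fun x => indicator_nonneg (fun _ _ => zero_le_one) x
  have hχ1 : ∀ x, φ x ≠ 0 → χ x = 1 := fun x hx => by
    rw [hχ, indicator_of_mem]
    rw [mem_closedBall_zero_iff]
    by_contra h
    exact hx (hs x (not_le.1 h))
  have i1 := hχi.convolution_integrand (ContinuousLinearMap.mul ℝ ℝ) hK (μ := volume)
  have i2 := i1.swap
  have i := i1.add i2
  simp only [ContinuousLinearMap.mul_apply'] at i
  rw [Measure.volume_eq_prod]
  refine i.mono' (by
    rw [← Measure.volume_eq_prod]; exact aestronglyMeasurable_gagliardoIntegrand hφm hφm)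
    (Eventually.of_forall fun z => ?_)
  rw [Real.norm_of_nonneg (gagliardoIntegrand_self_nonneg φ z)]
  simp only [Pi.add_apply, Function.comp, Prod.fst_swap, Prod.snd_swap]
  have hk : gagliardoIntegrand α φ φ z ≤ K (z.1 - z.2) := by
    refine hKb _ _ (hLip _ _) ?_
    have := abs_sub (φ z.1) (φ z.2)
    linarith [hb z.1, hb z.2]
  have hk' : K (z.2 - z.1) = K (z.1 - z.2) := by rw [← neg_sub, hKe]
  rw [hk']
  by_cases h1 : φ z.1 = 0
  · by_cases h2 : φ z.2 = 0
    · have : gagliardoIntegrand α φ φ z = 0 := by simp [gagliardoIntegrand, h1, h2]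
      rw [this]
      have := hK0 (z.1 - z.2)
      have := hχ0 z.1
      have := hχ0 z.2
      positivity
    · rw [hχ1 _ h2]
      have := mul_nonneg (hχ0 z.1) (hK0 (z.1 - z.2))
      linarith
  · rw [hχ1 _ h1]
    have := mul_nonneg (hχ0 z.2) (hK0 (z.1 - z.2))
    linarith

/-- The distance to the complement of an open subset of `Ω` is a test function. -/
theorem infDist_compl_mem_X0 (hα0 : 0 < α) (hα2 : α < 2) (hn : 0 < n) {Ω U : Set (Rn n)}
    (hΩo : IsOpen Ω) (hΩb : Bornology.IsBounded Ω) (hU : U ⊆ Ω) :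
    (fun x => Metric.infDist x Uᶜ) ∈ X0 α Ω ∧ ∃ L, ∀ x, Metric.infDist x Uᶜ ≤ L := by
  have : Nonempty (Fin n) := ⟨⟨0, hn⟩⟩
  obtain ⟨R, hR⟩ := (hΩb.subset hU).subset_closedBall (0 : Rn n)
  obtain ⟨y, hy⟩ : ∃ y : Rn n, max R 0 < ‖y‖ := NormedSpace.exists_lt_norm ℝ (Rn n) _
  have hyU : y ∈ Uᶜ := fun h => by
    have := mem_closedBall_zero_iff.1 (hR h)
    exact absurd ((le_max_left R 0).trans_lt hy) (not_lt.2 this)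
  have h0 : ∀ x, x ∉ U → Metric.infDist x Uᶜ = 0 := fun x hx => Metric.infDist_zero_of_mem hx
  have hb : ∀ x, Metric.infDist x Uᶜ ≤ max R 0 + ‖y‖ := fun x => by
    by_cases hx : x ∈ U
    · calc _ ≤ dist x y := Metric.infDist_le_dist_of_mem hyU
        _ ≤ ‖x‖ + ‖y‖ := by rw [dist_eq_norm]; exact norm_sub_le _ _
        _ ≤ _ := by gcongr; exact (mem_closedBall_zero_iff.1 (hR hx)).trans (le_max_left _ _)
    · rw [h0 x hx]; positivity
  refine ⟨⟨MemH.of_lipschitz hα0 hα2 hn (L := max R 0 + ‖y‖) (R := R) (fun x z => ?_)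
    (fun x => ?_) (fun x hx => ?_), ?_⟩, _, hb⟩
  · have := (Metric.lipschitz_infDist_pt Uᶜ).dist_le_mul x z
    rwa [NNReal.coe_one, one_mul, Real.dist_eq, dist_eq_norm] at this
  · rw [abs_of_nonneg Metric.infDist_nonneg]; exact hb x
  · exact h0 x fun h => absurd hx (not_lt.2 (mem_closedBall_zero_iff.1 (hR h)))
  · exact (ae_restrict_iff' hΩo.measurableSet.compl).2
      (Eventually.of_forall fun x hx => h0 x fun h => hx (hU h))

/-- By continuity `h` is positive on a ball contained in `Ω`, and the distance to the complement of
that ball is a test function supported where `h > 0`. -/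
theorem exists_powerTerm_pos (hα0 : 0 < α) (hα2 : α < 2) (hαn : α < n) {Ω : Set (Rn n)}
    (hΩo : IsOpen Ω) (hΩb : Bornology.IsBounded Ω) {s r : ℝ} (hs0 : 0 ≤ s) (hsα : s < α)
    (hr0 : 0 < r) (hr : r ≤ critExp n α s) {h : Rn n → ℝ} (hh : ContinuousOn h (closure Ω))
    (hpos : ∃ x ∈ closure Ω, 0 < h x) : ∃ u ∈ X0 α Ω, 0 < powerTerm s r Ω h u := by
  have hn := pos_of_lt_dim hα0 hαn
  have : Nonempty (Fin n) := ⟨⟨0, hn⟩⟩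
  obtain ⟨x₀, hx₀, hhx₀⟩ := hpos
  obtain ⟨x₁, hx₁, hhx₁⟩ : ∃ x ∈ Ω, 0 < h x := by
    have h1 : ∀ᶠ x in 𝓝[closure Ω] x₀, 0 < h x := (hh x₀ hx₀).eventually (lt_mem_nhds hhx₀)
    have h2 : ∀ᶠ x in 𝓝[Ω] x₀, 0 < h x := h1.filter_mono (nhdsWithin_mono _ subset_closure)
    have : (𝓝[Ω] x₀).NeBot := mem_closure_iff_nhdsWithin_neBot.1 hx₀
    obtain ⟨x, hx, hx'⟩ := (h2.and self_mem_nhdsWithin).exists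
    exact ⟨x, hx', hx⟩
  have hev : ∀ᶠ x in 𝓝 x₁, 0 < h x ∧ x ∈ Ω :=
    (((hh.continuousAt (mem_of_superset (hΩo.mem_nhds hx₁) subset_closure))).eventually
      (lt_mem_nhds hhx₁)).and (hΩo.mem_nhds hx₁)
  obtain ⟨δ, hδ, hball⟩ := Metric.eventually_nhds_iff_ball.1 hev
  set U := Metric.ball x₁ δ with hU
  have hUΩ : U ⊆ Ω := fun x hx => (hball x hx).2
  obtain ⟨hφ, L, hL⟩ := infDist_compl_mem_X0 hα0 hα2 hn hΩo hΩb hUΩ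
  set φ : Rn n → ℝ := fun x => Metric.infDist x Uᶜ with hφdef
  have hφU : ∀ x ∈ U, 0 < φ x := fun x hx => by
    refine (Metric.isOpen_ball.isClosed_compl.notMem_iff_infDist_pos ?_).1 (fun h => h hx)
    by_contra hne
    rw [not_nonempty_iff_eq_empty, compl_empty_iff] at hne
    exact NormedSpace.unbounded_univ ℝ (Rn n) (hne ▸ Metric.isBounded_ball)
  have hφ0 : ∀ x, x ∉ U → φ x = 0 := fun x hx => Metric.infDist_zero_of_mem hx
  refine ⟨φ, hφ, ?_⟩
  obtain ⟨C, -, hC⟩ := powerTerm_bound hα0 hα2 hαn hΩo hΩb hs0 hsα hh hr0 hr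
  have hInt : IntegrableOn (fun x => h x / ‖x‖ ^ s * |φ x| ^ r) Ω := by
    refine (hC φ hφ).1.mono' ((aestronglyMeasurable_weight hΩo hh s).mul
      (hφ.1.1.1.norm.aemeasurable.pow_const r).aestronglyMeasurable.restrict)
      (Eventually.of_forall fun x => ?_)
    rw [norm_mul, Real.norm_eq_abs, Real.norm_of_nonneg (by positivity : 0 ≤ |φ x| ^ r)]
  have hnn : ∀ x, 0 ≤ h x / ‖x‖ ^ s * |φ x| ^ r := fun x => by
    by_cases hx : x ∈ U
    · have := (hball x hx).1; positivity
    · rw [hφ0 x hx, abs_zero, Real.zero_rpow hr0.ne', mul_zero]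
  unfold powerTerm
  rw [setIntegral_pos_iff_support_of_nonneg_ae (Eventually.of_forall hnn) hInt]
  -- The origin is removed because for `s > 0` the weight `h x / ‖x‖ ^ s` is `0` there by
  -- convention.
  have hsub : U \ {0} ⊆
      (Function.support fun x => h x / ‖x‖ ^ s * |φ x| ^ r) ∩ Ω := fun x hx => by
    refine ⟨ne_of_gt ?_, hUΩ hx.1⟩
    have h1 := (hball x hx.1).1
    have h2 : 0 < ‖x‖ := norm_pos_iff.2 hx.2
    have h3 := hφU x hx.1
    positivity
  refine lt_of_lt_of_le ?_ (measure_mono hsub)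
  rw [measure_sdiff_null (measure_singleton 0)]
  exact Metric.measure_ball_pos _ _ hδ

/-! ### Absolute values -/

theorem X0.abs_mem {Ω : Set (Rn n)} {u : Rn n → ℝ} (hu : u ∈ X0 α Ω) :
    (fun x => |u x|) ∈ X0 α Ω ∧
      gagliardo α (fun x => |u x|) (fun x => |u x|) ≤ gagliardo α u u := by
  obtain ⟨h1, h2⟩ := hu.1.of_le (v := fun x => |u x|) hu.1.1.1.norm
    (fun x => by rw [abs_abs]) (fun x y => abs_abs_sub_abs_le_abs_sub _ _)
  exact ⟨⟨h1, hu.2.mono fun x hx => by simp [hx]⟩, h2⟩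

theorem normSq_abs_le (hα0 : 0 < α) (hα2 : α < 2) (γ : ℝ) {Ω : Set (Rn n)} {u : Rn n → ℝ}
    (hu : u ∈ X0 α Ω) : normSq α γ Ω (fun x => |u x|) ≤ normSq α γ Ω u := by
  unfold normSq
  simp only [abs_abs]
  have := (cConst_pos (n := n) hα0 hα2).le
  have := (X0.abs_mem hu).2
  gcongr

/-! ### The strong maximum principle -/

/-- The truncation `φ (1 - k u)⁺` is a test function. -/
theorem X0.truncation_mem {Ω : Set (Rn n)} {u φ : Rn n → ℝ} {L k : ℝ} (hk : 0 ≤ k)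
    (hu : u ∈ X0 α Ω) (hu0 : ∀ x, 0 ≤ u x) (hφ : φ ∈ X0 α Ω) (hφ0 : ∀ x, 0 ≤ φ x)
    (hφL : ∀ x, φ x ≤ L) : (fun x => φ x * max (1 - k * u x) 0) ∈ X0 α Ω := by
  have hψ0 : ∀ x, 0 ≤ max (1 - k * u x) 0 := fun x => le_max_right _ _
  have hψ1 : ∀ x, max (1 - k * u x) 0 ≤ 1 := fun x =>
    max_le (by have := mul_nonneg hk (hu0 x); linarith) zero_le_one
  have hm : AEStronglyMeasurable (fun x => φ x * max (1 - k * u x) 0) volume :=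
    hφ.1.1.1.mul ((aestronglyMeasurable_const.sub (hu.1.1.1.const_mul k)).sup
      aestronglyMeasurable_const)
  refine ⟨⟨hφ.1.1.mono hm (Eventually.of_forall fun x => ?_), ?_⟩,
    hφ.2.mono fun x hx => by simp [hx]⟩
  · rw [norm_mul, Real.norm_of_nonneg (hψ0 x)]
    exact mul_le_of_le_one_right (norm_nonneg _) (hψ1 x)
  refine ((hφ.1.2.const_mul 2).add (hu.1.2.const_mul (2 * (L * k) ^ 2))).mono'
    (aestronglyMeasurable_gagliardoIntegrand hm hm) (Eventually.of_forall fun z => ?_)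
  rw [Real.norm_of_nonneg (gagliardoIntegrand_self_nonneg _ z)]
  simp only [gagliardoIntegrand, Pi.add_apply]
  rw [← mul_div_assoc, ← mul_div_assoc, ← add_div]
  gcongr ?_ / _
  set a := max (1 - k * u z.1) 0
  set b := max (1 - k * u z.2) 0
  have hab : |a - b| ≤ k * |u z.1 - u z.2| := by
    have h1 : |a - b| ≤ |(1 - k * u z.1) - (1 - k * u z.2)| := abs_max_sub_max_le_abs _ _ _
    have h2 : (1 - k * u z.1) - (1 - k * u z.2) = -(k * (u z.1 - u z.2)) := by ring
    rwa [h2, abs_neg, abs_mul, abs_of_nonneg hk] at h1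
  have h3 : |φ z.1 * a - φ z.2 * b| ≤ |φ z.1 - φ z.2| + L * k * |u z.1 - u z.2| := by
    have : φ z.1 * a - φ z.2 * b = (φ z.1 - φ z.2) * b + φ z.1 * (a - b) := by ring
    rw [this]
    refine (abs_add_le _ _).trans ?_
    rw [abs_mul, abs_mul, abs_of_nonneg (hψ0 z.2 : 0 ≤ b), abs_of_nonneg (hφ0 z.1), mul_assoc]
    have hL0 : 0 ≤ L := (hφ0 z.1).trans (hφL z.1)
    refine add_le_add (mul_le_of_le_one_right (abs_nonneg _) (hψ1 z.2)) ?_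
    exact mul_le_mul (hφL z.1) hab (abs_nonneg _) hL0
  have h4 := abs_mul_abs_self (φ z.1 * a - φ z.2 * b)
  have h5 := abs_mul_abs_self (φ z.1 - φ z.2)
  have h6 := abs_mul_abs_self (u z.1 - u z.2)
  have h7 := mul_self_le_mul_self (abs_nonneg _) h3
  nlinarith [sq_nonneg (|φ z.1 - φ z.2| - L * k * |u z.1 - u z.2|)]

end FracHardy

/-! ### Limits of truncated test functions and positivity of solutions. -/

namespace FracHardy

variable {n : ℕ} {α : ℝ}

theorem tendsto_truncation {a : ℝ} (ha : 0 ≤ a) (c : ℝ) :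
    Tendsto (fun k : ℕ => c * max (1 - (k : ℝ) * a) 0) atTop (𝓝 (if a = 0 then c else 0)) := by
  split_ifs with h
  · simp [h]
  · have ha : 0 < a := lt_of_le_of_ne ha (Ne.symm h)
    refine tendsto_const_nhds.congr' ?_
    filter_upwards [(tendsto_natCast_atTop_atTop (R := ℝ)).eventually_ge_atTop (1 / a)] with k hk
    rw [div_le_iff₀ ha] at hk
    rw [max_eq_right (by linarith), mul_zero]

/-- The truncated test functions concentrate on `{u = 0}`, where `A` vanishes. This applies to the
local terms of the weak equation. -/
theorem tendsto_setIntegral_mul_truncation {Ω : Set (Rn n)} {A u φ : Rn n → ℝ}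
    (hu0 : ∀ x, 0 ≤ u x) (hA0 : ∀ x, u x = 0 → A x = 0)
    (hφ : IntegrableOn (fun x => A x * φ x) Ω)
    (hInt : ∀ k : ℕ, IntegrableOn (fun x => A x * (φ x * max (1 - (k : ℝ) * u x) 0)) Ω) :
    Tendsto (fun k : ℕ => ∫ x in Ω, A x * (φ x * max (1 - (k : ℝ) * u x) 0)) atTop (𝓝 0) := by
  have h := tendsto_integral_of_dominated_convergence (μ := volume.restrict Ω)
    (F := fun (k : ℕ) x => A x * (φ x * max (1 - (k : ℝ) * u x) 0)) (f := fun _ => 0)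
    (fun x => ‖A x * φ x‖) (fun k => (hInt k).aestronglyMeasurable) hφ.norm
    (fun k => Eventually.of_forall fun x => by
      rw [← mul_assoc, norm_mul, Real.norm_of_nonneg (le_max_right _ _)]
      refine mul_le_of_le_one_right (norm_nonneg _) (max_le ?_ zero_le_one)
      have := mul_nonneg (Nat.cast_nonneg (α := ℝ) k) (hu0 x)
      linarith)
    (Eventually.of_forall fun x => by
      by_cases hx : u x = 0
      · simp [hA0 x hx]
      · simpa [hx] using (tendsto_truncation (hu0 x) (φ x)).const_mul (A x))
  simpa using h

/-- With `A`, `B` the truncation factors, `cA - dB = c (A - B) + (c - d) B`, and `(a - b)(A - B) ≤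
0` because the truncation is decreasing. The resulting bound does not depend on `k`, which is what
Fatou's lemma needs for the negative of the Gagliardo integrand. -/
theorem truncation_product_bound {a b c d k : ℝ} (hk : 0 ≤ k) (hb : 0 ≤ b) (hc : 0 ≤ c) :
    (a - b) * (c * max (1 - k * a) 0 - d * max (1 - k * b) 0) ≤ |(a - b) * (c - d)| := by
  set A := max (1 - k * a) 0
  set B := max (1 - k * b) 0
  have hB0 : 0 ≤ B := le_max_right _ _
  have hB1 : B ≤ 1 := max_le (by have := mul_nonneg hk hb; linarith) zero_le_one
  have h1 : (a - b) * (A - B) ≤ 0 := by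
    rcases le_total a b with h | h
    · have : B ≤ A := max_le_max (by have := mul_le_mul_of_nonneg_left h hk; linarith) le_rfl
      nlinarith
    · have : A ≤ B := max_le_max (by have := mul_le_mul_of_nonneg_left h hk; linarith) le_rfl
      nlinarith
  have h2 : (a - b) * (c - d) * B ≤ |(a - b) * (c - d)| := by
    calc _ ≤ |(a - b) * (c - d)| * B := by gcongr; exact le_abs_self _
      _ ≤ _ := mul_le_of_le_one_right (abs_nonneg _) hB1
  calc _ = c * ((a - b) * (A - B)) + (a - b) * (c - d) * B := by ring
    _ ≤ 0 + |(a - b) * (c - d)| := add_le_add (mul_nonpos_of_nonneg_of_nonpos hc h1) h2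
    _ = _ := zero_add _

/-- Nonnegative weak solutions are positive or trivial. -/
theorem IsWeakSolution.pos (hα0 : 0 < α) (hα2 : α < 2) (hαn : α < n) {Ω : Set (Rn n)}
    (hΩo : IsOpen Ω) (hΩb : Bornology.IsBounded Ω) {s q p γ lam : ℝ} {f g u : Rn n → ℝ}
    (hsol : IsWeakSolution α s q p γ lam Ω f g u) (hu0 : ∀ x, 0 ≤ u x)
    (hne : ¬ u =ᵐ[volume] 0) : ∀ᵐ x ∂(volume.restrict Ω), 0 < u x := by
  obtain ⟨hu, hweak⟩ := hsol
  have hn := pos_of_lt_dim hα0 hαn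
  have : Nonempty (Fin n) := ⟨⟨0, hn⟩⟩
  have hc := cConst_pos (n := n) hα0 hα2
  obtain ⟨hφ, L, hφL⟩ := infDist_compl_mem_X0 hα0 hα2 hn hΩo hΩb (subset_refl Ω)
  have hφΩ : ∀ x ∈ Ω, 0 < Metric.infDist x Ωᶜ := fun x hx => by
    refine (hΩo.isClosed_compl.notMem_iff_infDist_pos ?_).1 (fun h => h hx)
    by_contra hne
    rw [not_nonempty_iff_eq_empty, compl_empty_iff] at hne
    exact NormedSpace.unbounded_univ ℝ (Rn n) (hne ▸ hΩb)
  have hφ0 : ∀ x, 0 ≤ Metric.infDist x Ωᶜ := fun x => Metric.infDist_nonneg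
  set φ : Rn n → ℝ := fun x => Metric.infDist x Ωᶜ with hφdef
  set v : ℕ → Rn n → ℝ := fun k x => φ x * max (1 - (k : ℝ) * u x) 0 with hv
  have hvX : ∀ k, v k ∈ X0 α Ω := fun k =>
    X0.truncation_mem (Nat.cast_nonneg k) hu hu0 hφ hφ0 hφL
  have e1 : ∀ w : Rn n → ℝ, (fun x => u x * w x / ‖x‖ ^ α) = fun x => u x / ‖x‖ ^ α * w x :=
    fun w => by ext x; ring
  have e3 : ∀ w : Rn n → ℝ, (fun x => g x * (|u x| ^ (p - 2) * u x * w x / ‖x‖ ^ s)) =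
      fun x => g x * (|u x| ^ (p - 2) * u x / ‖x‖ ^ s) * w x := fun w => by ext x; ring
  simp only [e1, e3] at hweak
  -- The potential and both nonlinear terms disappear in the limit, so the equation forces the
  -- nonlocal term to disappear as well.
  have hlim : Tendsto (fun k => gagliardo α u (v k)) atTop (𝓝 0) := by
    have t1 := tendsto_setIntegral_mul_truncation (A := fun x => u x / ‖x‖ ^ α) (φ := φ) hu0
      (fun x hx => by simp [hx]) (hweak φ hφ).1 (fun k => (hweak (v k) (hvX k)).1)
    have t2 := tendsto_setIntegral_mul_truncation (A := fun x => f x * |u x| ^ (q - 2) * u x)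
      (φ := φ) hu0 (fun x hx => by simp [hx]) (hweak φ hφ).2.1
      (fun k => (hweak (v k) (hvX k)).2.1)
    have t3 := tendsto_setIntegral_mul_truncation
      (A := fun x => g x * (|u x| ^ (p - 2) * u x / ‖x‖ ^ s)) (φ := φ) hu0
      (fun x hx => by simp [hx]) (hweak φ hφ).2.2.1 (fun k => (hweak (v k) (hvX k)).2.2.1)
    have t := (((t1.const_mul γ).add (t2.const_mul lam)).add t3).const_mul (cConst n α)⁻¹
    simp only [mul_zero, add_zero] at t
    refine t.congr fun k => ?_
    have := (hweak (v k) (hvX k)).2.2.2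
    rw [inv_mul_eq_iff_eq_mul₀ hc.ne']
    linarith
  -- The limit of the test functions. As `u w = 0` pointwise, the numerator of the Gagliardo
  -- integrand of `u` and `w` is `-(u(x) w(y) + u(y) w(x)) ≤ 0`.
  set w : Rn n → ℝ := fun x => if u x = 0 then φ x else 0 with hw
  have hI := integrable_gagliardoIntegrand hu.1 hφ.1
  have hIk := fun k => integrable_gagliardoIntegrand hu.1 (hvX k).1
  have hnn : ∀ z, 0 ≤ -gagliardoIntegrand α u w z := fun z => by
    unfold gagliardoIntegrand
    rw [← neg_div]
    refine div_nonneg ?_ (by positivity)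
    have h1 := hu0 z.1
    have h2 := hu0 z.2
    have h3 := hφ0 z.1
    have h4 := hφ0 z.2
    by_cases a : u z.1 = 0 <;> by_cases b : u z.2 = 0 <;> simp [hw, a, b] <;> positivity
  have key : ∀ ε > 0, Integrable (fun z => -gagliardoIntegrand α u w z +
        |gagliardoIntegrand α u φ z|) ∧
      ∫ z, (-gagliardoIntegrand α u w z + |gagliardoIntegrand α u φ z|) ≤
        ε + ∫ z, |gagliardoIntegrand α u φ z| := by
    intro ε hε
    obtain ⟨N, hN⟩ := eventually_atTop.1 (hlim.eventually (lt_mem_nhds (neg_lt_zero.2 hε)))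
    refine integral_le_of_tendsto
      (f := fun k z => -gagliardoIntegrand α u (v (k + N)) z + |gagliardoIntegrand α u φ z|)
      (fun k => (hIk (k + N)).neg.add hI.abs) (fun k => Eventually.of_forall fun z => ?_)
      (Eventually.of_forall fun z => ?_) (fun k => ?_)
    · have h1 := truncation_product_bound (k := ((k + N : ℕ) : ℝ)) (a := u z.1) (d := φ z.2)
        (Nat.cast_nonneg _) (hu0 z.2) (hφ0 z.1)
      simp only [gagliardoIntegrand, Pi.zero_apply, abs_div,
        abs_of_nonneg (by positivity : 0 ≤ ‖z.1 - z.2‖ ^ ((n : ℝ) + α))]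
      rw [← neg_div, ← add_div]
      refine div_nonneg ?_ (by positivity)
      simp only [hv]
      linarith
    · have h1 : ∀ x, Tendsto (fun k => v (k + N) x) atTop (𝓝 (w x)) := fun x =>
        (tendsto_truncation (hu0 x) (φ x)).comp (tendsto_add_atTop_nat N)
      exact ((((h1 z.1).sub (h1 z.2)).const_mul _).div_const _).neg.add_const _
    · rw [integral_add (f := fun z => -gagliardoIntegrand α u (v (k + N)) z) (hIk (k + N)).neg
        hI.abs, integral_neg]
      have := hN (k + N) (Nat.le_add_left _ _)
      unfold gagliardo at this
      linarith
  have hwi : Integrable fun z => -gagliardoIntegrand α u w z := by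
    refine ((key 1 one_pos).1.sub hI.abs).congr (Eventually.of_forall fun z => ?_)
    simp
  have hle : ∫ z, -gagliardoIntegrand α u w z ≤ 0 := by
    refine le_of_forall_pos_le_add fun ε hε => ?_
    have := (key ε hε).2
    rw [integral_add hwi hI.abs] at this
    linarith
  -- Hence `u(y) w(x) = 0` for almost every pair. By nonlocality a single generic zero `x ∈ Ω` of
  -- `u`, where `w(x) = φ(x) > 0`, already forces `u = 0` a.e.
  have hzero : ∀ᵐ z, -gagliardoIntegrand α u w z = 0 :=
    (integral_eq_zero_iff_of_nonneg hnn hwi).1 (le_antisymm hle (integral_nonneg hnn))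
  rw [Measure.volume_eq_prod] at hzero
  refine (ae_restrict_iff' hΩo.measurableSet).2 ?_
  filter_upwards [Measure.ae_ae_of_ae_prod hzero] with x hx hxΩ
  by_contra hux
  have hux : u x = 0 := le_antisymm (not_lt.1 hux) (hu0 x)
  refine hne ?_
  filter_upwards [hx] with y hy
  by_contra huy
  have hxy : 0 < ‖x - y‖ := norm_pos_iff.2 (sub_ne_zero.2 fun h => huy (by rw [← h, hux]; rfl))
  have huy' : u y ≠ 0 := huy
  have h1 : ‖x - y‖ ^ ((n : ℝ) + α) ≠ 0 := by positivity
  simp only [gagliardoIntegrand, hw, hux, huy', if_true, if_false, zero_sub, sub_zero, neg_mul,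
    neg_div, neg_neg, div_eq_zero_iff, mul_eq_zero, h1, or_false, false_or] at hy
  exact (hφΩ x hxΩ).ne' hy

end FracHardy

namespace FracHardy

variable {n : ℕ} {α : ℝ}

/-! ### The two solutions -/

/-- `X₀^{α/2}(Ω)` as a vector space. -/
def X0Submodule (α : ℝ) (Ω : Set (Rn n)) : Submodule ℝ (Rn n → ℝ) where
  carrier := X0 α Ω
  add_mem' := X0.add_mem
  zero_mem' := ⟨MemH.zero, Eventually.of_forall fun _ => rfl⟩
  smul_mem' c _ := X0.smul_mem c

theorem exists_powerTerm_bound_normSq (hα0 : 0 < α) (hα2 : α < 2) (hαn : α < n) {Ω : Set (Rn n)}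
    (hΩo : IsOpen Ω) (hΩb : Bornology.IsBounded Ω) {s r γ : ℝ} (hs0 : 0 ≤ s) (hsα : s < α)
    (hr0 : 0 < r) (hr : r ≤ critExp n α s) (hγ : γ < gammaH n α) {h : Rn n → ℝ}
    (hh : ContinuousOn h (closure Ω)) :
    ∃ c, ∀ u ∈ X0 α Ω, |powerTerm s r Ω h u| ≤ c * normSq α γ Ω u ^ (r / 2) := by
  obtain ⟨κ, hκ, hcoer⟩ := normSq_coercive hα0 hα2 hαn hΩo hΩb hγ
  obtain ⟨C, hC0, hC⟩ := abs_powerTerm_le hα0 hα2 hαn hΩo hΩb hs0 hsα hh hr0 hr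
  refine ⟨C * (κ⁻¹) ^ (r / 2), fun u hu => (hC u hu).trans ?_⟩
  have h0 := gagliardo_self_nonneg (α := α) u
  have h1 : gagliardo α u u ≤ κ⁻¹ * normSq α γ Ω u := by
    rw [inv_mul_eq_div, le_div_iff₀ hκ, mul_comm]; exact hcoer u hu
  have h2 : 0 ≤ normSq α γ Ω u := (mul_nonneg hκ.le h0).trans (hcoer u hu)
  rw [mul_assoc, ← Real.mul_rpow (by positivity) h2]
  gcongr

/-- The link between the analysis and the abstract scheme. The concave term is the case of weight
exponent `0`, where `q < 2 < 2n/(n - α)` is subcritical. -/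
theorem concaveConvex_X0 (hα0 : 0 < α) (hα2 : α < 2) (hαn : α < n) {Ω : Set (Rn n)}
    (hΩo : IsOpen Ω) (hΩb : Bornology.IsBounded Ω) {s q p γ : ℝ} (hs0 : 0 ≤ s) (hsα : s < α)
    (hq1 : 1 < q) (hq2 : q < 2) (hp2 : 2 < p) (hp : p < critExp n α s) (hγ : γ < gammaH n α)
    {f g : Rn n → ℝ} (hf : ContinuousOn f (closure Ω)) (hg : ContinuousOn g (closure Ω))
    (hfpos : ∃ x ∈ closure Ω, 0 < f x) (hgpos : ∃ x ∈ closure Ω, 0 < g x) :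
    ConcaveConvex (V := X0Submodule α Ω) q p (fun u => normSq α γ Ω u)
      (fun u => powerTerm 0 q Ω f u) (fun u => powerTerm s p Ω g u)
      (fun u v => normForm α γ Ω u v) (fun u v => powerTermDeriv 0 q Ω f u v)
      (fun u v => powerTermDeriv s p Ω g u v)
      (fun u => ⟨fun x => |u.1 x|, (X0.abs_mem u.2).1⟩) := by
  have hq0 : 0 < q := by linarith
  have hp0 : 0 < p := by linarith
  have hqc : q < critExp n α 0 := by
    unfold critExp
    rw [lt_div_iff₀ (by linarith)]
    nlinarith
  obtain ⟨κ, hκ, hcoer⟩ := normSq_coercive hα0 hα2 hαn hΩo hΩb hγ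
  have hadd := fun (u v : X0Submodule α Ω) (ε : ℝ) =>
    normSq_add_smul hα0 hα2 hαn hΩo hΩb γ u.2 v.2 ε
  exact
  { one_lt_q := hq1
    q_lt_two := hq2
    two_lt_p := hp2
    Q_nonneg := fun u => (mul_nonneg hκ.le (gagliardo_self_nonneg _)).trans (hcoer u u.2)
    Q_smul := fun t u => by
      simp only [← normForm_self, normForm, Submodule.coe_smul]
      have h1 : ∫ x in Ω, (t • u.1) x * (t • u.1) x / ‖x‖ ^ α =
          t ^ 2 * ∫ x in Ω, u.1 x * u.1 x / ‖x‖ ^ α := by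
        rw [← integral_const_mul]
        congr 1; ext x
        simp only [Pi.smul_apply, smul_eq_mul]; ring
      rw [h1, gagliardo_smul]; ring
    Q_add := hadd
    B_self := fun u => normForm_self γ Ω u
    F_smul := fun t u ht => powerTerm_smul ht Ω f u
    G_smul := fun t u ht => powerTerm_smul ht Ω g u
    F_bound := by
      obtain ⟨c, hc⟩ := exists_powerTerm_bound_normSq hα0 hα2 hαn hΩo hΩb le_rfl hα0 hq0 hqc.le
        hγ hf
      exact ⟨c, fun u => hc u u.2⟩
    G_bound := by
      obtain ⟨c, hc⟩ := exists_powerTerm_bound_normSq hα0 hα2 hαn hΩo hΩb hs0 hsα hp0 hp.le hγ hg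
      exact ⟨c, fun u => hc u u.2⟩
    F_deriv := fun u v => (integrableOn_powerTermDeriv hα0 hα2 hαn hΩo hΩb le_rfl hα0 hf hq1 hqc.le
      u.2 v.2).2
    G_deriv := fun u v => (integrableOn_powerTermDeriv hα0 hα2 hαn hΩo hΩb hs0 hsα hg
      (by linarith) hp.le u.2 v.2).2
    dF_self := fun u => powerTermDeriv_self hq1 Ω f u
    dG_self := fun u => powerTermDeriv_self (by linarith) Ω g u
    compact := fun u M hM => by
      have hM' : ∀ k, gagliardo α (u k).1 (u k).1 ≤ M / κ := fun k => by
        rw [le_div_iff₀ hκ, mul_comm]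
        exact (hcoer _ (u k).2).trans (hM k)
      obtain ⟨w, σ, hσ, hlim⟩ := X0.exists_ae_subseq hα0 hα2 hαn hΩo hΩb (fun k => (u k).2) hM'
      have hu := fun k => (u (σ k)).2
      have hMσ := fun k => hM' (σ k)
      exact ⟨⟨w, (X0.mem_of_tendsto hα0 hα2 hαn hΩo hΩb hu hMσ hlim).1⟩, σ, hσ,
        tendsto_powerTerm hα0 hα2 hαn hΩo hΩb le_rfl hα0 hf hq0 hqc hu hMσ hlim,
        tendsto_powerTerm hα0 hα2 hαn hΩo hΩb hs0 hsα hg hp0 hp hu hMσ hlim,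
        normSq_lsc hα0 hα2 hαn hΩo hΩb hγ hu hMσ hlim⟩
    Q_abs := fun u => normSq_abs_le hα0 hα2 γ u.2
    F_abs := fun u => by simp only [powerTerm, abs_abs]
    G_abs := fun u => by simp only [powerTerm, abs_abs]
    F_pos := by
      obtain ⟨u, hu, h⟩ := exists_powerTerm_pos hα0 hα2 hαn hΩo hΩb le_rfl hα0 hq0 hqc.le hf hfpos
      exact ⟨⟨u, hu⟩, h⟩
    G_pos := by
      obtain ⟨u, hu, h⟩ := exists_powerTerm_pos hα0 hα2 hαn hΩo hΩb hs0 hsα hp0 hp.le hg hgpos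
      exact ⟨⟨u, hu⟩, h⟩ }

theorem normSq_congr {γ : ℝ} {Ω : Set (Rn n)} {u v : Rn n → ℝ} (h : u =ᵐ[volume] v) :
    normSq α γ Ω u = normSq α γ Ω v := by
  unfold normSq
  rw [gagliardo_congr h h, integral_congr_ae (g := fun x => |v x| ^ 2 / ‖x‖ ^ α)]
  filter_upwards [ae_restrict_of_ae h] with x hx
  rw [hx]

theorem powerTerm_congr {s r : ℝ} {Ω : Set (Rn n)} {h u v : Rn n → ℝ} (huv : u =ᵐ[volume] v) :
    powerTerm s r Ω h u = powerTerm s r Ω h v := by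
  refine integral_congr_ae ?_
  filter_upwards [ae_restrict_of_ae huv] with x hx
  rw [hx]

theorem normSq_zero (γ : ℝ) (Ω : Set (Rn n)) : normSq α γ Ω 0 = 0 := by
  simp [normSq, gagliardo, gagliardoIntegrand]

/-- A nonnegative nontrivial critical point is a positive solution. -/
theorem isPositiveSolution_of_critical (hα0 : 0 < α) (hα2 : α < 2) (hαn : α < n) {Ω : Set (Rn n)}
    (hΩo : IsOpen Ω) (hΩb : Bornology.IsBounded Ω) {s q p γ lam : ℝ} (hs0 : 0 ≤ s) (hsα : s < α)
    (hq1 : 1 < q) (hq : q ≤ critExp n α 0) (hp1 : 1 < p) (hp : p ≤ critExp n α s)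
    {f g : Rn n → ℝ} (hf : ContinuousOn f (closure Ω)) (hg : ContinuousOn g (closure Ω))
    {u : Rn n → ℝ} (hu : u ∈ X0 α Ω) (hu0 : ∀ x, 0 ≤ u x) (hQ : 0 < normSq α γ Ω u)
    (hcrit : ∀ v ∈ X0 α Ω, normForm α γ Ω u v - lam * powerTermDeriv 0 q Ω f u v -
      powerTermDeriv s p Ω g u v = 0) : IsPositiveSolution α s q p γ lam Ω f g u := by
  have hsol : IsWeakSolution α s q p γ lam Ω f g u := by
    refine ⟨hu, fun v hv => ?_⟩
    have h1 := (integrableOn_powerTermDeriv hα0 hα2 hαn hΩo hΩb le_rfl hα0 hf hq1 hq hu hv).1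
    have h2 := (integrableOn_powerTermDeriv hα0 hα2 hαn hΩo hΩb hs0 hsα hg hp1 hp hu hv).1
    have h3 := hcrit v hv
    unfold normForm powerTermDeriv at h3
    have e1 : (fun x => f x / ‖x‖ ^ (0 : ℝ) * (|u x| ^ (q - 2) * u x * v x)) =
        fun x => f x * |u x| ^ (q - 2) * u x * v x := by
      ext x; rw [Real.rpow_zero]; ring
    have e2 : (fun x => g x / ‖x‖ ^ s * (|u x| ^ (p - 2) * u x * v x)) =
        fun x => g x * (|u x| ^ (p - 2) * u x * v x / ‖x‖ ^ s) := by
      ext x; ring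
    rw [e1] at h1
    rw [e2] at h2
    rw [e1, e2] at h3
    exact ⟨(X0.integrable_mul_div hα0 hα2 hαn hΩo hΩb hu hv).integrableOn, h1, h2, by linarith⟩
  refine ⟨hsol, hsol.pos hα0 hα2 hαn hΩo hΩb hu0 fun h => hQ.ne' ?_⟩
  rw [normSq_congr h, normSq_zero]

end FracHardy

theorem theorem1p1 (n : ℕ) (α s q p γ : ℝ)
    (hα0 : 0 < α) (hα2 : α < 2) (hs0 : 0 ≤ s) (hsα : s < α) (hαn : α < n)
    (hq1 : 1 < q) (hq2 : q < 2) (hp2 : 2 < p) (hp : p < FracHardy.critExp n α s)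
    (hγ : γ < FracHardy.gammaH n α)
    (Ω : Set (FracHardy.Rn n)) (hΩ : FracHardy.IsSmoothBoundedDomain Ω) (h0 : 0 ∈ Ω)
    (f g : FracHardy.Rn n → ℝ)
    (hf : ContinuousOn f (closure Ω)) (hg : ContinuousOn g (closure Ω))
    (hfpos : ∃ x ∈ closure Ω, 0 < f x) (hgpos : ∃ x ∈ closure Ω, 0 < g x) :
    ∃ Λ : ℝ, 0 < Λ ∧ ∀ lam : ℝ, 0 < lam → lam < Λ →
      ∃ u₁ u₂ : FracHardy.Rn n → ℝ,
        FracHardy.IsPositiveSolution α s q p γ lam Ω f g u₁ ∧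
        FracHardy.IsPositiveSolution α s q p γ lam Ω f g u₂ ∧
        ¬ (u₁ =ᵐ[volume] u₂) ∧
        u₁ ∈ FracHardy.nehariPlus α s q p γ lam Ω f g ∧
        IsMinOn (FracHardy.energy α s q p γ lam Ω f g)
          (FracHardy.nehariPlus α s q p γ lam Ω f g) u₁ ∧
        u₂ ∈ FracHardy.nehariMinus α s q p γ lam Ω f g ∧
        IsMinOn (FracHardy.energy α s q p γ lam Ω f g)
          (FracHardy.nehariMinus α s q p γ lam Ω f g) u₂ := by
  have hΩo := hΩ.isOpen
  have hΩb := hΩ.isBounded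
  have hqc : q < FracHardy.critExp n α 0 := by
    unfold FracHardy.critExp
    rw [lt_div_iff₀ (by linarith)]
    nlinarith
  obtain ⟨Λ, hΛ, H⟩ := (FracHardy.concaveConvex_X0 hα0 hα2 hαn hΩo hΩb hs0 hsα hq1 hq2 hp2 hp hγ
    hf hg hfpos hgpos).exists_two_minimizers
  refine ⟨Λ, hΛ, fun lam hlam hlamΛ => ?_⟩
  obtain ⟨w₁, w₂, t, ht, hcrit, hd1, hmin1, hd2, hmin2⟩ := H lam hlam hlamΛ
  set u₁ : FracHardy.X0Submodule α Ω := ⟨fun x => |w₁.1 x|, (FracHardy.X0.abs_mem w₁.2).1⟩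
  set u₂ : FracHardy.X0Submodule α Ω :=
    t • ⟨fun x => |w₂.1 x|, (FracHardy.X0.abs_mem w₂.2).1⟩
  obtain ⟨hQ1, hN1, hc1⟩ := hcrit u₁ (Or.inl rfl)
  obtain ⟨hQ2, hN2, hc2⟩ := hcrit u₂ (Or.inr rfl)
  have h0₁ : ∀ x, 0 ≤ u₁.1 x := fun x => abs_nonneg _
  have h0₂ : ∀ x, 0 ≤ u₂.1 x := fun x => mul_nonneg ht.le (abs_nonneg _)
  refine ⟨u₁, u₂,
    FracHardy.isPositiveSolution_of_critical hα0 hα2 hαn hΩo hΩb hs0 hsα hq1 hqc.le (by linarith)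
      hp.le hf hg u₁.2 h0₁ hQ1 fun v hv => hc1 ⟨v, hv⟩,
    FracHardy.isPositiveSolution_of_critical hα0 hα2 hαn hΩo hΩb hs0 hsα hq1 hqc.le (by linarith)
      hp.le hf hg u₂.2 h0₂ hQ2 fun v hv => hc2 ⟨v, hv⟩, fun h => ?_,
    ⟨⟨u₁.2, ?_⟩, ?_⟩, fun v hv => ?_,
    ⟨⟨u₂.2, ?_⟩, ?_⟩, fun v hv => ?_⟩
  -- If the two solutions agreed a.e., the same Nehari derivative would be both positive and
  -- negative.
  · rw [FracHardy.normSq_congr h, FracHardy.powerTerm_congr h, FracHardy.powerTerm_congr h] at hd1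
    exact lt_asymm hd1 hd2
  · simpa only [FracHardy.nehariFun, FracHardy.concaveTerm_eq, FracHardy.convexTerm_eq] using hN1
  · simpa only [FracHardy.nehariFunDeriv, FracHardy.concaveTerm_eq, FracHardy.convexTerm_eq]
      using hd1
  · obtain ⟨⟨hvX, hv1⟩, hv2⟩ := hv
    simp only [FracHardy.nehariFun, FracHardy.nehariFunDeriv, FracHardy.concaveTerm_eq,
      FracHardy.convexTerm_eq] at hv1 hv2
    simpa only [mem_ofPred_eq, FracHardy.energy, FracHardy.concaveTerm_eq,
      FracHardy.convexTerm_eq] using hmin1 ⟨v, hvX⟩ hv1 hv2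
  · simpa only [FracHardy.nehariFun, FracHardy.concaveTerm_eq, FracHardy.convexTerm_eq] using hN2
  · simpa only [FracHardy.nehariFunDeriv, FracHardy.concaveTerm_eq, FracHardy.convexTerm_eq]
      using hd2
  · obtain ⟨⟨hvX, hv1⟩, hv2⟩ := hv
    simp only [FracHardy.nehariFun, FracHardy.nehariFunDeriv, FracHardy.concaveTerm_eq,
      FracHardy.convexTerm_eq] at hv1 hv2
    simpa only [mem_ofPred_eq, FracHardy.energy, FracHardy.concaveTerm_eq,
      FracHardy.convexTerm_eq] using hmin2 ⟨v, hvX⟩ hv1 hv2
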